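/- \textbf{Notation.} Write $\mathbf{e}(x)=e^{2\pi i x}$. A \emph{discriminant form} is a finite abelian group $D$ with a quadratic form $\gamma\mapsto\frac{\gamma^2}{2}\in\mathbb{Q}/\mathbb{Z}$ whose associated pairing $(\cdot,\cdot)$ is non-degenerate. $\mathbb{C}[D]$ has the basis $(\mathfrak{e}_\gamma)_{\gamma\in D}$, with the operators $t_\alpha\mathfrak{e}_\gamma=\mathfrak{e}_{\gamma-\alpha}$ and $\chi_\beta\mathfrak{e}_\gamma=\mathbf{e}((\beta,\gamma))\mathfrak{e}_\gamma$. $\operatorname{Mp}_2(\mathbb{Z})$ is the group of pairs $(A,\varphi)$ with $A\in\operatorname{SL}_2(\mathbb{Z})$ having bottom row $(c_A,d_A)$ and $\varphi$ a holomorphic square root of $j(A,\tau)=c_A\tau+d_A$ on $\mathcal{H}$, and $j(A,\tau)^{k}:=\varphi(\tau)^{2k}$ for $k\in\frac12\mathbb{Z}$. The Weil representation $\rho_D$ of $\operatorname{Mp}_2(\mathbb{Z})$ on $\mathbb{C}[D]$ is given on the generators $T=\big(\binom{1\ 1}{0\ 1},1\big)$ and $S_0=\big(\binom{0\ -1}{1\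 \ \,0},\sqrt{\tau}\big)$ by $\rho_D(T)\mathfrak{e}_\gamma=\mathbf{e}(\frac{\gamma^2}{2})\mathfrak{e}_\gamma$ and $\rho_D(S_0)\mathfrak{e}_\gamma=\frac{\mathbf{e}(-\operatorname{sgn}(D)/8)}{\sqrt{|D|}}\sum_{\delta\in D}\mathbf{e}(-(\gamma,\delta))\mathfrak{e}_\delta$, where $\sum_{\mu\in D}\mathbf{e}(\frac{\mu^2}{2})=\sqrt{|D|}\,\mathbf{e}(\operatorname{sgn}(D)/8)$. A function $f$ on $\mathcal{H}$ has \emph{at most linear exponential growth at the cusps} if for every $A\in\operatorname{SL}_2(\mathbb{Z})$, $|f(A\tau)|$ is bounded by the exponential of a linear function of $\operatorname{Im}\tau$ for $\operatorname{Im}\tau\ge1$ in every vertical strip $|\operatorname{Re}\tau|\le R$. \textbf{Index.} Let $\Delta$ be a discriminant form, $S$ a positive semidefinite symmetric $c_+\times c_+$ matrix over $\mathbb{Q}$ of rank $b_+$, and $\psi:\mathbb{Z}^{c_+}\to\Delta$ a group homomorphism with $\frac{(\psi a)^2}{2}=a^tSa+\mathbb{Z}$ for all $a$ and $\psi(a)=0$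 whenever $Sa=0$. Put $\Omega=\ker\psi+\ker S\subseteq\mathbb{Q}^{c_+}$, $\Omega^*=\{a\in\mathbb{Q}^{c_+}\mid 2a^tSb\in\mathbb{Z}\ \forall b\in\Omega\}\supseteq\mathbb{Z}^{c_+}$, and $D_\Omega=\Omega^*/\Omega$, a discriminant form with $\frac{(a+\Omega)^2}{2}=a^tSa+\mathbb{Z}$. Let $D_{\Omega,S}$ be the image of $\mathbb{Z}^{c_+}$ in $D_\Omega$ (it embeds into $\Delta$ via $\psi$), let $H_\Omega=D_{\Omega,S}^\perp$, so that $D_{\Omega,S}=H_\Omega^\perp$, and put \[\Theta_{\Omega,S}(\tau,z)=\sum_{a\in\Omega^*/\ker S}\mathbf{e}(\tau a^tSa+2a^tSz)\,\mathfrak{e}_{a+\Omega}\in\mathbb{C}[D_\Omega].\] \textbf{Jacobi forms.} Let $\Gamma\subseteq\operatorname{Mp}_2(\mathbb{Z})$ be a subgroup of finite index (a finite index subgroup of $\operatorname{SL}_2(\mathbb{Z})$ is replaced by its inverse image) and $k\in\frac12\mathbb{Z}$. A \emph{Jacobi form of weight $k$, representation $\rho_\Delta$ and index $(S,\psi)$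 with respect to $\Gamma$} is a smooth function $\Phi:\mathcal{H}\times\mathbb{C}^{c_+}\to\mathbb{C}[\Delta]$, holomorphic in $z$, such that \[\Phi(\tau,z+\tau u+v)=\mathbf{e}(-\tau u^tSu-2u^tSz)\,\chi_{\psi v}t_{\psi u}\Phi(\tau,z)\quad(u,v\in\mathbb{Z}^{c_+}),\] \[\Phi\big(A\tau,\tfrac{z}{j(A,\tau)}\big)=j(A,\tau)^k\,\mathbf{e}\Big(\tfrac{c_A\,z^tSz}{j(A,\tau)}\Big)\rho_\Delta(A)\Phi(\tau,z)\quad(A\in\Gamma),\] and such that the coefficients $f_{\beta,a}$ in the expansion $\Phi_\beta(\tau,z)=\sum_{a\in\Omega^*/\ker S}f_{\beta,a}(\tau)\,\mathbf{e}(\tau a^tSa+2a^tSz)$ of the components of $\Phi$ have at most linear exponential growth at the cusps. It is \emph{weakly holomorphic} if it is holomorphic in $(\tau,z)$, and \emph{holomorphic} if moreover for every $A\in\operatorname{Mp}_2(\mathbb{Z})$ the function $j(A,\tau)^{-k}\mathbf{e}\big(-\tfrac{c_Az^tSz}{j(A,\tau)}\big)\Phi\big(A\tau,\tfrac{z}{j(A,\tau)}\big)$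 has a Fourier expansion in the functions $\mathbf{e}(m\tau+2a^tSz)$ with rational $m$ and $a$ in which only terms with $m\ge a^tSa$ occur. A \emph{modular form of weight $l\in\frac12\mathbb{Z}$ and representation $\rho_D$ with respect to $\Gamma$} is a smooth function $F:\mathcal{H}\to\mathbb{C}[D]$ with $F(A\tau)=j(A,\tau)^l\rho_D(A)F(\tau)$ for $A\in\Gamma$, with components of at most linear exponential growth at the cusps. It is \emph{weakly holomorphic} if it is holomorphic on $\mathcal{H}$, and \emph{holomorphic} if moreover $j(A,\tau)^{-l}F(A\tau)$ is bounded for $\operatorname{Im}\tau\ge1$ for every $A\in\operatorname{Mp}_2(\mathbb{Z})$. \textbf{Theorem.} With $\Delta$, $S$, $\psi$, $\Gamma$, $k$ as above, assume that there are a discriminant form $D$, a subgroup $H_D\subseteq D$ and a group isomorphism $\iota:H_\Omega\to H_D$ with $\frac{\iota(\gamma)^2}{2}=-\frac{\gamma^2}{2}$, such that for the isotropic subgroup $H=\{\gamma+\iota(\gamma)\mid\gamma\in H_\Omega\}$ of $D_\Omega\oplus D$ the discriminant form $\Delta_H=H^\perp/H$ is isomorphic to $\Delta$, compatibly with the embeddings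 of $D_{\Omega,S}=H_\Omega^\perp$ into $\Delta_H$ and (by $\psi$) into $\Delta$. Let $\downarrow_H:\mathbb{C}[D_\Omega\oplus D]\to\mathbb{C}[\Delta_H]\cong\mathbb{C}[\Delta]$ send $\mathfrak{e}_\alpha$ to $\mathfrak{e}_{\alpha+H}$ if $\alpha\in H^\perp$ and to $0$ otherwise. Then for every Jacobi form $\Phi$ of weight $k$, representation $\rho_\Delta$ and index $(S,\psi)$ with respect to $\Gamma$ there is a unique modular form $F$ of weight $k-\frac{b_+}{2}$ and representation $\rho_D$ with respect to $\Gamma$ such that \[\Phi(\tau,z)=\,\downarrow_H\big(\Theta_{\Omega,S}(\tau,z)\otimes F(\tau)\big)\qquad(\tau\in\mathcal{H},\ z\in\mathbb{C}^{c_+}).\] Moreover, $F$ is weakly holomorphic if and only if $\Phi$ is, and $F$ is holomorphic if and only if $\Phi$ is. -/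

import Mathlib

open scoped MatrixGroups UpperHalfPlane ContDiff Matrix

noncomputable section

namespace JacobiMatrixIndex

/-! ### Exponentials -/

/-- `𝐞(x) = exp(2πix)` for a complex number `x`. -/
def ce (x : ℂ) : ℂ := Complex.exp (2 * Real.pi * Complex.I * x)

theorem ce_rat_periodic : Function.Periodic (fun x : ℚ => ce (x : ℂ)) 1 := by
  intro x
  simp only [ce, Rat.cast_add, Rat.cast_one, mul_add, mul_one, Complex.exp_add,
    Complex.exp_two_pi_mul_I]

/-- `𝐞(x) = exp(2πix)` for `x ∈ ℚ/ℤ`. -/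
def qe (x : AddCircle (1 : ℚ)) : ℂ := ce_rat_periodic.lift x

/-! ### The metaplectic group `Mp₂(ℤ)` -/

/-- The factor of automorphy `j(A, τ) = cτ + d`. -/
def autJ (A : SL(2, ℤ)) (τ : ℍ) : ℂ := (A 1 0 : ℂ) * τ + (A 1 1 : ℂ)

theorem autJ_eq_denom (A : SL(2, ℤ)) (τ : ℍ) :
    autJ A τ = UpperHalfPlane.denom (A : GL (Fin 2) ℝ) τ := by
  simp [autJ, UpperHalfPlane.denom]

theorem autJ_ne_zero (A : SL(2, ℤ)) (τ : ℍ) : autJ A τ ≠ 0 := by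
  rw [autJ_eq_denom]
  exact UpperHalfPlane.denom_ne_zero _ _

theorem continuous_moebius (A : SL(2, ℤ)) : Continuous fun τ : ℍ => A • τ :=
  continuous_const_smul (A : GL (Fin 2) ℝ)

theorem autJ_mul (A B : SL(2, ℤ)) (τ : ℍ) : autJ (A * B) τ = autJ A (B • τ) * autJ B τ := by
  have hB : (B 1 0 : ℂ) * τ + (B 1 1 : ℂ) ≠ 0 := autJ_ne_zero B τ
  simp only [autJ]
  rw [UpperHalfPlane.coe_specialLinearGroup_apply]
  simp only [Matrix.SpecialLinearGroup.coe_mul, Matrix.mul_apply, Fin.sum_univ_two]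
  simp only [algebraMap_int_eq, eq_intCast, Complex.ofReal_intCast]
  push_cast
  field_simp
  ring

/-- The metaplectic group: pairs of a matrix `A ∈ SL₂(ℤ)` and a continuous (equivalently,
holomorphic) square root on the upper half-plane of `τ ↦ j(A, τ)`. -/
@[ext]
structure Mp2Z where
  mat : SL(2, ℤ)
  root : ℍ → ℂ
  continuous_root : Continuous root
  sq_root : ∀ τ, root τ ^ 2 = autJ mat τ

namespace Mp2Z

theorem root_ne_zero (A : Mp2Z) (τ : ℍ) : A.root τ ≠ 0 := by
  intro h
  have := A.sq_root τ
  rw [h] at this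
  exact autJ_ne_zero A.mat τ (by simpa using this.symm)

/-- `(A, φ)(B, ψ) = (AB, φ(Bτ)ψ(τ))`. -/
instance : Mul Mp2Z where
  mul A B :=
    { mat := A.mat * B.mat
      root := fun τ => A.root (B.mat • τ) * B.root τ
      continuous_root :=
        (A.continuous_root.comp (continuous_moebius B.mat)).mul B.continuous_root
      sq_root := fun τ => by rw [mul_pow, A.sq_root, B.sq_root, autJ_mul] }

instance : One Mp2Z where
  one :=
    { mat := 1
      root := fun _ => 1
      continuous_root := continuous_const
      sq_root := fun τ => by simp [autJ] }

instance : Inv Mp2Z where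
  inv A :=
    { mat := A.mat⁻¹
      root := fun τ => (A.root (A.mat⁻¹ • τ))⁻¹
      continuous_root :=
        (A.continuous_root.comp (continuous_moebius A.mat⁻¹)).inv₀
          fun τ => A.root_ne_zero _
      sq_root := fun τ => by
        rw [inv_pow, A.sq_root]
        have h := autJ_mul A.mat A.mat⁻¹ τ
        rw [mul_inv_cancel] at h
        have h1 : autJ 1 τ = 1 := by simp [autJ]
        rw [h1] at h
        exact inv_eq_of_mul_eq_one_right h.symm }

@[simp] theorem mul_mat (A B : Mp2Z) : (A * B).mat = A.mat * B.mat := rfl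
@[simp] theorem mul_root (A B : Mp2Z) (τ : ℍ) :
    (A * B).root τ = A.root (B.mat • τ) * B.root τ := rfl
@[simp] theorem one_mat : (1 : Mp2Z).mat = 1 := rfl
@[simp] theorem one_root (τ : ℍ) : (1 : Mp2Z).root τ = 1 := rfl
@[simp] theorem inv_mat (A : Mp2Z) : (A⁻¹).mat = A.mat⁻¹ := rfl
@[simp] theorem inv_root (A : Mp2Z) (τ : ℍ) :
    (A⁻¹).root τ = (A.root (A.mat⁻¹ • τ))⁻¹ := rfl

instance : Group Mp2Z where
  mul_assoc A B C := by
    ext1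
    · simp [mul_assoc]
    · funext τ
      simp [mul_assoc, mul_smul]
  one_mul A := by
    ext1
    · simp
    · funext τ
      simp
  mul_one A := by
    ext1
    · simp
    · funext τ
      simp
  inv_mul_cancel A := by
    ext1
    · simp
    · funext τ
      simp [A.root_ne_zero]

/-- The generator `T = ((1, 1; 0, 1), 1)`. -/
def T : Mp2Z where
  mat := ModularGroup.T
  root := fun _ => 1
  continuous_root := continuous_const
  sq_root := fun τ => by simp [autJ, ModularGroup.T]

/-- The generator `S = ((0, -1; 1, 0), √τ)`, with the principal branch of the root. -/
def S : Mp2Z where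
  mat := ModularGroup.S
  root := fun τ => (τ : ℂ) ^ (1 / 2 : ℂ)
  continuous_root :=
    UpperHalfPlane.continuous_coe.cpow continuous_const fun τ => Or.inr τ.im_ne_zero
  sq_root := fun τ => by
    rw [← Complex.cpow_nat_mul]
    simp [autJ, ModularGroup.S]

end Mp2Z

/-! ### Discriminant forms and Weil representations -/

section Discriminant

variable {D : Type*} [AddCommGroup D]

/-- A finite abelian group `D` with a quadratic form `γ ↦ γ²/2 ∈ ℚ/ℤ` (here `Q`) is a
discriminant form if the pairing `(γ, δ) = QuadraticMap.polar Q γ δ` is non-degenerate. -/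
def IsDiscriminantForm (Q : QuadraticMap ℤ D (AddCircle (1 : ℚ))) : Prop :=
  Finite D ∧ ∀ γ : D, (∀ δ : D, QuadraticMap.polar Q γ δ = 0) → γ = 0

/-- The orthogonal complement `H^⊥` of a subgroup. -/
def perp (Q : QuadraticMap ℤ D (AddCircle (1 : ℚ))) (H : AddSubgroup D) : AddSubgroup D where
  carrier := {γ | ∀ η ∈ H, QuadraticMap.polar Q γ η = 0}
  zero_mem' := fun η _ => by simp
  add_mem' := fun {x y} hx hy η hη => by
    rw [QuadraticMap.polar_add_left, hx η hη, hy η hη, add_zero]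
  neg_mem' := fun {x} hx η hη => by
    rw [QuadraticMap.polar_neg_left, hx η hη, neg_zero]

/-- The translation operator `t_α : 𝔢_γ ↦ 𝔢_{γ-α}` on `ℂ[D]`, the latter being the space of
functions on `D`, with `𝔢_γ` the indicator function of `γ`. -/
def transOp (α : D) (X : D → ℂ) : D → ℂ := fun γ => X (γ + α)

/-- The character operator `χ_β : 𝔢_γ ↦ 𝐞((β, γ)) 𝔢_γ` on `ℂ[D]`. -/
def charOp (Q : QuadraticMap ℤ D (AddCircle (1 : ℚ))) (β : D) (X : D → ℂ) : D → ℂ :=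
  fun γ => qe (QuadraticMap.polar Q β γ) * X γ

variable [Fintype D]

/-- `ρ_D(T) : 𝔢_γ ↦ 𝐞(γ²/2) 𝔢_γ`. -/
def weilT (Q : QuadraticMap ℤ D (AddCircle (1 : ℚ))) : Module.End ℂ (D → ℂ) :=
  LinearMap.pi fun γ => qe (Q γ) • LinearMap.proj γ

/-- `ρ_D(S) : 𝔢_γ ↦ 𝐞(-sgn(D)/8) / √|D| · ∑_δ 𝐞(-(γ, δ)) 𝔢_δ`. The signature `sgn(D)` modulo 8
of a discriminant form is determined by `∑_μ 𝐞(μ²/2) = √|D| 𝐞(sgn(D)/8)`, so that the scalar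
is `(∑_μ 𝐞(-μ²/2)) / |D|`; if `D = L*/L` for an even lattice `L` of signature `(b₊, b₋)` then
`sgn(D) = b₊ - b₋` by Milgram's formula. -/
def weilS (Q : QuadraticMap ℤ D (AddCircle (1 : ℚ))) : Module.End ℂ (D → ℂ) :=
  LinearMap.pi fun δ => ((∑ μ : D, qe (-Q μ)) / (Fintype.card D : ℂ)) •
    ∑ γ : D, qe (-QuadraticMap.polar Q γ δ) • LinearMap.proj γ

/-- The graph of the Weil representation `ρ_D` of `Mp₂(ℤ)` on `ℂ[D]`, which is determined by the
operators `ρ_D(T)` and `ρ_D(S)`: we have `(A, U) ∈ weilGraph Q` precisely when `U = ρ_D(A)`.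
(The elements `T` and `S` generate `Mp₂(ℤ)` as a monoid, since `S ^ 8 = 1` and
`(S * T) ^ 3 = S ^ 2`.) -/
def weilGraph (Q : QuadraticMap ℤ D (AddCircle (1 : ℚ))) :
    Submonoid (Mp2Z × Module.End ℂ (D → ℂ)) :=
  Submonoid.closure {(Mp2Z.T, weilT Q), (Mp2Z.S, weilS Q)}

end Discriminant

/-! ### Vector-valued modular forms -/

/-- At most linear exponential growth of `f` towards every cusp: for each cusp `A∞`, inside
every vertical strip, `f(Aτ)` is bounded by the exponential of a linear function of `Im τ`. -/
def ExpGrowthAtCusps (f : ℍ → ℂ) : Prop :=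
  ∀ (A : SL(2, ℤ)) (R : ℝ), ∃ C : ℝ, ∀ τ : ℍ, |τ.re| ≤ R → 1 ≤ τ.im →
    ‖f (A • τ)‖ ≤ Real.exp (C * τ.im + C)

section ModularForms

variable {D : Type*} [AddCommGroup D] [Fintype D]

/-- (Smooth) modular forms of weight `κ/2` and representation `ρ_D` with respect to `Γ`. -/
structure IsModularForm (Γ : Subgroup Mp2Z) (κ : ℤ)
    (Q : QuadraticMap ℤ D (AddCircle (1 : ℚ))) (F : ℍ → D → ℂ) : Prop where
  smooth : ContDiffOn ℝ ∞ (fun τ : ℂ => F (UpperHalfPlane.ofComplex τ)) UpperHalfPlane.upperHalfPlaneSet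
  modular : ∀ A ∈ Γ, ∀ U, (A, U) ∈ weilGraph Q → ∀ τ : ℍ,
    F (A.mat • τ) = A.root τ ^ κ • U (F τ)
  growth : ∀ δ : D, ExpGrowthAtCusps fun τ => F τ δ

/-- `F` is holomorphic on the upper half-plane. A modular form with this property is called
weakly holomorphic. -/
def HolomorphicOnH (F : ℍ → D → ℂ) : Prop :=
  DifferentiableOn ℂ (fun τ : ℂ => F (UpperHalfPlane.ofComplex τ)) UpperHalfPlane.upperHalfPlaneSet

/-- `F`, of weight `κ/2`, is bounded at every cusp. A modular form that is holomorphic on the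
upper half-plane and has this property is called holomorphic. -/
def BoundedAtCusps (κ : ℤ) (F : ℍ → D → ℂ) : Prop :=
  ∀ A : Mp2Z, ∃ C : ℝ, ∀ τ : ℍ, 1 ≤ τ.im → ∀ δ : D,
    ‖A.root τ ^ (-κ) * F (A.mat • τ) δ‖ ≤ C

end ModularForms

/-! ### Jacobi forms of matrix index -/

/-- The value `xᵗSy` for complex vectors `x` and `y`. -/
def cform {c : ℕ} (S : Matrix (Fin c) (Fin c) ℚ) (x y : Fin c → ℂ) : ℂ :=
  x ⬝ᵥ (S.map (fun q : ℚ => (q : ℂ)) *ᵥ y)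

/-- The value `xᵗSy` for rational vectors `x` and `y`. -/
def qform {c : ℕ} (S : Matrix (Fin c) (Fin c) ℚ) (x y : Fin c → ℚ) : ℚ := x ⬝ᵥ (S *ᵥ y)

/-- The inclusion of `ℤ^c` into `ℚ^c`. -/
def intVec (c : ℕ) : (Fin c → ℤ) →+ (Fin c → ℚ) where
  toFun a := fun i => (a i : ℚ)
  map_zero' := by ext; simp
  map_add' a b := by ext; simp

/-- The inclusion of `ℚ^c` into `ℂ^c`. -/
def ratVec {c : ℕ} (a : Fin c → ℚ) : Fin c → ℂ := fun i => (a i : ℂ)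

variable {c : ℕ} {Δ : Type*} [AddCommGroup Δ]

/-- An index `(S, ψ)`: a positive semidefinite symmetric matrix `S` over `ℚ`, and a homomorphism
`ψ : ℤ^c → Δ` with `(ψa)²/2 = aᵗSa + ℤ` for all `a`, vanishing on the elements of `ker S`. -/
structure MatrixIndex (c : ℕ) (Q : QuadraticMap ℤ Δ (AddCircle (1 : ℚ))) where
  S : Matrix (Fin c) (Fin c) ℚ
  posSemidef : S.PosSemidef
  ψ : (Fin c → ℤ) →+ Δ
  quad_ψ : ∀ a : Fin c → ℤ,
    Q (ψ a) = ((qform S (intVec c a) (intVec c a) : ℚ) : AddCircle (1 : ℚ))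
  ψ_ker : ∀ a : Fin c → ℤ, S *ᵥ intVec c a = 0 → ψ a = 0

namespace MatrixIndex

variable {Q : QuadraticMap ℤ Δ (AddCircle (1 : ℚ))} (I : MatrixIndex c Q)

/-! #### The groups `Ω ⊆ Ω*` and the discriminant form `D_Ω` -/

/-- The kernel of `S` on `ℚ^c`. -/
def kerS : AddSubgroup (Fin c → ℚ) := (LinearMap.ker I.S.mulVecLin).toAddSubgroup

/-- `Ω = ker ψ + ker S ⊆ ℚ^c`. -/
def omega : AddSubgroup (Fin c → ℚ) := I.ψ.ker.map (intVec c) ⊔ I.kerS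

theorem qform_add_right (S : Matrix (Fin c) (Fin c) ℚ) (x y z : Fin c → ℚ) :
    qform S x (y + z) = qform S x y + qform S x z := by
  simp [qform, Matrix.mulVec_add, dotProduct_add]

theorem qform_add_left (S : Matrix (Fin c) (Fin c) ℚ) (x y z : Fin c → ℚ) :
    qform S (x + y) z = qform S x z + qform S y z := by
  simp [qform, add_dotProduct]

theorem qform_comm (x y : Fin c → ℚ) : qform I.S x y = qform I.S y x := by
  have h : I.Sᵀ = I.S := by
    have := I.posSemidef.isHermitian
    ext i j
    exact congrFun (congrFun this i) j
  unfold qform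
  rw [Matrix.dotProduct_mulVec, dotProduct_comm, ← Matrix.mulVec_transpose, h]

theorem mem_kerS {x : Fin c → ℚ} : x ∈ I.kerS ↔ I.S *ᵥ x = 0 := by
  simp [kerS]

theorem qform_kerS {x k : Fin c → ℚ} (hk : k ∈ I.kerS) : qform I.S x k = 0 := by
  rw [mem_kerS] at hk
  simp [qform, hk]

/-- `Ω* = {a ∈ ℚ^c | 2aᵗSb ∈ ℤ for all b ∈ Ω}`, the inverse image of the dual lattice `L*` of
`L = Ω / ker S ⊆ V = ℚ^c / ker S`, where `V` carries the quadratic form `a ↦ aᵗSa`. -/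
def omegaDual : AddSubgroup (Fin c → ℚ) where
  carrier := {a | ∀ b ∈ I.omega, ∃ n : ℤ, 2 * qform I.S a b = n}
  zero_mem' := fun b _ => ⟨0, by simp [qform]⟩
  add_mem' := fun {x y} hx hy b hb => by
    obtain ⟨m, hm⟩ := hx b hb
    obtain ⟨n, hn⟩ := hy b hb
    exact ⟨m + n, by rw [qform_add_left, mul_add, hm, hn]; push_cast; rfl⟩
  neg_mem' := fun {x} hx b hb => by
    obtain ⟨m, hm⟩ := hx b hb
    exact ⟨-m, by rw [qform, neg_dotProduct, mul_neg, ← qform, hm]; push_cast; rfl⟩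

/-- `D_Ω = Ω*/Ω`, which is isomorphic to `D_L = L*/L`. -/
abbrev DOmega : Type := I.omegaDual ⧸ I.omega.addSubgroupOf I.omegaDual

theorem circle_coe_eq_zero {x : ℚ} : ((x : AddCircle (1 : ℚ)) = 0) ↔ ∃ n : ℤ, x = n := by
  rw [AddCircle.coe_eq_zero_iff]
  constructor
  · rintro ⟨n, hn⟩
    exact ⟨n, by rw [← hn]; simp⟩
  · rintro ⟨n, hn⟩
    exact ⟨n, by rw [hn]; simp⟩

theorem qform_omega {b : Fin c → ℚ} (hb : b ∈ I.omega) : ∃ n : ℤ, qform I.S b b = n := by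
  obtain ⟨y, hy, k, hk, rfl⟩ := AddSubgroup.mem_sup.1 hb
  obtain ⟨a, ha, rfl⟩ := AddSubgroup.mem_map.1 hy
  rw [qform_add_left, qform_add_right, I.qform_comm k, I.qform_kerS hk, add_zero,
    I.qform_kerS hk, add_zero]
  rw [← circle_coe_eq_zero, ← I.quad_ψ, (AddMonoidHom.mem_ker).1 ha, QuadraticMap.map_zero]

/-- The class of `aᵗSa` in `ℚ/ℤ`. -/
def circleQ (a : I.omegaDual) : AddCircle (1 : ℚ) :=
  ((qform I.S a.1 a.1 : ℚ) : AddCircle (1 : ℚ))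

theorem circleQ_add (a b : I.omegaDual) :
    I.circleQ (a + b) = I.circleQ a + I.circleQ b +
      ((2 * qform I.S a.1 b.1 : ℚ) : AddCircle (1 : ℚ)) := by
  simp only [circleQ, ← AddCircle.coe_add]
  congr 1
  rw [AddSubgroup.coe_add, qform_add_left, qform_add_right, qform_add_right,
    I.qform_comm b.1 a.1]
  ring

theorem circleQ_congr (a b : I.omegaDual) (h : -a + b ∈ I.omega.addSubgroupOf I.omegaDual) :
    I.circleQ a = I.circleQ b := by
  obtain ⟨x, rfl⟩ : ∃ x, b = a + x := ⟨-a + b, by abel⟩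
  rw [neg_add_cancel_left, AddSubgroup.mem_addSubgroupOf] at h
  have h1 : I.circleQ x = 0 := circle_coe_eq_zero.2 (I.qform_omega h)
  have h2 : ((2 * qform I.S a.1 x.1 : ℚ) : AddCircle (1 : ℚ)) = 0 :=
    circle_coe_eq_zero.2 (a.2 x.1 h)
  rw [circleQ_add, h1, h2, add_zero, add_zero]

/-- The quadratic form on `D_Ω`, as a function. -/
def quadFun (γ : I.DOmega) : AddCircle (1 : ℚ) :=
  Quotient.liftOn' γ I.circleQ fun a b h =>
    I.circleQ_congr a b (QuotientAddGroup.leftRel_apply.1 h)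

theorem quadFun_mk (a : I.omegaDual) : I.quadFun (QuotientAddGroup.mk a) = I.circleQ a := rfl

theorem polar_quadFun (a b : I.omegaDual) :
    QuadraticMap.polar I.quadFun (QuotientAddGroup.mk a) (QuotientAddGroup.mk b) =
      ((2 * qform I.S a.1 b.1 : ℚ) : AddCircle (1 : ℚ)) := by
  rw [QuadraticMap.polar, ← QuotientAddGroup.mk_add, quadFun_mk, quadFun_mk, quadFun_mk,
    circleQ_add]
  abel

theorem coe_zsmul_vec (n : ℤ) (a : I.omegaDual) : ((n • a : I.omegaDual) : Fin c → ℚ) =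
    (n : ℚ) • a.1 := by
  rw [AddSubgroup.coe_zsmul]
  ext i
  simp

/-- The quadratic form `a + Ω ↦ aᵗSa + ℤ` on `D_Ω`, whose pairing is `2aᵗSb + ℤ`. -/
def quad : QuadraticMap ℤ I.DOmega (AddCircle (1 : ℚ)) :=
  QuadraticMap.ofPolar I.quadFun
    (fun n γ => by
      induction γ using QuotientAddGroup.induction_on with
      | H a =>
        rw [← QuotientAddGroup.mk_zsmul, quadFun_mk, quadFun_mk, circleQ, circleQ,
          ← AddCircle.coe_zsmul, coe_zsmul_vec]
        congr 1
        simp [qform, Matrix.mulVec_smul, mul_assoc])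
    (fun x y z => by
      induction x using QuotientAddGroup.induction_on with
      | H a =>
        induction y using QuotientAddGroup.induction_on with
        | H b =>
          induction z using QuotientAddGroup.induction_on with
          | H d =>
            rw [← QuotientAddGroup.mk_add, polar_quadFun, polar_quadFun, polar_quadFun,
              ← AddCircle.coe_add, AddSubgroup.coe_add, qform_add_left, mul_add])
    (fun n x y => by
      induction x using QuotientAddGroup.induction_on with
      | H a =>
        induction y using QuotientAddGroup.induction_on with
        | H b =>
          rw [← QuotientAddGroup.mk_zsmul, polar_quadFun, polar_quadFun, ← AddCircle.coe_zsmul,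
            coe_zsmul_vec]
          congr 1
          simp [qform]
          ring)

theorem intVec_mem_omegaDual (u : Fin c → ℤ) : intVec c u ∈ I.omegaDual := by
  intro b hb
  obtain ⟨y, hy, k, hk, rfl⟩ := AddSubgroup.mem_sup.1 hb
  obtain ⟨a, ha, rfl⟩ := AddSubgroup.mem_map.1 hy
  rw [qform_add_right, I.qform_kerS hk, add_zero, ← circle_coe_eq_zero]
  have h1 := I.quad_ψ (u + a)
  have h2 := I.quad_ψ u
  have h3 := I.quad_ψ a
  rw [map_add, (AddMonoidHom.mem_ker).1 ha, add_zero, h2, map_add, qform_add_left,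
    qform_add_right, qform_add_right, I.qform_comm (intVec c a) (intVec c u)] at h1
  rw [(AddMonoidHom.mem_ker).1 ha, QuadraticMap.map_zero] at h3
  have h4 : qform I.S (intVec c u) (intVec c u) + qform I.S (intVec c u) (intVec c a) +
      (qform I.S (intVec c u) (intVec c a) + qform I.S (intVec c a) (intVec c a)) =
      qform I.S (intVec c u) (intVec c u) + 2 * qform I.S (intVec c u) (intVec c a) +
        qform I.S (intVec c a) (intVec c a) := by ring
  rw [h4, AddCircle.coe_add, AddCircle.coe_add, ← h3, add_zero] at h1
  simpa using h1.symm

/-- The map `ℤ^c → D_Ω`. -/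
def intClass : (Fin c → ℤ) →+ I.DOmega :=
  (QuotientAddGroup.mk' _).comp ((intVec c).codRestrict I.omegaDual I.intVec_mem_omegaDual)

/-- The subgroup `H_Ω = D_{Ω,S}^⊥` of `D_Ω`, with `D_{Ω,S}` the image of `ℤ^c` in `D_Ω`. -/
def HOmega : AddSubgroup I.DOmega := perp I.quad I.intClass.range

/-! #### The horizontal subgroup `H` and the quotient `Δ_H` -/

section Gluing

variable {D : Type*} [AddCommGroup D] (QD : QuadraticMap ℤ D (AddCircle (1 : ℚ)))
  {HD : AddSubgroup D} (ι : I.HOmega ≃+ HD)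

/-- The horizontal subgroup `H = {γ + ι(γ) | γ ∈ H_Ω}` of `D_Ω ⊕ D`. -/
def glue : AddSubgroup (I.DOmega × D) :=
  (I.HOmega.subtype.prod (HD.subtype.comp ι.toAddMonoidHom)).range

/-- `H^⊥ ⊆ D_Ω ⊕ D`. -/
def gluePerp : AddSubgroup (I.DOmega × D) := perp (I.quad.prod QD) (I.glue ι)

/-- `Δ_H = H^⊥/H`. -/
abbrev DeltaH : Type _ := I.gluePerp QD ι ⧸ (I.glue ι).addSubgroupOf (I.gluePerp QD ι)

/-- The projection `H^⊥ → Δ_H`. -/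
def toDeltaH (α : I.gluePerp QD ι) : I.DeltaH QD ι := QuotientAddGroup.mk α

theorem intClass_mem_gluePerp (u : Fin c → ℤ) : (I.intClass u, (0 : D)) ∈ I.gluePerp QD ι := by
  rintro _ ⟨γ, rfl⟩
  have h := γ.2 _ (AddMonoidHom.mem_range.2 ⟨u, rfl⟩)
  rw [QuadraticMap.polar_comm] at h
  rw [QuadraticMap.polar_prod]
  simp [h]

/-- The embedding of `D_{Ω,S} = H_Ω^⊥` into `Δ_H`, composed with the map `ℤ^c → D_{Ω,S}`. -/
def intToDeltaH (u : Fin c → ℤ) : I.DeltaH QD ι :=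
  I.toDeltaH QD ι ⟨(I.intClass u, 0), I.intClass_mem_gluePerp QD ι u⟩

/-- The arrow operator `↓_H : ℂ[D_Ω ⊕ D] → ℂ[Δ_H]`, taking `𝔢_α` to `𝔢_{α+H}` if `α ∈ H^⊥` and
to `0` otherwise, followed by the map `ℂ[Δ_H] → ℂ[Δ]` induced by an identification of `Δ_H`
with `Δ`. The sum is over a subset of the finite group `D_Ω ⊕ D`. -/
def arrowDown (e : I.DeltaH QD ι ≃+ Δ) (X : I.DOmega × D → ℂ) : Δ → ℂ :=
  fun β => ∑ᶠ α : {α : I.gluePerp QD ι // e (I.toDeltaH QD ι α) = β}, X α.1.1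

end Gluing

/-! #### The theta function -/

theorem kerS_le_omega : I.kerS ≤ I.omega := le_sup_right

theorem ratVec_add (a b : Fin c → ℚ) : ratVec (a + b) = ratVec a + ratVec b := by
  ext i
  simp [ratVec]

theorem cform_ratVec (S : Matrix (Fin c) (Fin c) ℚ) (a b : Fin c → ℚ) :
    cform S (ratVec a) (ratVec b) = (qform S a b : ℂ) := by
  simp [cform, qform, ratVec, dotProduct, Matrix.mulVec]

/-- `Ω̄* = Ω*/ker S`, which is the dual lattice `L* ⊆ V`. -/
abbrev OmegaBarDual : Type := I.omegaDual ⧸ I.kerS.addSubgroupOf I.omegaDual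

/-- The projection from `Ω̄*` to `D_Ω`. -/
def barToD : I.OmegaBarDual →+ I.DOmega :=
  QuotientAddGroup.map _ _ (AddMonoidHom.id _) (fun _ hx => I.kerS_le_omega hx)

/-- `𝐞(τ aᵗSa + 2aᵗSz)` for `a ∈ ℚ^c`. -/
def thetaExp (τ : ℍ) (z : Fin c → ℂ) (a : Fin c → ℚ) : ℂ :=
  ce ((τ : ℂ) * (qform I.S a a : ℂ) + 2 * cform I.S (ratVec a) z)

theorem cform_kerS {k : Fin c → ℚ} (hk : k ∈ I.kerS) (z : Fin c → ℂ) :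
    cform I.S (ratVec k) z = 0 := by
  have h : ∀ i, cform I.S (ratVec k) (Pi.single i 1) = 0 := fun i => by
    have h1 : (Pi.single i 1 : Fin c → ℂ) = ratVec (Pi.single i 1) := by
      ext j
      by_cases hj : j = i <;> simp [ratVec, hj]
    rw [h1, cform_ratVec, I.qform_comm, I.qform_kerS hk, Rat.cast_zero]
  have h2 : ∀ x : Fin c → ℂ, cform I.S x z = ∑ i, z i * cform I.S x (Pi.single i 1) := fun x => by
    simp only [cform]
    conv_lhs => rw [Matrix.dotProduct_mulVec, dotProduct_comm]
    simp [Matrix.vecMul, dotProduct]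
  rw [h2]
  simp [h]

theorem thetaExp_congr (τ : ℍ) (z : Fin c → ℂ) (a k : Fin c → ℚ) (hk : k ∈ I.kerS) :
    I.thetaExp τ z (a + k) = I.thetaExp τ z a := by
  have h1 : qform I.S (a + k) (a + k) = qform I.S a a := by
    rw [qform_add_right, I.qform_kerS hk, add_zero, I.qform_comm, qform_add_right,
      I.qform_kerS hk, add_zero]
  have h2 : cform I.S (ratVec (a + k)) z = cform I.S (ratVec a) z := by
    rw [ratVec_add, cform, add_dotProduct, ← cform, ← cform, I.cform_kerS hk, add_zero]
  rw [thetaExp, thetaExp, h1, h2]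

/-- The summand `𝐞(τ aᵗSa + 2aᵗSz)` of the theta function as a function of `a ∈ Ω̄*`. -/
def thetaTerm (τ : ℍ) (z : Fin c → ℂ) (a : I.OmegaBarDual) : ℂ :=
  Quotient.liftOn' a (fun x => I.thetaExp τ z x.1) fun x y h => by
    have hk := AddSubgroup.mem_addSubgroupOf.1 (QuotientAddGroup.leftRel_apply.1 h)
    have hy : y.1 = x.1 + (-x + y : I.omegaDual).1 := by simp
    rw [hy, I.thetaExp_congr τ z _ _ hk]

/-- The theta function
`Θ_{Ω,S}(τ, z) = ∑_{γ ∈ D_Ω} [∑_{a ∈ γ + Ω, a mod ker S} 𝐞(τ aᵗSa + 2aᵗSz)] 𝔢_γ`. -/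
def theta (τ : ℍ) (z : Fin c → ℂ) (γ : I.DOmega) : ℂ :=
  ∑' a : {a : I.OmegaBarDual // I.barToD a = γ}, I.thetaTerm τ z a.1

/-! #### Jacobi forms -/

variable [Fintype Δ]

/-- The coefficient `f_{β,a}(τ)` in the theta expansion
`Φ_β(τ, z) = ∑_{a ∈ Ω*/ker S} f_{β,a}(τ) 𝐞(τ aᵗSa + 2aᵗSz)`, i.e. the Fourier coefficient
of `Φ_β` at `𝐞(2aᵗSz)` divided by `𝐞(τ aᵗSa)`. For the Fourier coefficient we integrate over
the real torus with period lattice `N ℤ^c`, where `N = |Δ|`; this lattice is contained in the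
period lattice `ker ψ` of `Φ`. -/
def thetaCoeff (Φ : ℍ → (Fin c → ℂ) → Δ → ℂ) (β : Δ) (a : Fin c → ℚ) (τ : ℍ) : ℂ :=
  ce (-((τ : ℂ) * (qform I.S a a : ℂ))) *
    ∫ x in (Set.Icc 0 1 : Set (Fin c → ℝ)),
      Φ τ (fun i => (Fintype.card Δ : ℂ) * (x i : ℂ)) β *
        ce (-(2 * cform I.S (ratVec a) (fun i => (Fintype.card Δ : ℂ) * (x i : ℂ))))

/-- Jacobi forms of weight `κ/2`, representation `ρ_Δ` and index `(S, ψ)` with respect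
to `Γ`. -/
structure IsJacobiForm (Γ : Subgroup Mp2Z) (κ : ℤ) (Φ : ℍ → (Fin c → ℂ) → Δ → ℂ) : Prop where
  smooth : ContDiffOn ℝ ∞ (fun p : ℂ × (Fin c → ℂ) => Φ (UpperHalfPlane.ofComplex p.1) p.2)
    (UpperHalfPlane.upperHalfPlaneSet ×ˢ Set.univ)
  holo : ∀ τ : ℍ, Differentiable ℂ (Φ τ)
  periodic : ∀ (τ : ℍ) (z : Fin c → ℂ) (u v : Fin c → ℤ),
    Φ τ (fun i => z i + τ * (u i : ℂ) + (v i : ℂ)) =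
      ce (-((τ : ℂ) * (qform I.S (intVec c u) (intVec c u) : ℂ)) -
          2 * cform I.S (ratVec (intVec c u)) z) •
        charOp Q (I.ψ v) (transOp (I.ψ u) (Φ τ z))
  modular : ∀ A ∈ Γ, ∀ U, (A, U) ∈ weilGraph Q → ∀ (τ : ℍ) (z : Fin c → ℂ),
    Φ (A.mat • τ) ((autJ A.mat τ)⁻¹ • z) =
      (A.root τ ^ κ * ce ((A.mat 1 0 : ℂ) * cform I.S z z / autJ A.mat τ)) • U (Φ τ z)
  growth : ∀ β : Δ, ∀ a ∈ I.omegaDual, ExpGrowthAtCusps (I.thetaCoeff Φ β a)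

end MatrixIndex

/-- `Φ` is holomorphic in all its variables. A Jacobi form with this property is called weakly
holomorphic. -/
def JointlyHolomorphic [Fintype Δ] (Φ : ℍ → (Fin c → ℂ) → Δ → ℂ) : Prop :=
  DifferentiableOn ℂ (fun p : ℂ × (Fin c → ℂ) => Φ (UpperHalfPlane.ofComplex p.1) p.2)
    (UpperHalfPlane.upperHalfPlaneSet ×ˢ Set.univ)

namespace MatrixIndex

variable {Q : QuadraticMap ℤ Δ (AddCircle (1 : ℚ))} (I : MatrixIndex c Q)

/-- The slash operator
`(Φ|A)(τ, z) = j(A, τ)^{-κ/2} 𝐞(-j'_A zᵗSz / j(A, τ)) Φ(Aτ, z / j(A, τ))`. -/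
def slash (κ : ℤ) (Φ : ℍ → (Fin c → ℂ) → Δ → ℂ) (A : Mp2Z) :
    ℍ → (Fin c → ℂ) → Δ → ℂ := fun τ z =>
  (A.root τ ^ (-κ) * ce (-((A.mat 1 0 : ℂ) * cform I.S z z / autJ A.mat τ))) •
    Φ (A.mat • τ) ((autJ A.mat τ)⁻¹ • z)

/-- The condition on the Fourier coefficients in the definition of holomorphic Jacobi forms, at
every cusp: for every `A`, the function `Φ|A` has a Fourier expansion
`∑_{m, r} c(m, r) 𝐞(mτ + rᵗz)` in which `c(m, r) ≠ 0` only if `r = 2Sa` and `m ≥ aᵗSa` for some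
rational vector `a` (where `aᵗSa = λ²/2` for the vector `λ ∈ V` represented by `a`). -/
def HolomorphicAtCusps (κ : ℤ) (Φ : ℍ → (Fin c → ℂ) → Δ → ℂ) : Prop :=
  ∀ (A : Mp2Z) (β : Δ), ∃ coef : ℚ × (Fin c → ℚ) → ℂ,
    (∀ m r, coef (m, r) ≠ 0 → ∃ a : Fin c → ℚ, r = (2 : ℚ) • (I.S *ᵥ a) ∧ qform I.S a a ≤ m) ∧
    ∀ (τ : ℍ) (z : Fin c → ℂ),
      HasSum (fun p : ℚ × (Fin c → ℚ) =>
        coef p * ce ((p.1 : ℂ) * τ + ∑ i, (p.2 i : ℂ) * z i)) (I.slash κ Φ A τ z β)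

end MatrixIndex

end JacobiMatrixIndex

end

open JacobiMatrixIndex

open scoped MatrixGroups UpperHalfPlane ContDiff Matrix

noncomputable section

namespace JacobiMatrixIndex

/-! ### Exponentials -/

/-! Fix τ. Then Φ(τ, ·) is entire and periodic under |Δ|ℤ^c, so it has a Fourier series. The law for
translations by τu shows that the coefficients, divided by 𝐞(τ aᵗSa), depend only on the class of a
modulo Ω, so Φ_β = ∑_γ f_{β,γ}(τ) θ_γ(τ, z) with γ ∈ D_Ω (`IsElliptic.exists_theta_expansion`).
Moreover f_{β,γ} is invariant under simultaneous translation of β by ψu and of γ by the class of u,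
and it vanishes unless β and γ pair alike with ℤ^c. The support condition says that some (γ, δ) ∈
H^⊥ lies above β, and δ is unique because H is a graph. The invariance says that the value depends
on δ alone, because elements of H^⊥ over the same δ differ by H_Ω^⊥ = D_{Ω,S}. Hence F_δ = f_{β,γ}
is well defined and Φ is the arrow image of Θ ⊗ F (`IsElliptic.exists_arrow_eq`).

Uniqueness is linear independence of the θ_γ(τ, ·) (`eq_zero_of_sum_theta`) plus the fact that every
δ occurs in H^⊥; together they give `eq_of_arrow_theta_eq`. Modularity of F follows by cancelling Θ:
Θ transforms with weight b₊/2 under the Weil representation of D_Ω (`theta_modular`), and the arrow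
intertwines the tensor product with ρ_Δ (`exists_weil_compat`).

The law for Θ is reduced to dimension one. An orthogonal basis of integral vectors in ker ψ
(`nonempty_frame`) makes θ_γ a finite sum of products of Jacobi theta functions, whose functional
equation and a character sum yield the inversion up to a constant. The constant is found by
evaluating along two routes between the primitive sixth and third roots of unity in the upper
half-plane, so Milgram's formula is not needed. The inversion also yields the non-degeneracy of D_Ω.

For smoothness and holomorphy, F_δ θ_γ is a finite combination of translates of Φ, and one divides
by θ_γ near a point where it is non-zero. At a cusp, a bounded holomorphic F|A has a q-expansion
with non-negative exponents, and multiplying by theta terms gives exponents m ≥ aᵗSa. Conversely, a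
Fourier integral based at z = -τa bounds the components of F|A, because m - rᵗa + aᵗSa is
non-negative after completing the square.

The Weil representation enters only as the relation `weilGraph`. Its single-valuedness is never
needed: every operator over 1 fixes the values of F, since 1 ∈ Γ. -/

theorem ce_add (x y : ℂ) : ce (x + y) = ce x * ce y := by
  simp only [ce, mul_add, Complex.exp_add]

@[simp] theorem ce_zero : ce 0 = 1 := by simp [ce]

theorem ce_ne_zero (x : ℂ) : ce x ≠ 0 := Complex.exp_ne_zero _

theorem ce_neg (x : ℂ) : ce (-x) = (ce x)⁻¹ := by
  rw [ce, ce, mul_neg, Complex.exp_neg]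

theorem ce_sum {ι : Type*} (s : Finset ι) (f : ι → ℂ) : ce (∑ i ∈ s, f i) = ∏ i ∈ s, ce (f i) := by
  simp only [ce, Finset.mul_sum, Complex.exp_sum]

@[simp] theorem ce_intCast (n : ℤ) : ce n = 1 := by
  rw [ce, mul_comm]; exact Complex.exp_int_mul_two_pi_mul_I n

theorem norm_ce (x : ℂ) : ‖ce x‖ = Real.exp (-(2 * Real.pi * x.im)) := by
  rw [ce, Complex.norm_exp]
  congr 1
  simp

theorem ce_eq_one_iff {x : ℂ} : ce x = 1 ↔ ∃ n : ℤ, x = n := by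
  rw [ce, Complex.exp_eq_one_iff]
  refine exists_congr fun n => ?_
  rw [mul_comm (n : ℂ)]
  exact mul_right_inj' Complex.two_pi_I_ne_zero

theorem continuous_ce : Continuous ce := by unfold ce; fun_prop

theorem differentiable_ce : Differentiable ℂ ce := by unfold ce; fun_prop

@[simp] theorem qe_coe (x : ℚ) : qe (x : AddCircle (1 : ℚ)) = ce (x : ℂ) := rfl

theorem qe_add (x y : AddCircle (1 : ℚ)) : qe (x + y) = qe x * qe y := by
  induction x using QuotientAddGroup.induction_on with
  | H x =>
    induction y using QuotientAddGroup.induction_on with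
    | H y =>
      have : ((x : AddCircle (1 : ℚ)) + (y : AddCircle (1 : ℚ))) = ((x + y : ℚ) : AddCircle (1 : ℚ)) := rfl
      rw [this]
      exact (by push_cast; rw [ce_add] : ce ((x + y : ℚ) : ℂ) = ce x * ce y)

@[simp] theorem qe_zero : qe 0 = 1 := by
  have : qe ((0 : ℚ) : AddCircle (1 : ℚ)) = 1 := by rw [qe_coe, Rat.cast_zero, ce_zero]
  rwa [AddCircle.coe_zero] at this

theorem qe_ne_zero (x : AddCircle (1 : ℚ)) : qe x ≠ 0 := by
  intro h
  have := qe_add x (-x)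
  rw [h, zero_mul, add_neg_cancel, qe_zero] at this
  exact one_ne_zero this

theorem qe_neg (x : AddCircle (1 : ℚ)) : qe (-x) = (qe x)⁻¹ := by
  apply eq_inv_of_mul_eq_one_left
  rw [← qe_add, neg_add_cancel, qe_zero]

theorem qe_eq_one_iff {x : AddCircle (1 : ℚ)} : qe x = 1 ↔ x = 0 := by
  induction x using QuotientAddGroup.induction_on with
  | H x =>
    refine Iff.trans (?_ : ce (x : ℂ) = 1 ↔ _) (MatrixIndex.circle_coe_eq_zero (x := x)).symm
    rw [ce_eq_one_iff]
    refine exists_congr fun n => ?_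
    exact_mod_cast Iff.rfl

theorem qe_injective : Function.Injective qe := by
  intro x y h
  rw [← sub_eq_zero, ← qe_eq_one_iff, sub_eq_add_neg, qe_add, qe_neg, h, mul_inv_cancel₀ (qe_ne_zero y)]

/-! ### Character sums on discriminant forms -/

open QuadraticMap (polar)

/-- Translating the variable by y multiplies the sum by `qe (f y)`; one such factor different from 1
forces the sum to vanish. -/
theorem sum_qe_addMonoidHom {G : Type*} [AddCommGroup G] [Fintype G]
    (f : G →+ AddCircle (1 : ℚ)) [Decidable (∀ x, f x = 0)] :
    ∑ x, qe (f x) = if ∀ x, f x = 0 then (Fintype.card G : ℂ) else 0 := by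
  split_ifs with h
  · simp [h]
  · push Not at h
    obtain ⟨y, hy⟩ := h
    have h1 : ∑ x, qe (f x) = qe (f y) * ∑ x, qe (f x) := by
      rw [Finset.mul_sum]
      refine (Fintype.sum_equiv (Equiv.addLeft y) _ _ fun x => ?_).symm
      rw [← qe_add, ← map_add]; rfl
    have h2 : qe (f y) ≠ 1 := fun h => hy (qe_eq_one_iff.1 h)
    have h3 : (qe (f y) - 1) * ∑ x, qe (f x) = 0 := by rw [sub_mul, ← h1, one_mul, sub_self]
    exact (mul_eq_zero.1 h3).resolve_left (sub_ne_zero.2 h2)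

section

variable {M : Type*} [AddCommGroup M] (Q : QuadraticMap ℤ M (AddCircle (1 : ℚ)))

/-- The pairing with a fixed element as a homomorphism. -/
def pairing (x : M) : M →+ AddCircle (1 : ℚ) where
  toFun y := polar Q x y
  map_zero' := by simp
  map_add' y z := QuadraticMap.polar_add_right Q x y z

@[simp] theorem pairing_apply (x y : M) : pairing Q x y = polar Q x y := rfl

theorem mem_perp {H : AddSubgroup M} {x : M} : x ∈ perp Q H ↔ ∀ η ∈ H, polar Q x η = 0 := Iff.rfl

theorem qe_quad_add (x y : M) : qe (Q (x + y)) = qe (Q x) * qe (Q y) * qe (polar Q x y) := by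
  rw [← qe_add, ← qe_add, QuadraticMap.polar]
  congr 1
  abel

theorem sum_qe_polar [Fintype M] (hQ : IsDiscriminantForm Q) [DecidableEq M] (x : M) :
    ∑ y, qe (polar Q x y) = if x = 0 then (Fintype.card M : ℂ) else 0 := by
  classical
  have := sum_qe_addMonoidHom (pairing Q x)
  simp only [pairing_apply] at this
  rw [this]
  refine if_congr ⟨hQ.2 x, ?_⟩ rfl rfl
  rintro rfl y
  simp

theorem sum_qe_polar_subgroup (H : AddSubgroup M) [Fintype H] [Decidable (x ∈ perp Q H)] :
    ∑ h : H, qe (polar Q x h) = if x ∈ perp Q H then (Fintype.card H : ℂ) else 0 := by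
  classical
  have := sum_qe_addMonoidHom ((pairing Q x).comp H.subtype)
  simp only [AddMonoidHom.comp_apply, pairing_apply, AddSubgroup.subtype_apply] at this
  rw [this]
  refine if_congr ?_ rfl rfl
  rw [mem_perp]
  exact ⟨fun h η hη => h ⟨η, hη⟩, fun h η => h η η.2⟩

/-- The sum of 𝐞((x, h)) over M × H is evaluated in both orders. -/
theorem card_mul_card_perp [Fintype M] (hQ : IsDiscriminantForm Q) (H : AddSubgroup M) :
    Nat.card H * Nat.card (perp Q H) = Nat.card M := by
  classical
  have e1 : ∑ x : M, ∑ h : H, qe (polar Q x h) = Nat.card H * Nat.card (perp Q H) := by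
    simp_rw [sum_qe_polar_subgroup]
    rw [← Finset.sum_filter, Finset.sum_const, nsmul_eq_mul, mul_comm, Nat.card_eq_fintype_card,
      Nat.card_eq_fintype_card]
    congr 2
    exact (Fintype.card_of_subtype _ (by simp)).symm
  have e2 : ∑ x : M, ∑ h : H, qe (polar Q x h) = Nat.card M := by
    rw [Finset.sum_comm]
    have : ∀ h : H, ∑ x : M, qe (polar Q x h) = if h = 0 then (Fintype.card M : ℂ) else 0 :=
      fun h => by
        simp_rw [QuadraticMap.polar_comm Q _ (h : M)]
        rw [sum_qe_polar Q hQ]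
        simp only [ZeroMemClass.coe_eq_zero]
    simp_rw [this]
    simp
  exact_mod_cast e1.symm.trans e2

theorem perp_perp [Fintype M] (hQ : IsDiscriminantForm Q) (H : AddSubgroup M) : perp Q (perp Q H) = H := by
  have h1 := card_mul_card_perp Q hQ H
  have h2 := card_mul_card_perp Q hQ (perp Q H)
  have h3 : 0 < Nat.card (perp Q H) := Nat.card_pos
  have h4 : Nat.card (perp Q (perp Q H)) = Nat.card H := by
    rw [← h1, mul_comm] at h2
    exact Nat.eq_of_mul_eq_mul_right h3 h2
  have h5 : H ≤ perp Q (perp Q H) := fun x hx y hy => by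
    rw [QuadraticMap.polar_comm]; exact hy x hx
  exact (AddSubgroup.eq_of_le_of_card_ge h5 h4.le).symm

/-- After the substitution y ↦ y - x the inner sum becomes a character sum. This later turns the
inverse of a Gauss sum into the scalar of `weilS`. -/
theorem gaussSum_mul_conj [Fintype M] (hQ : IsDiscriminantForm Q) :
    (∑ x, qe (Q x)) * ∑ x, qe (-Q x) = Fintype.card M := by
  classical
  rw [mul_comm, Finset.sum_mul_sum]
  have : ∀ x, ∑ y, qe (-Q x) * qe (Q y) = ∑ y, qe (Q y) * qe (polar Q y x) := fun x => by
    refine Fintype.sum_equiv (Equiv.subRight x) _ _ fun y => ?_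
    have := qe_quad_add Q (y - x) x
    rw [sub_add_cancel] at this
    simp only [Equiv.subRight_apply]
    rw [this, qe_neg]
    field_simp [qe_ne_zero]
  simp_rw [this]
  rw [Finset.sum_comm]
  simp_rw [← Finset.mul_sum, sum_qe_polar Q hQ]
  simp

/-- Completing the square in a Gauss sum. -/
theorem sum_qe_quad_sub_polar [Fintype M] (x : M) :
    ∑ y, qe (Q y) * qe (-polar Q y x) = (∑ y, qe (Q y)) * qe (-Q x) := by
  rw [Finset.sum_mul]
  refine Fintype.sum_equiv (Equiv.subRight x) _ _ fun y => ?_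
  have := qe_quad_add Q (y - x) x
  rw [sub_add_cancel] at this
  simp only [Equiv.subRight_apply]
  have h2 : polar Q y x = polar Q (y - x) x + polar Q x x := by
    rw [← QuadraticMap.polar_add_left, sub_add_cancel]
  have h3 : polar Q x x = Q x + Q x := by rw [QuadraticMap.polar_self, two_smul]
  rw [this, h2, h3]
  simp only [qe_neg, qe_add]
  field_simp [qe_ne_zero]

theorem weilT_apply (X : M → ℂ) (γ : M) : weilT Q X γ = qe (Q γ) * X γ := rfl

theorem weilS_apply [Fintype M] (X : M → ℂ) (δ : M) :
    weilS Q X δ = ((∑ μ : M, qe (-Q μ)) / (Fintype.card M : ℂ)) *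
      ∑ γ : M, qe (-polar Q γ δ) * X γ := by
  simp [weilS, LinearMap.sum_apply]

end

end JacobiMatrixIndex

namespace JacobiMatrixIndex

open QuadraticMap (polar)

/-! ### Isotropic reduction of Weil representations -/

section Arrow

variable {M Δ : Type*} [AddCommGroup M] [AddCommGroup Δ]
  {Q : QuadraticMap ℤ M (AddCircle (1 : ℚ))} {QΔ : QuadraticMap ℤ Δ (AddCircle (1 : ℚ))}
  {H : AddSubgroup M}

open Classical in
/-- The operator `𝔢_α ↦ 𝔢_{π(α)}` for `α ∈ H^⊥` and `𝔢_α ↦ 0` otherwise. -/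
def arrow [Fintype M] (π : perp Q H →+ Δ) : (M → ℂ) →ₗ[ℂ] (Δ → ℂ) :=
  LinearMap.pi fun β => ∑ α : perp Q H, if π α = β then LinearMap.proj (α : M) else 0

open Classical in
theorem arrow_apply [Fintype M] (π : perp Q H →+ Δ) (X : M → ℂ) (β : Δ) :
    arrow π X β = ∑ α : perp Q H, if π α = β then X α else 0 := by
  simp only [arrow, LinearMap.pi_apply, LinearMap.sum_apply]
  exact Finset.sum_congr rfl fun α _ => by split_ifs <;> rfl

theorem arrow_weilT [Fintype M] (π : perp Q H →+ Δ) (hQ : ∀ α, QΔ (π α) = Q α) (X : M → ℂ) :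
    weilT QΔ (arrow π X) = arrow π (weilT Q X) := by
  classical
  funext β
  rw [weilT_apply, arrow_apply, arrow_apply, Finset.mul_sum]
  refine Finset.sum_congr rfl fun α _ => ?_
  split_ifs with h
  · rw [weilT_apply, ← hQ, h]
  · simp

theorem isotropic_le_perp (hH : ∀ h ∈ H, Q h = 0) : H ≤ perp Q H := fun x hx y hy => by
  rw [QuadraticMap.polar, hH _ (H.add_mem hx hy), hH x hx, hH y hy]
  simp

open Classical in
-- The fibres of π are the cosets of its kernel H, which lies in H^⊥ because H is isotropic.
theorem sum_fiber [Fintype M] (hH : ∀ h ∈ H, Q h = 0) (π : perp Q H →+ Δ)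
    (hπ : ∀ α, π α = 0 ↔ (α : M) ∈ H) (α₀ : perp Q H) (f : M → ℂ) :
    (∑ α : perp Q H, if π α = π α₀ then f α else 0) = ∑ h : H, f (α₀ + h) := by
  rw [← Finset.sum_filter]
  refine Finset.sum_bij' (fun α hα => ⟨(α : M) - α₀, ?_⟩)
    (fun h _ => α₀ + ⟨h, isotropic_le_perp hH h.2⟩) ?_ ?_ ?_ ?_ ?_
  · rw [← AddSubgroup.coe_sub, ← hπ, map_sub, (Finset.mem_filter.1 hα).2, sub_self]
  · simp
  · intro h _
    rw [Finset.mem_filter, map_add, (hπ ⟨h, _⟩).2 h.2, add_zero]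
    exact ⟨Finset.mem_univ _, rfl⟩
  · intro α _
    ext
    simp
  · intro h _
    ext
    simp
  · intro α _
    simp

theorem card_perp_eq [Fintype M] [Fintype Δ] (hH : ∀ h ∈ H, Q h = 0) (π : perp Q H →+ Δ)
    (hπ : ∀ α, π α = 0 ↔ (α : M) ∈ H) (hs : Function.Surjective π) :
    (Nat.card (perp Q H) : ℂ) = Fintype.card Δ * Nat.card H := by
  classical
  have h1 : ∑ β : Δ, ∑ α : perp Q H, (if π α = β then (1 : ℂ) else 0) = Nat.card (perp Q H) := by
    rw [Finset.sum_comm]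
    simp
  have h2 : ∀ β : Δ, ∑ α : perp Q H, (if π α = β then (1 : ℂ) else 0) = Nat.card H := fun β => by
    obtain ⟨α₀, rfl⟩ := hs β
    rw [sum_fiber hH π hπ α₀ fun _ => 1]
    simp
  rw [← h1]
  simp [h2]

/-- For isotropic h, the quadratic form changes under μ ↦ μ + h only by (μ, h). Averaging over H
therefore keeps only μ ∈ H^⊥, and these fibre over Δ with |H| points each. -/
theorem sum_perp_gauss [Fintype M] [Fintype Δ] (hH : ∀ h ∈ H, Q h = 0) (π : perp Q H →+ Δ)
    (hπ : ∀ α, π α = 0 ↔ (α : M) ∈ H) (hs : Function.Surjective π)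
    (hQ : ∀ α, QΔ (π α) = Q α) :
    ∑ μ : M, qe (-Q μ) = Nat.card H * ∑ β : Δ, qe (-QΔ β) := by
  classical
  have hc : (Nat.card H : ℂ) ≠ 0 := by exact_mod_cast Nat.card_pos.ne'
  have h1 : ∀ h : H, ∑ μ : M, qe (-Q μ) = ∑ μ : M, qe (-Q μ) * qe (polar Q (-μ) h) := fun h => by
    refine (Fintype.sum_equiv (Equiv.addRight (h : M)) _ _ fun μ => ?_).symm
    rw [Equiv.coe_addRight, QuadraticMap.polar_neg_left, qe_neg, qe_neg, qe_neg, qe_quad_add,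
      hH h h.2]
    simp only [qe_zero, mul_one, mul_inv]
  have h2 : Nat.card H * ∑ μ : M, qe (-Q μ) =
      Nat.card H * ∑ μ : M, if μ ∈ perp Q H then qe (-Q μ) else 0 := by
    calc Nat.card H * ∑ μ : M, qe (-Q μ) = ∑ h : H, ∑ μ : M, qe (-Q μ) := by simp
      _ = ∑ h : H, ∑ μ : M, qe (-Q μ) * qe (polar Q (-μ) h) :=
        Finset.sum_congr rfl fun h _ => h1 h
      _ = _ := by
        rw [Finset.sum_comm, Finset.mul_sum]
        refine Finset.sum_congr rfl fun μ _ => ?_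
        rw [← Finset.mul_sum, sum_qe_polar_subgroup]
        simp only [neg_mem_iff, Nat.card_eq_fintype_card]
        split_ifs <;> ring
  rw [mul_right_inj' hc] at h2
  rw [h2]
  have h3 : ∑ μ : M, (if μ ∈ perp Q H then qe (-Q μ) else 0) = ∑ α : perp Q H, qe (-QΔ (π α)) := by
    rw [← Finset.sum_filter]
    simp_rw [hQ]
    exact Finset.sum_subtype _ (by simp) _
  have h4 : ∀ α : perp Q H, qe (-QΔ (π α)) = ∑ β : Δ, if π α = β then qe (-QΔ β) else 0 := by
    simp
  rw [h3]
  simp_rw [h4]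
  rw [Finset.sum_comm, Finset.mul_sum]
  refine Finset.sum_congr rfl fun β _ => ?_
  obtain ⟨α₀, rfl⟩ := hs β
  rw [sum_fiber hH π hπ α₀ fun _ => qe (-QΔ (π α₀))]
  simp

/-- Summing the output over a coset of H gives a character sum in H that restricts the input to H^⊥
and contributes |H|. The Gauss sum contributes another |H|, and both cancel against |M| = |Δ||H|².
-/
theorem arrow_weilS [Fintype M] [Fintype Δ] (hM : IsDiscriminantForm Q)
    (hH : ∀ h ∈ H, Q h = 0) (π : perp Q H →+ Δ)
    (hπ : ∀ α, π α = 0 ↔ (α : M) ∈ H) (hs : Function.Surjective π)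
    (hQ : ∀ α, QΔ (π α) = Q α) (X : M → ℂ) :
    weilS QΔ (arrow π X) = arrow π (weilS Q X) := by
  classical
  funext β
  obtain ⟨α₀, rfl⟩ := hs β
  have hpol : ∀ α, polar QΔ (π α) (π α₀) = polar Q α α₀ := fun α => by
    rw [QuadraticMap.polar, ← map_add, hQ, hQ, hQ]
    rfl
  have hcard : (Fintype.card M : ℂ) = Fintype.card Δ * (Nat.card H) ^ 2 := by
    have := card_mul_card_perp Q hM H
    rw [← Nat.card_eq_fintype_card, ← this, Nat.cast_mul, card_perp_eq hH π hπ hs]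
    ring
  have hL : ∑ β' : Δ, qe (-polar QΔ β' (π α₀)) * arrow π X β' =
      ∑ α : perp Q H, qe (-polar Q (α : M) α₀) * X α := by
    simp_rw [arrow_apply, Finset.mul_sum]
    rw [Finset.sum_comm]
    refine Finset.sum_congr rfl fun α _ => ?_
    rw [Finset.sum_eq_single (π α)]
    · rw [if_pos rfl, hpol]
    · intro b _ hb
      rw [if_neg (Ne.symm hb), mul_zero]
    · simp
  have hR : ∑ h : H, ∑ μ : M, qe (-polar Q μ (α₀ + h)) * X μ =
      Nat.card H * ∑ α : perp Q H, qe (-polar Q (α : M) α₀) * X α := by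
    rw [Finset.sum_comm]
    have : ∀ μ : M, ∑ h : H, qe (-polar Q μ (α₀ + h)) * X μ =
        if μ ∈ perp Q H then Nat.card H * (qe (-polar Q μ α₀) * X μ) else 0 := fun μ => by
      have h1 : ∀ h : H, qe (-polar Q μ (α₀ + h)) * X μ =
          (qe (-polar Q μ α₀) * X μ) * qe (polar Q (-μ) h) := fun h => by
        rw [QuadraticMap.polar_add_right, neg_add, qe_add, QuadraticMap.polar_neg_left]
        ring
      simp_rw [h1]
      rw [← Finset.mul_sum, sum_qe_polar_subgroup]
      simp only [neg_mem_iff, Nat.card_eq_fintype_card]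
      split_ifs <;> ring
    simp_rw [this]
    rw [← Finset.sum_filter, Finset.mul_sum]
    exact Finset.sum_subtype _ (by simp) _
  rw [weilS_apply, hL, arrow_apply, sum_fiber hH π hπ α₀]
  simp_rw [weilS_apply]
  rw [← Finset.mul_sum, hR, sum_perp_gauss hH π hπ hs hQ, hcard]
  have h1 : (Nat.card H : ℂ) ≠ 0 := by exact_mod_cast Nat.card_pos.ne'
  have h2 : (Fintype.card Δ : ℂ) ≠ 0 := by exact_mod_cast Fintype.card_ne_zero
  field_simp

end Arrow

/-! ### Products -/

section Prod

variable {M N : Type*} [AddCommGroup M] [AddCommGroup N]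
  {Q : QuadraticMap ℤ M (AddCircle (1 : ℚ))} {Q' : QuadraticMap ℤ N (AddCircle (1 : ℚ))}

/-- The tensor product of two elements of the group algebras. -/
def tens (X : M → ℂ) (Y : N → ℂ) : M × N → ℂ := fun α => X α.1 * Y α.2

theorem polar_prod_apply (x y : M × N) :
    polar (Q.prod Q') x y = polar Q x.1 y.1 + polar Q' x.2 y.2 := by
  rw [QuadraticMap.polar_prod]

theorem isDiscriminantForm_prod (h : IsDiscriminantForm Q) (h' : IsDiscriminantForm Q') :
    IsDiscriminantForm (Q.prod Q') := by
  obtain ⟨hf, hn⟩ := h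
  obtain ⟨hf', hn'⟩ := h'
  refine ⟨inferInstance, fun γ hγ => Prod.ext (hn _ fun δ => ?_) (hn' _ fun δ => ?_)⟩
  · simpa [polar_prod_apply] using hγ (δ, 0)
  · simpa [polar_prod_apply] using hγ (0, δ)

theorem weilT_tens (X : M → ℂ) (Y : N → ℂ) :
    weilT (Q.prod Q') (tens X Y) = tens (weilT Q X) (weilT Q' Y) := by
  funext α
  rw [weilT_apply, tens, tens, weilT_apply, weilT_apply, QuadraticMap.prod_apply, qe_add]
  ring

theorem weilS_tens [Fintype M] [Fintype N] (X : M → ℂ) (Y : N → ℂ) :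
    weilS (Q.prod Q') (tens X Y) = tens (weilS Q X) (weilS Q' Y) := by
  funext α
  have h1 : ∑ μ : M × N, qe (-(Q.prod Q') μ) = (∑ μ, qe (-Q μ)) * ∑ μ, qe (-Q' μ) := by
    rw [Finset.sum_mul_sum, ← Finset.univ_product_univ, Finset.sum_product]
    refine Finset.sum_congr rfl fun x _ => Finset.sum_congr rfl fun y _ => ?_
    rw [QuadraticMap.prod_apply, neg_add, qe_add]
  have h2 : ∑ γ : M × N, qe (-polar (Q.prod Q') γ α) * tens X Y γ =
      (∑ γ, qe (-polar Q γ α.1) * X γ) * ∑ γ, qe (-polar Q' γ α.2) * Y γ := by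
    rw [Finset.sum_mul_sum, ← Finset.univ_product_univ, Finset.sum_product]
    refine Finset.sum_congr rfl fun x _ => Finset.sum_congr rfl fun y _ => ?_
    rw [polar_prod_apply, neg_add, qe_add, tens]
    ring
  rw [weilS_apply, h1, h2, tens, weilS_apply, weilS_apply, Fintype.card_prod, Nat.cast_mul,
    mul_div_mul_comm]
  ring

end Prod

section Compat

variable {M N Δ : Type*} [AddCommGroup M] [AddCommGroup N] [AddCommGroup Δ]
  [Fintype M] [Fintype N] [Fintype Δ]
  {Q : QuadraticMap ℤ M (AddCircle (1 : ℚ))} {Q' : QuadraticMap ℤ N (AddCircle (1 : ℚ))}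
  {QΔ : QuadraticMap ℤ Δ (AddCircle (1 : ℚ))} {H : AddSubgroup (M × N)}

/-- The arrow operator intertwines the tensor product of the Weil representations of `M` and `N`
with the one of `Δ`. -/
theorem exists_weil_compat (hM : IsDiscriminantForm Q) (hN : IsDiscriminantForm Q')
    (hH : ∀ h ∈ H, Q.prod Q' h = 0) (π : perp (Q.prod Q') H →+ Δ)
    (hπ : ∀ α, π α = 0 ↔ (α : M × N) ∈ H) (hs : Function.Surjective π)
    (hQ : ∀ α, QΔ (π α) = Q.prod Q' α) {p : Mp2Z × Module.End ℂ (N → ℂ)}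
    (hp : p ∈ weilGraph Q') :
    ∃ W V, (p.1, W) ∈ weilGraph Q ∧ (p.1, V) ∈ weilGraph QΔ ∧
      ∀ X Y, arrow π (tens (W X) (p.2 Y)) = V (arrow π (tens X Y)) := by
  -- W and V are built along the same word in T and S that produces p, so no relation between words
  -- has to be checked.
  induction hp using Submonoid.closure_induction with
  | mem p hp =>
    rcases hp with rfl | rfl
    · refine ⟨weilT Q, weilT QΔ, Submonoid.subset_closure (by simp),
        Submonoid.subset_closure (by simp), fun X Y => ?_⟩
      rw [arrow_weilT π hQ, weilT_tens]
    · refine ⟨weilS Q, weilS QΔ, Submonoid.subset_closure (by simp),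
        Submonoid.subset_closure (by simp), fun X Y => ?_⟩
      rw [arrow_weilS (isDiscriminantForm_prod hM hN) hH π hπ hs hQ, weilS_tens]
  | one => exact ⟨1, 1, one_mem _, one_mem _, fun _ _ => rfl⟩
  | mul p q _ _ hp hq =>
    obtain ⟨W, V, h1, h2, h3⟩ := hp
    obtain ⟨W', V', h1', h2', h3'⟩ := hq
    exact ⟨W * W', V * V', mul_mem h1 h1', mul_mem h2 h2', fun X Y => by
      rw [Module.End.mul_apply, Prod.snd_mul, Module.End.mul_apply, h3, h3', Module.End.mul_apply]⟩

end Compat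

end JacobiMatrixIndex

namespace JacobiMatrixIndex

/-! ### Generators of the metaplectic group -/

namespace Mp2Z

/-- Two continuous square roots of the same nowhere vanishing function on a connected space differ
by a global sign. -/
theorem eq_of_mat_eq {A B : Mp2Z} (h : A.mat = B.mat) :
    A.root = B.root ∨ A.root = -B.root := by
  have h1 := isPreconnected_univ.eq_or_eq_neg_of_sq_eq (f := A.root) (g := B.root) (S := Set.univ)
    A.continuous_root.continuousOn B.continuous_root.continuousOn
    (fun τ _ => by simp only [Pi.pow_apply, A.sq_root, B.sq_root, h]) 
    (fun {τ} _ => B.root_ne_zero τ)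
  simpa only [Set.eqOn_univ] using h1

theorem sq_eq_one_of_mat_eq_one {A : Mp2Z} (h : A.mat = 1) : A ^ 2 = 1 := by
  rw [sq]
  ext1
  · simp [h]
  · funext τ
    rw [mul_root, one_root, h, one_smul, ← sq, A.sq_root, h]
    simp [autJ]

theorem root_T (τ : ℍ) : T.root τ = 1 := rfl

theorem root_S (τ : ℍ) : S.root τ = (τ : ℂ) ^ (1 / 2 : ℂ) := rfl

theorem mat_S_sq : ModularGroup.S * ModularGroup.S = -1 := by
  ext i j; fin_cases i <;> fin_cases j <;> rfl

theorem mat_ST_cube : (ModularGroup.S * ModularGroup.T) ^ 3 = -1 := by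
  ext i j; fin_cases i <;> fin_cases j <;> rfl

theorem mat_pow (A : Mp2Z) (n : ℕ) : (A ^ n).mat = A.mat ^ n := by
  induction n with
  | zero => rfl
  | succ n ih => rw [pow_succ, pow_succ, mul_mat, ih]

theorem S_pow_four_mat : (S ^ 4).mat = 1 := by
  rw [mat_pow]
  change ModularGroup.S ^ 4 = 1
  rw [show (4 : ℕ) = 2 * 2 from rfl, pow_mul, sq ModularGroup.S, mat_S_sq]
  simp

theorem S_pow_eight : S ^ 8 = 1 := by
  have : (S ^ 4).mat = 1 := S_pow_four_mat
  have := sq_eq_one_of_mat_eq_one this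
  rwa [← pow_mul] at this

theorem ST_pow : (S * T) ^ 12 = 1 := by
  have : ((S * T) ^ 6).mat = 1 := by
    rw [mat_pow]
    change (ModularGroup.S * ModularGroup.T) ^ 6 = 1
    rw [show (6 : ℕ) = 3 * 2 from rfl, pow_mul, mat_ST_cube]; simp
  have := sq_eq_one_of_mat_eq_one this
  rwa [← pow_mul] at this

/-- The sign is constant, so it can be read off at the fixed point i of S, where the root to the
fourth power is i² = -1. -/
theorem S_pow_four_root (τ : ℍ) : (S ^ 4).root τ = -1 := by
  have h4 : (S ^ 4).mat = (1 : Mp2Z).mat := S_pow_four_mat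
  have hI : ModularGroup.S • UpperHalfPlane.I = UpperHalfPlane.I := by
    ext1
    rw [UpperHalfPlane.modular_S_smul]
    simp
  have h5 : (S ^ 4).root UpperHalfPlane.I = -1 := by
    have hS : S.mat = ModularGroup.S := rfl
    simp only [pow_succ, pow_zero, one_mul, mul_root, hS, hI]
    have := S.sq_root UpperHalfPlane.I
    rw [sq] at this
    rw [this, mul_assoc, this]
    simp [autJ, hS, ModularGroup.S]
  rcases eq_of_mat_eq h4 with h | h
  · rw [h, one_root] at h5
    norm_num at h5
  · rw [h]; rfl

/-- S and ST have finite order, so the monoid contains the inverses. It maps onto SL₂(ℤ), and S⁴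
supplies the non-trivial sign of the root. -/
theorem closure_T_S : Submonoid.closure ({T, S} : Set Mp2Z) = ⊤ := by
  set N := Submonoid.closure ({T, S} : Set Mp2Z) with hN
  have hT : T ∈ N := Submonoid.subset_closure (by simp)
  have hS : S ∈ N := Submonoid.subset_closure (by simp)
  have hSi : S⁻¹ ∈ N := by
    rw [show S⁻¹ = S ^ 7 from inv_eq_of_mul_eq_one_right (by rw [← pow_succ']; exact S_pow_eight)]
    exact pow_mem hS 7
  have hTi : T⁻¹ ∈ N := by
    have : (S * T) ^ 11 * S * T = 1 := by rw [mul_assoc, ← pow_succ]; exact ST_pow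
    rw [inv_eq_of_mul_eq_one_left this]
    exact mul_mem (pow_mem (mul_mem hS hT) 11) hS
  have hinv : ∀ A ∈ N, A⁻¹ ∈ N := fun A hA => by
    induction hA using Submonoid.closure_induction with
    | mem x hx => rcases hx with rfl | rfl <;> assumption
    | one => simp
    | mul x y _ _ hx hy => rw [mul_inv_rev]; exact mul_mem hy hx
  let G : Subgroup Mp2Z := { N with inv_mem' := fun {x} hx => hinv x hx }
  let f : Mp2Z →* SL(2, ℤ) := { toFun := Mp2Z.mat, map_one' := rfl, map_mul' := fun _ _ => rfl }
  have hG : G.map f = ⊤ := by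
    rw [eq_top_iff, ← SpecialLinearGroup.SL2Z_generators, Subgroup.closure_le]
    rintro _ (rfl | rfl)
    · exact ⟨S, hS, rfl⟩
    · exact ⟨T, hT, rfl⟩
  rw [eq_top_iff]
  intro A _
  obtain ⟨B, hB, hAB⟩ : A.mat ∈ G.map f := by rw [hG]; trivial
  have hAB : B.mat = A.mat := hAB
  have h4 : (S ^ 4).mat = 1 := S_pow_four_mat
  rcases eq_of_mat_eq hAB.symm with h | h
  · have : A = B := Mp2Z.ext hAB.symm h
    rw [this]; exact hB
  · have : A = S ^ 4 * B := by
      ext1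
      · rw [mul_mat, h4, one_mul, hAB]
      · funext τ
        rw [mul_root, S_pow_four_root, h]
        simp
    rw [this]
    exact mul_mem (pow_mem hS 4) hB

end Mp2Z

/-- Every element of the metaplectic group acts in the Weil representation. -/
theorem exists_mem_weilGraph {D : Type*} [AddCommGroup D] [Fintype D]
    (Q : QuadraticMap ℤ D (AddCircle (1 : ℚ))) (A : Mp2Z) : ∃ U, (A, U) ∈ weilGraph Q := by
  have h : (weilGraph Q).map (MonoidHom.fst Mp2Z (Module.End ℂ (D → ℂ))) = ⊤ := by
    rw [weilGraph, MonoidHom.map_mclosure, ← Mp2Z.closure_T_S]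
    congr 1
    simp [Set.image_insert_eq]
  obtain ⟨p, hp, rfl⟩ : A ∈ (weilGraph Q).map (MonoidHom.fst Mp2Z (Module.End ℂ (D → ℂ))) := by
    rw [h]; trivial
  exact ⟨p.2, hp⟩

/-- This cocycle relation makes the factor 𝐞(c zᵗSz / j) compatible with products. -/
theorem autJ_smul_eq (A B : SL(2, ℤ)) (τ : ℍ) :
    ((A * B) 1 0 : ℂ) / autJ (A * B) τ =
      (A 1 0 : ℂ) / (autJ A (B • τ) * autJ B τ ^ 2) + (B 1 0 : ℂ) / autJ B τ := by
  have h1 := autJ_ne_zero A (B • τ)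
  have h2 := autJ_ne_zero B τ
  have h3 := autJ_mul A B τ
  have hdet : (B 0 0 : ℂ) * B 1 1 - B 0 1 * B 1 0 = 1 := by
    have := B.det_coe
    rw [Matrix.det_fin_two] at this
    exact_mod_cast this
  have hab : autJ (A * B) τ = ((A 1 0 : ℂ) * B 0 0 + A 1 1 * B 1 0) * τ +
      ((A 1 0 : ℂ) * B 0 1 + A 1 1 * B 1 1) := by
    simp [autJ, Matrix.SpecialLinearGroup.coe_mul, Matrix.mul_apply, Fin.sum_univ_two]
  have hc : ((A * B) 1 0 : ℂ) = (A 1 0 : ℂ) * B 0 0 + A 1 1 * B 1 0 := by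
    simp [Matrix.SpecialLinearGroup.coe_mul, Matrix.mul_apply, Fin.sum_univ_two]
  have key : ((A * B) 1 0 : ℂ) * autJ B τ = A 1 0 + B 1 0 * (autJ A (B • τ) * autJ B τ) := by
    rw [← h3, hab, hc]
    simp only [autJ]
    linear_combination (A 1 0 : ℂ) * hdet
  rw [h3]
  field_simp
  linear_combination key

end JacobiMatrixIndex

namespace JacobiMatrixIndex

open QuadraticMap (polar)

variable {c : ℕ} {Δ : Type*} [AddCommGroup Δ]

namespace MatrixIndex

variable {Q : QuadraticMap ℤ Δ (AddCircle (1 : ℚ))} (I : MatrixIndex c Q)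

/-! ### Orthogonal coordinates -/

/-- A basis of `ℚ^c` consisting of pairwise orthogonal vectors in the kernel of `ψ`. -/
structure Frame where
  /-- the basis vectors -/
  u : Fin c → Fin c → ℤ
  /-- the values of the quadratic form on the basis vectors -/
  d : Fin c → ℕ
  map_u : ∀ i, I.ψ (u i) = 0
  orth : ∀ i j, qform I.S (intVec c (u i)) (intVec c (u j)) = if i = j then (d i : ℚ) else 0
  basis : Module.Basis (Fin c) ℚ (Fin c → ℚ)
  basis_apply : ∀ i, basis i = intVec c (u i)

theorem exists_int_multiple (x : Fin c → ℚ) :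
    ∃ (m : ℕ) (w : Fin c → ℤ), m ≠ 0 ∧ intVec c w = (m : ℚ) • x := by
  refine ⟨∏ j, (x j).den, fun i => (∏ j ∈ Finset.univ.erase i, ((x j).den : ℤ)) * (x i).num,
    Finset.prod_ne_zero_iff.2 fun j _ => (x j).den_nz, ?_⟩
  ext i
  simp only [intVec, AddMonoidHom.coe_mk, ZeroHom.coe_mk, Pi.smul_apply, smul_eq_mul]
  rw [← Finset.prod_erase_mul _ _ (Finset.mem_univ i)]
  push_cast
  rw [mul_assoc, Rat.den_mul_eq_num]

theorem qform_smul_right (S : Matrix (Fin c) (Fin c) ℚ) (x y : Fin c → ℚ) (r : ℚ) :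
    qform S x (r • y) = r * qform S x y := by
  simp [qform, Matrix.mulVec_smul]

theorem qform_smul_left (S : Matrix (Fin c) (Fin c) ℚ) (x y : Fin c → ℚ) (r : ℚ) :
    qform S (r • x) y = r * qform S x y := by
  simp [qform]

theorem qform_sum_left {ι : Type*} (s : Finset ι) (S : Matrix (Fin c) (Fin c) ℚ)
    (x : ι → Fin c → ℚ) (y : Fin c → ℚ) :
    qform S (∑ i ∈ s, x i) y = ∑ i ∈ s, qform S (x i) y := by
  simp [qform, sum_dotProduct]

theorem qform_nonneg (x : Fin c → ℚ) : 0 ≤ qform I.S x x := by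
  have := I.posSemidef.dotProduct_mulVec_nonneg x
  simpa [qform] using this

/-- An orthogonal basis over ℚ is cleared of denominators and multiplied by |Δ|, which puts it in
ker ψ. The norms are then integral, because Q(0) = 0, and non-negative by semidefiniteness. -/
theorem nonempty_frame [Finite Δ] : Nonempty I.Frame := by
  classical
  let B : LinearMap.BilinForm ℚ (Fin c → ℚ) := Matrix.toBilin' I.S
  have hB : ∀ x y, B x y = qform I.S x y := fun x y => Matrix.toBilin'_apply' I.S x y
  have hBs : LinearMap.IsSymm B := ⟨fun x y => by
    simp only [hB]; exact (I.qform_comm x y)⟩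
  obtain ⟨v', hv'⟩ := LinearMap.BilinForm.exists_orthogonal_basis hBs
  have hc : Module.finrank ℚ (Fin c → ℚ) = c := by simp
  let v : Module.Basis (Fin c) ℚ (Fin c → ℚ) := v'.reindex (finCongr hc)
  have hv : ∀ i j, i ≠ j → qform I.S (v i) (v j) = 0 := fun i j hij => by
    rw [← hB]
    simp only [v, Module.Basis.reindex_apply]
    exact hv' (fun h => hij ((finCongr hc).symm.injective h))
  choose m w hm hw using fun i => exists_int_multiple (v i)
  let N := Nat.card Δ
  have hN : N ≠ 0 := Nat.card_pos.ne'
  have hu : ∀ i, intVec c (N • w i) = ((N * m i : ℕ) : ℚ) • v i := fun i => by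
    rw [map_nsmul, hw, Nat.cast_mul, mul_smul, Nat.cast_smul_eq_nsmul ℚ N]
  have hψ : ∀ i, I.ψ (N • w i) = 0 := fun i => by
    rw [map_nsmul]; exact card_nsmul_eq_zero'
  have hd : ∀ i, ∃ d : ℕ, qform I.S (intVec c (N • w i)) (intVec c (N • w i)) = d := fun i => by
    have h1 := I.quad_ψ (N • w i)
    rw [hψ, QuadraticMap.map_zero] at h1
    obtain ⟨n, hn⟩ := circle_coe_eq_zero.1 h1.symm
    have h2 := I.qform_nonneg (intVec c (N • w i))
    rw [hn] at h2
    have h3 : 0 ≤ n := by exact_mod_cast h2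
    obtain ⟨k, rfl⟩ := Int.eq_ofNat_of_zero_le h3
    exact ⟨k, by rw [hn]; simp⟩
  choose d hd using hd
  refine ⟨⟨fun i => N • w i, d, hψ, fun i j => ?_, v.isUnitSMul (w := fun i => ((N * m i : ℕ) : ℚ))
    (fun i => ?_), fun i => ?_⟩⟩
  · split_ifs with h
    · subst h; exact hd i
    · rw [hu, hu, qform_smul_left, qform_smul_right, hv i j h]; simp
  · rw [isUnit_iff_ne_zero]
    exact_mod_cast Nat.mul_ne_zero hN (hm i)
  · rw [Module.Basis.isUnitSMul_apply, hu]

namespace Frame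

variable {I} (f : I.Frame)

/-- The indices of the basis vectors with non-zero norm. -/
abbrev J : Type := {i : Fin c // f.d i ≠ 0}

/-- The basis vectors as rational vectors. -/
def v (i : Fin c) : Fin c → ℚ := intVec c (f.u i)

theorem qform_v (i j : Fin c) : qform I.S (f.v i) (f.v j) = if i = j then (f.d i : ℚ) else 0 :=
  f.orth i j

theorem mem_kerS_of_forall {x : Fin c → ℚ} (h : ∀ i, qform I.S x (f.v i) = 0) : x ∈ I.kerS := by
  rw [mem_kerS]
  have h1 : ∀ y, qform I.S x y = 0 := fun y => by
    rw [← f.basis.sum_repr y, I.qform_comm, qform_sum_left]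
    refine Finset.sum_eq_zero fun i _ => ?_
    rw [qform_smul_left, I.qform_comm, f.basis_apply]
    exact mul_eq_zero_of_right _ (h i)
  ext i
  have := h1 (Pi.single i 1)
  rw [I.qform_comm] at this
  simpa [qform] using this

theorem v_mem_kerS {i : Fin c} (h : f.d i = 0) : f.v i ∈ I.kerS := by
  refine f.mem_kerS_of_forall fun j => ?_
  rw [qform_v]
  split_ifs <;> simp [h]

theorem v_mem_omega (i : Fin c) : f.v i ∈ I.omega :=
  AddSubgroup.mem_sup_left ⟨f.u i, f.map_u i, rfl⟩

/-- Parseval in the orthogonal basis; the basis vectors of norm zero lie in ker S and contribute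
nothing. -/
theorem qform_eq_sum (x y : Fin c → ℚ) :
    qform I.S x y = ∑ i : f.J, qform I.S x (f.v i) * qform I.S y (f.v i) / f.d i := by
  have h1 : ∀ y, qform I.S x y = ∑ j, f.basis.repr y j * qform I.S x (f.v j) := fun y => by
    conv_lhs => rw [← f.basis.sum_repr y, I.qform_comm, qform_sum_left]
    refine Finset.sum_congr rfl fun i _ => ?_
    rw [qform_smul_left, I.qform_comm, f.basis_apply, v]
  have h2 : ∀ j, qform I.S y (f.v j) = f.basis.repr y j * f.d j := fun j => by
    conv_lhs => rw [← f.basis.sum_repr y, qform_sum_left]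
    have h4 : ∀ i, qform I.S (f.basis i) (f.v j) = if i = j then (f.d i : ℚ) else 0 := fun i => by
      rw [f.basis_apply]; exact f.qform_v i j
    simp_rw [qform_smul_left, h4]
    simp
  have h3 : ∀ j, f.d j = 0 → qform I.S x (f.v j) = 0 := fun j hj => I.qform_kerS (f.v_mem_kerS hj)
  rw [h1]
  simp_rw [h2]
  rw [← Finset.sum_subtype (Finset.univ.filter fun i => f.d i ≠ 0) (by simp)
    (fun i => qform I.S x (f.v i) * (f.basis.repr y i * (f.d i : ℚ)) / (f.d i : ℚ)),
    Finset.sum_filter]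
  refine Finset.sum_congr rfl fun j _ => ?_
  split_ifs with h
  · field_simp
  · push Not at h
    rw [h3 j h, mul_zero]

theorem qform_single_left (S : Matrix (Fin c) (Fin c) ℚ) (k : Fin c) (y : Fin c → ℚ) :
    qform S (Pi.single k 1) y = ∑ l, S k l * y l := by
  rw [qform, single_dotProduct, one_mul]
  rfl

theorem qform_single_single (S : Matrix (Fin c) (Fin c) ℚ) (k l : Fin c) :
    qform S (Pi.single k 1) (Pi.single l 1) = S k l := by
  simp [qform_single_left, Pi.single_apply]

theorem cform_expand (S : Matrix (Fin c) (Fin c) ℚ) (x y : Fin c → ℂ) :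
    cform S x y = ∑ k, ∑ l, x k * y l * (qform S (Pi.single k 1) (Pi.single l 1) : ℚ) := by
  simp only [cform, dotProduct, Matrix.mulVec, Finset.mul_sum, Matrix.map_apply,
    qform_single_single]
  exact Finset.sum_congr rfl fun k _ => Finset.sum_congr rfl fun l _ => by ring

theorem cform_v (x : Fin c → ℂ) (w : Fin c → ℚ) :
    cform I.S (ratVec w) x = ∑ k, x k * (qform I.S (Pi.single k 1) w : ℚ) := by
  simp only [cform, dotProduct, Matrix.mulVec, Matrix.map_apply, qform_single_left, ratVec]
  simp_rw [Finset.mul_sum]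
  rw [Finset.sum_comm]
  refine Finset.sum_congr rfl fun k _ => ?_
  push_cast
  rw [Finset.mul_sum]
  refine Finset.sum_congr rfl fun l _ => ?_
  have : I.S l k = I.S k l := by
    have := I.posSemidef.isHermitian.apply l k
    simpa using this.symm
  rw [this]
  ring

/-- Both sides are bilinear over ℂ, so the rational Parseval identity on standard basis vectors
suffices. -/
theorem cform_eq_sum (x y : Fin c → ℂ) :
    cform I.S x y =
      ∑ i : f.J, cform I.S (ratVec (f.v i)) x * cform I.S (ratVec (f.v i)) y / f.d i := by
  rw [cform_expand]
  have h : ∀ i : f.J, cform I.S (ratVec (f.v i)) x * cform I.S (ratVec (f.v i)) y / f.d i =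
      ∑ k, ∑ l, x k * y l * ((qform I.S (Pi.single k 1) (f.v i) *
        qform I.S (Pi.single l 1) (f.v i) / f.d i : ℚ) : ℂ) := fun i => by
    rw [cform_v, cform_v, Finset.sum_mul_sum, Finset.sum_div]
    refine Finset.sum_congr rfl fun k _ => ?_
    rw [Finset.sum_div]
    refine Finset.sum_congr rfl fun l _ => ?_
    push_cast
    ring
  simp_rw [h]
  conv_rhs => rw [Finset.sum_comm]
  refine Finset.sum_congr rfl fun k _ => ?_
  rw [Finset.sum_comm]
  refine Finset.sum_congr rfl fun l _ => ?_
  rw [f.qform_eq_sum, Rat.cast_sum, Finset.mul_sum]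

/-- S is congruent to the diagonal matrix of the norms. The inversion has one square root of τ per
index in `J`, so this is where the weight shift by half the rank originates. -/
theorem card_J : Fintype.card f.J = I.S.rank := by
  let P : Matrix (Fin c) (Fin c) ℚ := Matrix.of fun i j => f.v j i
  have hP : IsUnit P := by
    rw [← Matrix.linearIndependent_cols_iff_isUnit]
    have h : P.col = f.basis := by
      funext i
      rw [f.basis_apply]
      rfl
    rw [h]
    exact f.basis.linearIndependent
  have hPd : IsUnit P.det := (Matrix.isUnit_iff_isUnit_det P).1 hP
  have h1 : P.transpose * I.S * P = Matrix.diagonal fun i => (f.d i : ℚ) := by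
    ext i j
    have := f.qform_v i j
    rw [Matrix.diagonal_apply, ← this, qform, Matrix.dotProduct_mulVec]
    simp only [Matrix.mul_apply, dotProduct, Matrix.vecMul, P, Matrix.transpose_apply, Matrix.of_apply]
  have h2 : (P.transpose * I.S * P).rank = I.S.rank := by
    rw [Matrix.rank_mul_eq_left_of_isUnit_det _ _ hPd, Matrix.rank_mul_eq_right_of_isUnit_det]
    rwa [Matrix.det_transpose]
  rw [← h2, h1, Matrix.rank_diagonal]
  exact Fintype.card_congr (Equiv.subtypeEquivRight fun i => by simp)

/-! #### Integral coordinates -/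

theorem two_qform_int {a : Fin c → ℚ} (ha : a ∈ I.omegaDual) (i : Fin c) :
    ∃ n : ℤ, 2 * qform I.S a (f.v i) = n := ha _ (f.v_mem_omega i)

/-- The coordinates `2aᵗSu_i` of `a ∈ Ω*`. -/
def coord (a : Fin c → ℚ) (i : f.J) : ℤ := ⌊2 * qform I.S a (f.v i)⌋

/-- The basis vectors lie in Ω, so the pairing with a ∈ Ω* is already integral and the floor changes
nothing. -/
theorem coe_coord {a : Fin c → ℚ} (ha : a ∈ I.omegaDual) (i : f.J) :
    (f.coord a i : ℚ) = 2 * qform I.S a (f.v i) := by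
  obtain ⟨n, hn⟩ := f.two_qform_int ha i
  rw [coord, hn, Int.floor_intCast]

/-- The vector with prescribed coordinates. -/
def vec (n : f.J → ℤ) : Fin c → ℚ := ∑ i : f.J, ((n i : ℚ) / (2 * f.d i)) • f.v i

theorem two_qform_vec (n : f.J → ℤ) (i : f.J) : 2 * qform I.S (f.vec n) (f.v i) = n i := by
  rw [vec, qform_sum_left]
  simp_rw [qform_smul_left, qform_v]
  have hi : (f.d i : ℚ) ≠ 0 := by exact_mod_cast i.2
  rw [Finset.sum_eq_single i]
  · rw [if_pos rfl]; field_simp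
  · intro j _ hj
    rw [if_neg (fun h => hj (Subtype.ext h)), mul_zero]
  · simp

theorem coord_vec (n : f.J → ℤ) : f.coord (f.vec n) = n := by
  funext i
  rw [coord, two_qform_vec, Int.floor_intCast]

theorem two_qform_eq_sum (a : Fin c → ℚ) (n : f.J → ℤ) :
    2 * qform I.S a (f.vec n) = ∑ i : f.J, (2 * qform I.S a (f.v i)) * n i / (2 * f.d i) := by
  rw [f.qform_eq_sum, Finset.mul_sum]
  refine Finset.sum_congr rfl fun i _ => ?_
  have hi : (f.d i : ℚ) ≠ 0 := by exact_mod_cast i.2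
  rw [← f.two_qform_vec n i]
  field_simp

theorem sub_mem_kerS {a b : Fin c → ℚ} 
    (h : ∀ i : f.J, qform I.S a (f.v i) = qform I.S b (f.v i)) : a - b ∈ I.kerS := by
  refine f.mem_kerS_of_forall fun i => ?_
  by_cases hi : f.d i = 0
  · exact I.qform_kerS (f.v_mem_kerS hi)
  · rw [sub_eq_add_neg, qform_add_left, ← neg_one_smul ℚ, qform_smul_left, h ⟨i, hi⟩]
    ring

theorem sub_vec_coord {a : Fin c → ℚ} (ha : a ∈ I.omegaDual) :
    f.vec (f.coord a) - a ∈ I.kerS := by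
  refine f.sub_mem_kerS fun i => ?_
  have h1 := f.two_qform_vec (f.coord a) i
  rw [f.coe_coord ha] at h1
  linarith

theorem _root_.JacobiMatrixIndex.MatrixIndex.omega_le_omegaDual : I.omega ≤ I.omegaDual := by
  rw [omega, sup_le_iff]
  constructor
  · rintro _ ⟨a, _, rfl⟩
    exact I.intVec_mem_omegaDual a
  · intro k hk b _
    exact ⟨0, by rw [I.qform_comm, I.qform_kerS hk]; simp⟩

theorem vec_coord_mem {a : Fin c → ℚ} (ha : a ∈ I.omegaDual) : f.vec (f.coord a) ∈ I.omegaDual := by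
  have := I.omegaDual.add_mem (I.omega_le_omegaDual (I.kerS_le_omega (f.sub_vec_coord ha))) ha
  rwa [sub_add_cancel] at this

theorem vec_add (m n : f.J → ℤ) : f.vec (m + n) = f.vec m + f.vec n := by
  simp only [vec, ← Finset.sum_add_distrib, ← add_smul, Pi.add_apply, Int.cast_add, add_div]

/-- The i-th basis vector has coordinate 2dᵢ, so changing coordinates by multiples of 2dᵢ adds
integral combinations of the basis, which lie in Ω. -/
theorem vec_mem_omega (k : f.J → ℤ) : f.vec (fun i => 2 * f.d i * k i) ∈ I.omega := by
  refine AddSubgroup.sum_mem _ fun i _ => ?_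
  have hi : (f.d i : ℚ) ≠ 0 := by exact_mod_cast i.2
  have : ((((2 * f.d i * k i : ℤ) : ℚ) / (2 * f.d i)) • f.v i) = k i • f.v i := by
    rw [← Int.cast_smul_eq_zsmul ℚ]
    congr 1
    push_cast
    field_simp
  rw [this]
  exact I.omega.zsmul_mem (f.v_mem_omega i) _

end Frame

/-! ### Classes in the discriminant form D_Ω -/

/-- The class in `D_Ω` of an element of `Ω*`. -/
def cls {a : Fin c → ℚ} (ha : a ∈ I.omegaDual) : I.DOmega := QuotientAddGroup.mk ⟨a, ha⟩

theorem cls_eq_iff {a b : Fin c → ℚ} (ha : a ∈ I.omegaDual) (hb : b ∈ I.omegaDual) :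
    I.cls ha = I.cls hb ↔ b - a ∈ I.omega := by
  rw [cls, cls, QuotientAddGroup.eq, AddSubgroup.mem_addSubgroupOf]
  simp [sub_eq_neg_add]

theorem exists_cls (γ : I.DOmega) : ∃ (a : Fin c → ℚ) (ha : a ∈ I.omegaDual), I.cls ha = γ := by
  induction γ using QuotientAddGroup.induction_on with
  | H a => exact ⟨a.1, a.2, rfl⟩

theorem cls_add {a b : Fin c → ℚ} (ha : a ∈ I.omegaDual) (hb : b ∈ I.omegaDual) :
    I.cls (I.omegaDual.add_mem ha hb) = I.cls ha + I.cls hb := rfl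

theorem quad_cls {a : Fin c → ℚ} (ha : a ∈ I.omegaDual) :
    I.quad (I.cls ha) = ((qform I.S a a : ℚ) : AddCircle (1 : ℚ)) := rfl

theorem polar_quad_cls {a b : Fin c → ℚ} (ha : a ∈ I.omegaDual) (hb : b ∈ I.omegaDual) :
    polar I.quad (I.cls ha) (I.cls hb) = ((2 * qform I.S a b : ℚ) : AddCircle (1 : ℚ)) :=
  I.polar_quadFun _ _

theorem intClass_eq (u : Fin c → ℤ) : I.intClass u = I.cls (I.intVec_mem_omegaDual u) := rfl

/-- The coordinates modulo 2dᵢ already determine the class modulo Ω. -/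
theorem finite_DOmega [Finite Δ] : Finite I.DOmega := by
  obtain ⟨f⟩ := I.nonempty_frame
  let R := ∀ i : f.J, ZMod (2 * f.d i)
  have : ∀ i : f.J, NeZero (2 * f.d i) := fun i => ⟨Nat.mul_ne_zero two_ne_zero i.2⟩
  let g : I.omegaDual → R := fun a i => (f.coord a.1 i : ZMod (2 * f.d i))
  have hg : ∀ a b : I.omegaDual, g a = g b →
      (QuotientAddGroup.mk a : I.DOmega) = QuotientAddGroup.mk b := by
    intro a b hab
    change I.cls a.2 = I.cls b.2
    rw [cls_eq_iff]
    have h1 : ∀ i : f.J, ∃ k : ℤ, f.coord b.1 i - f.coord a.1 i = 2 * f.d i * k := fun i => by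
      have h2 : ((f.coord a.1 i : ℤ) : ZMod (2 * f.d i)) = (f.coord b.1 i : ℤ) := congrFun hab i
      rw [ZMod.intCast_eq_intCast_iff_dvd_sub] at h2
      exact_mod_cast h2
    choose k hk using h1
    have h3 : f.vec (f.coord b.1) = f.vec (f.coord a.1) + f.vec (fun i => 2 * f.d i * k i) := by
      rw [← f.vec_add]
      congr 1
      funext i
      rw [Pi.add_apply, ← hk]
      ring
    have h4 := I.omega.sub_mem (I.omega.add_mem (f.vec_mem_omega k)
      (I.kerS_le_omega (f.sub_vec_coord a.2))) (I.kerS_le_omega (f.sub_vec_coord b.2))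
    rw [h3] at h4
    convert h4 using 1
    abel
  refine Finite.of_injective (fun γ : I.DOmega => g γ.out) fun γ γ' h => ?_
  have := hg _ _ h
  rwa [QuotientAddGroup.out_eq', QuotientAddGroup.out_eq'] at this

end MatrixIndex

end JacobiMatrixIndex

namespace JacobiMatrixIndex

open QuadraticMap (polar)

/-! ### Products of series -/

theorem hasSum_pi_fin {β : Type*} (n : ℕ) (f : Fin n → β → ℂ) (hf : ∀ i, Summable fun b => ‖f i b‖) :
    Summable (fun x : Fin n → β => ‖∏ i, f i (x i)‖) ∧
      HasSum (fun x : Fin n → β => ∏ i, f i (x i)) (∏ i, ∑' b, f i b) := by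
  induction n with
  | zero =>
    exact ⟨(hasSum_fintype _).summable, by simp⟩
  | succ n ih =>
    obtain ⟨h1, h2⟩ := ih (fun i => f i.succ) fun i => hf _
    have h3 : Summable fun p : β × (Fin n → β) => ‖f 0 p.1 * ∏ i, f (Fin.succ i) (p.2 i)‖ :=
      (summable_mul_of_summable_norm' (hf 0) (hf 0).of_norm h1 h1.of_norm).norm
    have h4 := ((hf 0).of_norm.hasSum.mul h2 h3.of_norm)
    rw [← (Fin.consEquiv fun _ => β).summable_iff, ← (Fin.consEquiv fun _ => β).hasSum_iff]
    simp only [Function.comp_def, Fin.consEquiv_apply, Fin.prod_univ_succ, Fin.cons_zero,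
      Fin.cons_succ]
    exact ⟨h3, h4⟩

theorem hasSum_pi {ι β : Type*} [Fintype ι] (f : ι → β → ℂ) (hf : ∀ i, Summable fun b => ‖f i b‖) :
    Summable (fun x : ι → β => ‖∏ i, f i (x i)‖) ∧
      HasSum (fun x : ι → β => ∏ i, f i (x i)) (∏ i, ∑' b, f i b) := by
  let e := Fintype.equivFin ι
  obtain ⟨h1, h2⟩ := hasSum_pi_fin _ (fun i => f (e.symm i)) fun i => hf _
  let g : (Fin (Fintype.card ι) → β) ≃ (ι → β) := Equiv.arrowCongr e.symm (Equiv.refl β)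
  have hg : ∀ x, ∏ i, f i (g x i) = ∏ j, f (e.symm j) (x j) := fun x =>
    Fintype.prod_equiv e _ _ fun i => by simp [g, Equiv.arrowCongr]
  rw [← g.summable_iff, ← g.hasSum_iff]
  simp only [Function.comp_def, hg]
  refine ⟨h1, ?_⟩
  convert h2 using 1
  exact Fintype.prod_equiv e _ _ fun i => by simp

/-! ### One-dimensional theta functions -/

/-- The theta function `∑ 𝐞(τ n²/(4d) + nζ)`, summed over `n ≡ r` modulo `2d`. -/
def theta₁ (d : ℕ) (r : ℤ) (τ ζ : ℂ) : ℂ :=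
  ce (τ * r ^ 2 / (4 * d) + r * ζ) * jacobiTheta₂ (r * τ + 2 * d * ζ) (2 * d * τ)

theorem theta₁_term {d : ℕ} (hd : d ≠ 0) (r k : ℤ) (τ ζ : ℂ) :
    jacobiTheta₂_term (r + 2 * d * k) ζ (τ / (2 * d)) =
      ce (τ * r ^ 2 / (4 * d) + r * ζ) *
        jacobiTheta₂_term k (r * τ + 2 * d * ζ) (2 * d * τ) := by
  have hd' : (d : ℂ) ≠ 0 := by exact_mod_cast hd
  rw [jacobiTheta₂_term, jacobiTheta₂_term, ce, ← Complex.exp_add]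
  congr 1
  push_cast
  field_simp
  ring

theorem hasSum_theta₁ {d : ℕ} (hd : d ≠ 0) (r : ℤ) {τ : ℂ} (hτ : 0 < τ.im) (ζ : ℂ) :
    HasSum (fun k : ℤ => jacobiTheta₂_term (r + 2 * d * k) ζ (τ / (2 * d))) (theta₁ d r τ ζ) := by
  simp_rw [theta₁_term hd]
  refine (hasSum_jacobiTheta₂_term _ ?_).mul_left _
  have h : 0 < (2 * d : ℝ) := by positivity
  rw [show (2 * d * τ : ℂ) = ((2 * d : ℝ) : ℂ) * τ by push_cast; ring, Complex.im_ofReal_mul]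
  positivity

/-- This is the functional equation of `jacobiTheta₂` at (ζ - r/(2d), τ/(2d)), read from right to
left. It trades the congruence n ≡ r mod 2d for the additive character 𝐞(-nr/(2d)) on all of ℤ. -/
theorem theta₁_inversion {d : ℕ} (hd : d ≠ 0) (r : ℤ) {τ : ℂ} (hτ : 0 < τ.im) (ζ : ℂ) :
    theta₁ d r (-1 / τ) (ζ / τ) = (-Complex.I * (τ / (2 * d))) ^ (1 / 2 : ℂ) *
      ce (d * ζ ^ 2 / τ) * jacobiTheta₂ (ζ - r / (2 * d)) (τ / (2 * d)) := by
  have hd' : (d : ℂ) ≠ 0 := by exact_mod_cast hd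
  have h0 : τ ≠ 0 := by rintro rfl; simp at hτ
  have h1 : (-Complex.I * (τ / (2 * d))) ^ (1 / 2 : ℂ) ≠ 0 := by
    rw [Complex.cpow_ne_zero_iff]
    left
    simp [h0, hd']
  have e1 : (ζ - r / (2 * d)) / (τ / (2 * d)) = r * (-1 / τ) + 2 * d * (ζ / τ) := by
    field_simp
    ring
  have e2 : -1 / (τ / (2 * d)) = 2 * d * (-1 / τ) := by
    field_simp
  have e3 : ce (d * ζ ^ 2 / τ) * Complex.exp
      (-(Real.pi : ℂ) * Complex.I * (ζ - r / (2 * d)) ^ 2 / (τ / (2 * d))) =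
        ce (-1 / τ * r ^ 2 / (4 * d) + r * (ζ / τ)) := by
    rw [ce, ce, ← Complex.exp_add]
    congr 1
    field_simp
    ring
  rw [theta₁, jacobiTheta₂_functional_equation (ζ - r / (2 * d)), e1, e2, ← e3]
  field_simp

theorem mul_cpow_of_arg {x y : ℂ} (hx : x ≠ 0) (hy : y ≠ 0)
    (h : x.arg + y.arg ∈ Set.Ioc (-Real.pi) Real.pi) (r : ℂ) : (x * y) ^ r = x ^ r * y ^ r := by
  rw [Complex.cpow_def_of_ne_zero (mul_ne_zero hx hy), Complex.cpow_def_of_ne_zero hx,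
    Complex.cpow_def_of_ne_zero hy, Complex.log_mul hx hy h, add_mul, Complex.exp_add]

/-- The arguments of -i and τ are -π/2 and a number in [0, π], so the principal branch is
multiplicative here. The dependence on τ is thus exactly that of the root belonging to S. -/
theorem neg_I_mul_cpow_half {τ : ℂ} (hτ : 0 < τ.im) {d : ℕ} (hd : d ≠ 0) :
    (-Complex.I * (τ / (2 * d))) ^ (1 / 2 : ℂ) =
      ((-Complex.I) ^ (1 / 2 : ℂ) * ((1 / (2 * d) : ℝ) : ℂ) ^ (1 / 2 : ℂ)) * τ ^ (1 / 2 : ℂ) := by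
  have h0 : τ ≠ 0 := by rintro rfl; simp at hτ
  have e : -Complex.I * (τ / (2 * d)) = ((1 / (2 * d) : ℝ) : ℂ) * (-Complex.I * τ) := by
    push_cast; ring
  have h1 : 0 < (1 / (2 * d) : ℝ) := by positivity
  have harg : (-Complex.I).arg + τ.arg ∈ Set.Ioc (-Real.pi) Real.pi := by
    rw [Complex.arg_neg_I]
    have := Complex.arg_nonneg_iff.2 hτ.le
    have h3 := Complex.arg_le_pi τ
    have := Real.pi_pos
    constructor <;> linarith
  have hI : -Complex.I ≠ 0 := neg_ne_zero.2 Complex.I_ne_zero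
  have h2 : (((1 / (2 * d) : ℝ) : ℂ)).arg = 0 := Complex.arg_ofReal_of_nonneg h1.le
  rw [e, mul_cpow_of_arg (Complex.ofReal_ne_zero.2 h1.ne') (mul_ne_zero hI h0),
    mul_cpow_of_arg hI h0 harg]
  · ring
  · rw [h2, zero_add]
    exact Complex.arg_mem_Ioc _

end JacobiMatrixIndex

namespace JacobiMatrixIndex

open QuadraticMap (polar)

variable {c : ℕ} {Δ : Type*} [AddCommGroup Δ]

namespace MatrixIndex

variable {Q : QuadraticMap ℤ Δ (AddCircle (1 : ℚ))} {I : MatrixIndex c Q}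

/-! ### The theta function in orthogonal coordinates -/

/-- The class in `Ω*/ker S` of an element of `Ω*`. -/
def bcls (I : MatrixIndex c Q) {a : Fin c → ℚ} (ha : a ∈ I.omegaDual) : I.OmegaBarDual :=
  QuotientAddGroup.mk ⟨a, ha⟩

theorem exists_bcls (a : I.OmegaBarDual) :
    ∃ (x : Fin c → ℚ) (hx : x ∈ I.omegaDual), I.bcls hx = a := by
  induction a using QuotientAddGroup.induction_on with
  | H a => exact ⟨a.1, a.2, rfl⟩

theorem bcls_eq_iff {a b : Fin c → ℚ} (ha : a ∈ I.omegaDual) (hb : b ∈ I.omegaDual) :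
    I.bcls ha = I.bcls hb ↔ b - a ∈ I.kerS := by
  rw [bcls, bcls, QuotientAddGroup.eq, AddSubgroup.mem_addSubgroupOf]
  simp [sub_eq_neg_add]

@[simp] theorem barToD_bcls {a : Fin c → ℚ} (ha : a ∈ I.omegaDual) :
    I.barToD (I.bcls ha) = I.cls ha := rfl

@[simp] theorem thetaTerm_bcls (τ : ℍ) (z : Fin c → ℂ) {a : Fin c → ℚ} (ha : a ∈ I.omegaDual) :
    I.thetaTerm τ z (I.bcls ha) = I.thetaExp τ z a := rfl

theorem cform_smul_right (S : Matrix (Fin c) (Fin c) ℚ) (r : ℂ) (x z : Fin c → ℂ) :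
    cform S x (r • z) = r * cform S x z := by
  simp [cform, Matrix.mulVec_smul]

theorem cform_smul_left (S : Matrix (Fin c) (Fin c) ℚ) (r : ℂ) (x z : Fin c → ℂ) :
    cform S (r • x) z = r * cform S x z := by
  simp [cform]

theorem cform_add_right (S : Matrix (Fin c) (Fin c) ℚ) (x y z : Fin c → ℂ) :
    cform S x (y + z) = cform S x y + cform S x z := by
  simp [cform, Matrix.mulVec_add, dotProduct_add]

namespace Frame

variable (f : I.Frame)

/-- The coordinates of `z`. -/
def zeta (z : Fin c → ℂ) (i : f.J) : ℂ := cform I.S (ratVec (f.v i)) z / f.d i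

/-- The summand of the theta function with coordinates `n`. -/
def thetaProd (τ : ℍ) (z : Fin c → ℂ) (n : f.J → ℤ) : ℂ :=
  ∏ i : f.J, jacobiTheta₂_term (n i) (f.zeta z i) (τ / (2 * f.d i))

theorem cast_d_ne_zero (i : f.J) : (f.d i : ℂ) ≠ 0 := by exact_mod_cast i.2

/-- Orthogonality splits the exponent into the one-dimensional terms τ nᵢ²/(4dᵢ) + nᵢ ζᵢ. -/
theorem thetaProd_vec (τ : ℍ) (z : Fin c → ℂ) (n : f.J → ℤ) :
    f.thetaProd τ z n = I.thetaExp τ z (f.vec n) := by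
  have h1 : (qform I.S (f.vec n) (f.vec n) : ℂ) = ∑ i : f.J, (n i : ℂ) ^ 2 / (4 * f.d i) := by
    rw [f.qform_eq_sum]
    push_cast
    refine Finset.sum_congr rfl fun i _ => ?_
    have := congrArg (fun q : ℚ => (q : ℂ)) (f.two_qform_vec n i)
    push_cast at this
    rw [← this]
    ring
  have h2 : 2 * cform I.S (ratVec (f.vec n)) z = ∑ i : f.J, (n i : ℂ) * f.zeta z i := by
    rw [f.cform_eq_sum, Finset.mul_sum]
    refine Finset.sum_congr rfl fun i _ => ?_
    have := congrArg (fun q : ℚ => (q : ℂ)) (f.two_qform_vec n i)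
    push_cast at this
    rw [cform_ratVec, I.qform_comm, ← this, zeta]
    ring
  rw [thetaExp, h1, h2, Finset.mul_sum, ← Finset.sum_add_distrib, ce_sum, thetaProd]
  refine Finset.prod_congr rfl fun i _ => ?_
  have := f.cast_d_ne_zero i
  rw [jacobiTheta₂_term, ce]
  congr 1
  field_simp
  ring

theorem im_div_pos (τ : ℍ) (i : f.J) : 0 < ((τ : ℂ) / (2 * f.d i)).im := by
  have : (0 : ℝ) < 2 * f.d i := by have := Nat.pos_of_ne_zero i.2; positivity
  rw [show ((τ : ℂ) / (2 * f.d i)) = (τ : ℂ) / ((2 * f.d i : ℝ) : ℂ) by push_cast; rfl,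
    Complex.div_ofReal_im]
  exact div_pos τ.im_pos this

theorem summable_thetaProd (τ : ℍ) (z : Fin c → ℂ) : Summable fun n => ‖f.thetaProd τ z n‖ :=
  (hasSum_pi (fun (i : f.J) (m : ℤ) => jacobiTheta₂_term m (f.zeta z i) (τ / (2 * f.d i)))
    fun i => ((summable_jacobiTheta₂_term_iff _ _).2 (f.im_div_pos τ i)).norm).1

/-- The coordinates of an element of `Ω*/ker S`. -/
def bcoord (a : I.OmegaBarDual) : f.J → ℤ := f.coord (exists_bcls a).choose

theorem coord_congr {a b : Fin c → ℚ} (h : a - b ∈ I.kerS) : f.coord b = f.coord a := by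
  funext i
  rw [coord, coord]
  congr 2
  rw [I.qform_comm a, I.qform_comm b, ← sub_add_cancel a b, qform_add_right, I.qform_kerS h,
    zero_add]

theorem bcoord_bcls {a : Fin c → ℚ} (ha : a ∈ I.omegaDual) : f.bcoord (I.bcls ha) = f.coord a := by
  obtain ⟨hx, h⟩ := (exists_bcls (I.bcls ha)).choose_spec
  rw [bcls_eq_iff] at h
  exact f.coord_congr h

theorem bcoord_injective : Function.Injective f.bcoord := by
  intro a b hab
  obtain ⟨x, hx, rfl⟩ := exists_bcls a
  obtain ⟨y, hy, rfl⟩ := exists_bcls b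
  rw [bcoord_bcls, bcoord_bcls] at hab
  rw [bcls_eq_iff]
  refine f.sub_mem_kerS fun i => ?_
  have := congrArg (fun q : ℤ => (q : ℚ)) (congrFun hab i)
  simp only [f.coe_coord hx, f.coe_coord hy] at this
  linarith

theorem thetaTerm_eq (τ : ℍ) (z : Fin c → ℂ) (a : I.OmegaBarDual) :
    I.thetaTerm τ z a = f.thetaProd τ z (f.bcoord a) := by
  obtain ⟨x, hx, rfl⟩ := exists_bcls a
  rw [bcoord_bcls, thetaProd_vec, thetaTerm_bcls, ← I.thetaExp_congr τ z x _ (f.sub_vec_coord hx)]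
  congr 1
  abel

theorem mem_range_bcoord {n : f.J → ℤ} (hn : f.vec n ∈ I.omegaDual) : f.bcoord (I.bcls hn) = n := by
  rw [bcoord_bcls, coord_vec]

theorem bcls_vec_bcoord (a : I.OmegaBarDual) :
    ∃ h : f.vec (f.bcoord a) ∈ I.omegaDual, I.bcls h = a := by
  obtain ⟨x, hx, rfl⟩ := exists_bcls a
  refine ⟨by rw [bcoord_bcls]; exact f.vec_coord_mem hx, ?_⟩
  apply f.bcoord_injective
  rw [mem_range_bcoord]

/-- The integral vectors which are the coordinates of an element of the class `γ`. -/
def Ind (γ : I.DOmega) (n : f.J → ℤ) : Prop := ∃ h : f.vec n ∈ I.omegaDual, I.cls h = γ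

open Classical in
-- Coordinates embed Ω*/ker S into the integral vectors. Extension by zero puts all classes on one
-- index set, as the inversion formula requires.
theorem hasSum_theta (τ : ℍ) (z : Fin c → ℂ) (γ : I.DOmega) :
    HasSum (fun n => if f.Ind γ n then f.thetaProd τ z n else 0) (I.theta τ z γ) := by
  let e : {a : I.OmegaBarDual // I.barToD a = γ} → (f.J → ℤ) := fun a => f.bcoord a.1
  have he : Function.Injective e := f.bcoord_injective.comp Subtype.val_injective
  have hr : ∀ n, n ∉ Set.range e → (if f.Ind γ n then f.thetaProd τ z n else 0) = 0 := by
    intro n hn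
    rw [if_neg]
    rintro ⟨h, rfl⟩
    exact hn ⟨⟨I.bcls h, rfl⟩, f.mem_range_bcoord h⟩
  have hf : ∀ a, (if f.Ind γ (e a) then f.thetaProd τ z (e a) else 0) = I.thetaTerm τ z a.1 := by
    rintro ⟨a, rfl⟩
    rw [f.thetaTerm_eq, if_pos]
    obtain ⟨h, h'⟩ := f.bcls_vec_bcoord a
    exact ⟨h, by rw [← barToD_bcls h, h']⟩
  have hs : Summable fun n => if f.Ind γ n then f.thetaProd τ z n else 0 := by
    refine (f.summable_thetaProd τ z).of_norm_bounded fun n => ?_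
    split_ifs <;> simp
  have h1 := (he.hasSum_iff hr).2 hs.hasSum
  simp only [Function.comp_def, hf] at h1
  rw [theta, h1.tsum_eq]
  exact hs.hasSum

/-! #### Residue classes -/

/-- Residue classes of coordinate vectors. -/
abbrev R : Type := ∀ i : f.J, ZMod (2 * f.d i)

instance (i : f.J) : NeZero (2 * f.d i) := ⟨Nat.mul_ne_zero two_ne_zero i.2⟩

/-- Representatives of residue classes. -/
def rep (r : f.R) : f.J → ℤ := fun i => (r i).cast

theorem intCast_rep (r : f.R) (i : f.J) : ((f.rep r i : ℤ) : ZMod (2 * f.d i)) = r i :=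
  ZMod.intCast_zmod_cast _

theorem exists_eq_of_intCast_eq {m n : f.J → ℤ}
    (h : ∀ i : f.J, (m i : ZMod (2 * f.d i)) = n i) :
    ∃ k : f.J → ℤ, n = m + fun i : f.J => 2 * f.d i * k i := by
  have h1 : ∀ i : f.J, ∃ k : ℤ, n i - m i = 2 * f.d i * k := fun i => by
    have h2 := h i
    rw [ZMod.intCast_eq_intCast_iff_dvd_sub] at h2
    exact_mod_cast h2
  choose k hk using h1
  exact ⟨k, by funext i; rw [Pi.add_apply, ← hk]; ring⟩

/-- Division with remainder of coordinate vectors. -/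
def divMod : f.R × (f.J → ℤ) ≃ (f.J → ℤ) :=
  Equiv.ofBijective (fun p => f.rep p.1 + fun i : f.J => 2 * f.d i * p.2 i) <| by
    constructor
    · rintro ⟨r, k⟩ ⟨r', k'⟩ h
      have hr : r = r' := by
        funext i
        have := congrArg (fun m : ℤ => (m : ZMod (2 * f.d i))) (congrFun h i)
        simp only [Pi.add_apply, Int.cast_add, f.intCast_rep] at this
        have h2 : ∀ k : ℤ, ((2 * f.d i * k : ℤ) : ZMod (2 * f.d i)) = 0 := fun k => by
          rw [ZMod.intCast_zmod_eq_zero_iff_dvd]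
          push_cast
          exact dvd_mul_right _ _
        rwa [h2, h2, add_zero, add_zero] at this
      subst hr
      congr 1
      funext i
      have := congrFun (add_left_cancel h) i
      have hi : (2 * f.d i : ℤ) ≠ 0 := by
        have := i.2
        positivity
      exact mul_left_cancel₀ hi this
    · intro n
      obtain ⟨k, hk⟩ := f.exists_eq_of_intCast_eq (m := f.rep fun i : f.J => (n i : ZMod (2 * f.d i)))
        (n := n) fun i => f.intCast_rep _ i
      exact ⟨(_, k), hk.symm⟩

theorem divMod_apply (r : f.R) (k : f.J → ℤ) :
    f.divMod (r, k) = f.rep r + fun i : f.J => 2 * f.d i * k i := rfl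

/-- Sums over residue classes are invariant under translations. -/
theorem sum_rep_add (F : (f.J → ℤ) → ℂ) (hF : ∀ n k : f.J → ℤ,
    F (n + fun i : f.J => 2 * f.d i * k i) = F n) (l : f.J → ℤ) :
    ∑ r, F (f.rep r + l) = ∑ r, F (f.rep r) := by
  refine Fintype.sum_equiv (Equiv.addRight (fun i : f.J => (l i : ZMod (2 * f.d i)) : f.R)) _ _
    fun r => ?_
  obtain ⟨k, hk⟩ := f.exists_eq_of_intCast_eq (m := f.rep r + l)
    (n := f.rep (r + fun i : f.J => (l i : ZMod (2 * f.d i)))) fun i => by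
      rw [f.intCast_rep, Pi.add_apply, Int.cast_add, f.intCast_rep]
      rfl
  rw [Equiv.coe_addRight, hk, hF]

theorem ind_iff {a : Fin c → ℚ} (ha : a ∈ I.omegaDual) (n : f.J → ℤ) :
    f.Ind (I.cls ha) n ↔ f.vec n - a ∈ I.omega := by
  constructor
  · rintro ⟨h, h'⟩
    exact (cls_eq_iff I ha h).1 h'.symm
  · intro h
    have h1 : f.vec n ∈ I.omegaDual := by
      have := I.omegaDual.add_mem (I.omega_le_omegaDual h) ha
      rwa [sub_add_cancel] at this
    exact ⟨h1, ((cls_eq_iff I ha h1).2 h).symm⟩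

theorem ind_add (γ : I.DOmega) (n k : f.J → ℤ) :
    f.Ind γ (n + fun i : f.J => 2 * f.d i * k i) ↔ f.Ind γ n := by
  obtain ⟨a, ha, rfl⟩ := I.exists_cls γ
  rw [ind_iff, ind_iff, vec_add, add_sub_right_comm]
  exact I.omega.add_mem_cancel_right (f.vec_mem_omega k)

open Classical in
/-- The theta functions are finite sums of products of Jacobi theta functions. -/
theorem theta_eq_sum (τ : ℍ) (z : Fin c → ℂ) (γ : I.DOmega) :
    I.theta τ z γ = ∑ r : f.R, if f.Ind γ (f.rep r) then
      ∏ i : f.J, theta₁ (f.d i) (f.rep r i) τ (f.zeta z i) else 0 := by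
  have h1 := (f.divMod.hasSum_iff).2 (f.hasSum_theta τ z γ)
  have h2 : ∀ r : f.R, HasSum (fun k => if f.Ind γ (f.divMod (r, k)) then
      f.thetaProd τ z (f.divMod (r, k)) else 0) (if f.Ind γ (f.rep r) then
      ∏ i : f.J, theta₁ (f.d i) (f.rep r i) τ (f.zeta z i) else 0) := fun r => by
    simp_rw [divMod_apply, ind_add]
    split_ifs with h
    · have h3 : ∀ i : f.J, HasSum (fun k : ℤ => jacobiTheta₂_term (f.rep r i + 2 * f.d i * k)
          (f.zeta z i) (τ / (2 * f.d i))) (theta₁ (f.d i) (f.rep r i) τ (f.zeta z i)) :=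
        fun i => hasSum_theta₁ i.2 _ τ.im_pos _
      have h4 := (hasSum_pi (fun (i : f.J) (k : ℤ) => jacobiTheta₂_term (f.rep r i + 2 * f.d i * k)
        (f.zeta z i) (τ / (2 * f.d i))) fun i => (h3 i).summable.norm).2
      simp_rw [fun i => (h3 i).tsum_eq] at h4
      exact h4
    · exact hasSum_zero
  have h3 := h1.prod_fiberwise h2
  exact h3.unique (hasSum_fintype _)

end Frame

theorem summable_thetaTerm [Finite Δ] (I : MatrixIndex c Q) (τ : ℍ) (z : Fin c → ℂ) :
    Summable fun a => ‖I.thetaTerm τ z a‖ := by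
  obtain ⟨f⟩ := I.nonempty_frame
  simp_rw [f.thetaTerm_eq]
  exact (f.summable_thetaProd τ z).comp_injective f.bcoord_injective

end MatrixIndex

end JacobiMatrixIndex

namespace JacobiMatrixIndex

open QuadraticMap (polar)

variable {c : ℕ} {Δ : Type*} [AddCommGroup Δ]

namespace MatrixIndex

variable {Q : QuadraticMap ℤ Δ (AddCircle (1 : ℚ))} {I : MatrixIndex c Q}

/-! ### Inversion of the theta function -/

namespace Frame

variable (f : I.Frame)

/-- The character of the coordinate vectors defined by `m`. -/
def chr (m n : f.J → ℤ) : ℂ := ce (-((2 * qform I.S (f.vec n) (f.vec m) : ℚ) : ℂ))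

theorem chr_add (m n n' : f.J → ℤ) : f.chr m (n + n') = f.chr m n * f.chr m n' := by
  rw [chr, chr, chr, ← ce_add, vec_add, qform_add_left]
  congr 1
  push_cast
  ring

theorem chr_period (m k : f.J → ℤ) : f.chr m (fun i : f.J => 2 * f.d i * k i) = 1 := by
  have h : 2 * qform I.S (f.vec fun i : f.J => 2 * f.d i * k i) (f.vec m) =
      ((∑ i, k i * m i : ℤ) : ℚ) := by
    rw [two_qform_eq_sum]
    push_cast
    refine Finset.sum_congr rfl fun i _ => ?_
    rw [two_qform_vec]
    have hi : (f.d i : ℚ) ≠ 0 := by exact_mod_cast i.2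
    push_cast
    field_simp
  rw [chr, h, ce_neg, Rat.cast_intCast, ce_intCast, inv_one]

theorem chr_eq_prod (m n : f.J → ℤ) :
    f.chr m n = ∏ i : f.J, ce (-((n i : ℂ) * m i / (2 * f.d i))) := by
  rw [chr, two_qform_eq_sum, ← ce_sum, Finset.sum_neg_distrib]
  push_cast
  congr 2
  refine Finset.sum_congr rfl fun i _ => ?_
  have := congrArg (fun q : ℚ => (q : ℂ)) (f.two_qform_vec n i)
  push_cast at this
  rw [← this]

/-- The character is absorbed by translating ζᵢ by -nᵢ/(2dᵢ), which is the form produced by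
`theta₁_inversion`. -/
theorem hasSum_chr (τ : ℍ) (z : Fin c → ℂ) (n : f.J → ℤ) :
    HasSum (fun m => f.chr m n * f.thetaProd τ z m)
      (∏ i : f.J, jacobiTheta₂ (f.zeta z i - n i / (2 * f.d i)) (τ / (2 * f.d i))) := by
  have h := (hasSum_pi (fun (i : f.J) (m : ℤ) =>
    jacobiTheta₂_term m (f.zeta z i - n i / (2 * f.d i)) (τ / (2 * f.d i)))
    fun i => ((summable_jacobiTheta₂_term_iff _ _).2 (f.im_div_pos τ i)).norm).2
  have e : (fun m => f.chr m n * f.thetaProd τ z m) = fun m : f.J → ℤ => ∏ i : f.J,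
      jacobiTheta₂_term (m i) (f.zeta z i - n i / (2 * f.d i)) (τ / (2 * f.d i)) := by
    funext m
    rw [chr_eq_prod, thetaProd, ← Finset.prod_mul_distrib]
    refine Finset.prod_congr rfl fun i _ => ?_
    rw [jacobiTheta₂_term, jacobiTheta₂_term, ce, ← Complex.exp_add]
    congr 1
    ring
  rw [e]
  exact h

open Classical in
/-- The character sum over a class. -/
def charSum (γ : I.DOmega) (m : f.J → ℤ) : ℂ :=
  ∑ r, if f.Ind γ (f.rep r) then f.chr m (f.rep r) else 0

theorem ind_shift {a : Fin c → ℚ} (ha : a ∈ I.omegaDual) (γ : I.DOmega) (n : f.J → ℤ) :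
    f.Ind (I.cls ha + γ) (n + f.coord a) ↔ f.Ind γ n := by
  obtain ⟨b, hb, rfl⟩ := I.exists_cls γ
  rw [← cls_add, ind_iff, ind_iff, vec_add]
  have := I.kerS_le_omega (f.sub_vec_coord ha)
  rw [show f.vec n + f.vec (f.coord a) - (a + b) = (f.vec n - b) + (f.vec (f.coord a) - a) by abel]
  exact I.omega.add_mem_cancel_right this

/-- Residue classes are reindexed by adding the coordinates of a; the summand is periodic modulo
2dᵢ. -/
theorem charSum_shift {a : Fin c → ℚ} (ha : a ∈ I.omegaDual) (γ : I.DOmega) (m : f.J → ℤ) :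
    f.charSum (I.cls ha + γ) m = f.chr m (f.coord a) * f.charSum γ m := by
  classical
  rw [charSum, ← f.sum_rep_add (fun n => if f.Ind (I.cls ha + γ) n then f.chr m n else 0)
    (fun n k => by rw [chr_add, chr_period, mul_one]; exact if_congr (f.ind_add _ _ _) rfl rfl)
    (f.coord a), charSum, Finset.mul_sum]
  refine Finset.sum_congr rfl fun r _ => ?_
  simp only [ind_shift, chr_add]
  split_ifs
  · ring
  · simp

theorem chr_coord {a : Fin c → ℚ} (ha : a ∈ I.omegaDual) (m : f.J → ℤ) :
    f.chr m (f.coord a) = ce (-((2 * qform I.S a (f.vec m) : ℚ) : ℂ)) := by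
  rw [chr]
  congr 4
  rw [← sub_add_cancel (f.vec _) a, qform_add_left, I.qform_comm _ (f.vec m),
    I.qform_kerS (f.sub_vec_coord ha), zero_add]

open Classical in
/-- The number of residue classes in the trivial class. -/
def mult : ℂ := ∑ r, if f.Ind 0 (f.rep r) then 1 else 0

theorem mult_ne_zero : f.mult ≠ 0 := by
  classical
  rw [mult, Finset.sum_boole, Nat.cast_ne_zero, Finset.card_ne_zero]
  refine ⟨0, ?_⟩
  rw [Finset.mem_filter]
  refine ⟨Finset.mem_univ _, ?_⟩
  have h0 : f.vec (f.rep 0) = 0 := by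
    have : f.rep 0 = 0 := by funext i; exact ZMod.cast_zero
    rw [this, vec]
    simp
  exact ⟨by rw [h0]; exact zero_mem _, by
    rw [show (0 : I.DOmega) = I.cls (zero_mem _) from rfl, cls_eq_iff, h0, sub_zero]
    exact zero_mem _⟩

theorem charSum_of_mem {γ : I.DOmega} {m : f.J → ℤ} (hm : f.vec m ∈ I.omegaDual) :
    f.charSum γ m = f.mult * qe (-polar I.quad γ (I.cls hm)) := by
  classical
  obtain ⟨a, ha, rfl⟩ := I.exists_cls γ
  have h0 : f.charSum 0 m = f.mult := by
    refine Finset.sum_congr rfl fun r _ => ?_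
    split_ifs with h
    · obtain ⟨h1, h2⟩ := h
      have h3 : f.vec (f.rep r) ∈ I.omega := by
        have := (cls_eq_iff I (zero_mem _) h1).1 h2.symm
        rwa [sub_zero] at this
      obtain ⟨k, hk⟩ := hm _ h3
      rw [chr, I.qform_comm, hk, ce_neg, Rat.cast_intCast, ce_intCast, inv_one]
    · rfl
  have := f.charSum_shift ha 0 m
  rw [add_zero, h0] at this
  rw [this, chr_coord f ha, polar_quad_cls, qe_neg, qe_coe, ce_neg, mul_comm]

/-- Some b ∈ Ω pairs non-integrally with the vector. Shifting by b fixes γ but multiplies the sum by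
a number different from 1. This is how the inversion cuts all integral vectors down to the dual
lattice. -/
theorem charSum_of_notMem {γ : I.DOmega} {m : f.J → ℤ} (hm : f.vec m ∉ I.omegaDual) :
    f.charSum γ m = 0 := by
  obtain ⟨b, hb, hb'⟩ : ∃ b ∈ I.omega, ¬ ∃ n : ℤ, 2 * qform I.S (f.vec m) b = n := by
    by_contra h
    push Not at h
    exact hm h
  have h1 := f.charSum_shift (I.omega_le_omegaDual hb) γ m
  have h2 : I.cls (I.omega_le_omegaDual hb) = 0 := by
    rw [show (0 : I.DOmega) = I.cls (zero_mem _) from rfl, cls_eq_iff, zero_sub]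
    exact I.omega.neg_mem hb
  rw [h2, zero_add, chr_coord f (I.omega_le_omegaDual hb)] at h1
  by_contra h3
  have h4 := mul_right_cancel₀ h3 ((one_mul _).trans h1)
  rw [ce_neg, eq_comm, inv_eq_one, ce_eq_one_iff] at h4
  obtain ⟨n, hn⟩ := h4
  exact hb' ⟨n, by rw [I.qform_comm]; exact_mod_cast hn⟩

/-- The automorphy factor in the inversion formula. -/
def cst (τ : ℍ) : ℂ := f.mult * ∏ i : f.J, (-Complex.I * (τ / (2 * f.d i))) ^ (1 / 2 : ℂ)

/-- Each one-dimensional factor is inverted and the finite sum over residue classes is taken inside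
the series. The resulting `charSum` vanishes off Ω* and elsewhere equals `mult` times the character
of D_Ω, which regroups the series into components of Θ. -/
theorem theta_inversion [Fintype I.DOmega] (τ : ℍ) (z : Fin c → ℂ) (γ : I.DOmega) :
    I.theta (ModularGroup.S • τ) ((τ : ℂ)⁻¹ • z) γ = f.cst τ * ce (cform I.S z z / τ) *
      ∑ δ, qe (-polar I.quad γ δ) * I.theta τ z δ := by
  classical
  have hS : ((ModularGroup.S • τ : ℍ) : ℂ) = -1 / τ := by
    rw [UpperHalfPlane.modular_S_smul]
    rw [UpperHalfPlane.coe_mk, inv_neg, neg_div, one_div]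
  have hz : ∀ i, f.zeta ((τ : ℂ)⁻¹ • z) i = f.zeta z i / τ := fun i => by
    rw [zeta, zeta, cform_smul_right]
    ring
  have hzz : cform I.S z z / τ = ∑ i : f.J, f.d i * f.zeta z i ^ 2 / τ := by
    rw [f.cform_eq_sum, Finset.sum_div]
    refine Finset.sum_congr rfl fun i _ => ?_
    have := f.cast_d_ne_zero i
    rw [zeta]
    field_simp
  have h1 : I.theta (ModularGroup.S • τ) ((τ : ℂ)⁻¹ • z) γ =
      (∏ i : f.J, (-Complex.I * (τ / (2 * f.d i))) ^ (1 / 2 : ℂ)) * ce (cform I.S z z / τ) *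
      ∑ r, if f.Ind γ (f.rep r) then ∏ i : f.J, jacobiTheta₂ (f.zeta z i - f.rep r i / (2 * f.d i))
        (τ / (2 * f.d i)) else 0 := by
    rw [theta_eq_sum, Finset.mul_sum]
    refine Finset.sum_congr rfl fun r _ => ?_
    split_ifs
    · rw [hzz, ce_sum, ← Finset.prod_mul_distrib, ← Finset.prod_mul_distrib]
      refine Finset.prod_congr rfl fun i _ => ?_
      rw [hS, hz, theta₁_inversion i.2 _ τ.im_pos]
    · rw [mul_zero]
  have h2 : HasSum (fun m => f.charSum γ m * f.thetaProd τ z m)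
      (∑ r, if f.Ind γ (f.rep r) then ∏ i : f.J,
        jacobiTheta₂ (f.zeta z i - f.rep r i / (2 * f.d i)) (τ / (2 * f.d i)) else 0) := by
    simp_rw [charSum, Finset.sum_mul]
    refine hasSum_sum fun r _ => ?_
    split_ifs
    · exact f.hasSum_chr τ z _
    · simp_rw [zero_mul]
      exact hasSum_zero
  have h3 : HasSum (fun m => f.mult * ∑ δ, qe (-polar I.quad γ δ) *
      if f.Ind δ m then f.thetaProd τ z m else 0)
      (f.mult * ∑ δ, qe (-polar I.quad γ δ) * I.theta τ z δ) :=
    (hasSum_sum fun δ _ => (f.hasSum_theta τ z δ).mul_left _).mul_left _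
  have h4 : ∀ m, f.charSum γ m * f.thetaProd τ z m = f.mult * ∑ δ, qe (-polar I.quad γ δ) *
      if f.Ind δ m then f.thetaProd τ z m else 0 := fun m => by
    by_cases hm : f.vec m ∈ I.omegaDual
    · rw [charSum_of_mem f hm, Finset.sum_eq_single (I.cls hm), if_pos ⟨hm, rfl⟩]
      · ring
      · intro δ _ hδ
        rw [if_neg, mul_zero]
        rintro ⟨_, h⟩
        exact hδ h.symm
      · simp
    · rw [charSum_of_notMem f hm, Finset.sum_eq_zero, zero_mul, mul_zero]
      intro δ _
      rw [if_neg, mul_zero]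
      rintro ⟨h, _⟩
      exact hm h
  simp_rw [h4] at h2
  rw [h1, h2.unique h3, cst]
  ring

/-- Only the shape and c₀ ≠ 0 are recorded; the value of c₀ is determined in `theta_S_smul`. -/
theorem exists_cst_eq : ∃ c₀ : ℂ, c₀ ≠ 0 ∧ ∀ τ : ℍ, f.cst τ = c₀ * Mp2Z.S.root τ ^ I.S.rank := by
  refine ⟨f.mult * ∏ i : f.J, ((-Complex.I) ^ (1 / 2 : ℂ) *
    ((1 / (2 * f.d i) : ℝ) : ℂ) ^ (1 / 2 : ℂ)), ?_, fun τ => ?_⟩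
  · refine mul_ne_zero f.mult_ne_zero (Finset.prod_ne_zero_iff.2 fun i _ => mul_ne_zero ?_ ?_)
    · rw [Complex.cpow_ne_zero_iff]
      left
      simp
    · rw [Complex.cpow_ne_zero_iff]
      left
      simpa using i.2
  · rw [cst, Mp2Z.root_S, ← f.card_J, ← Finset.card_univ, ← Finset.prod_const, mul_assoc,
      ← Finset.prod_mul_distrib]
    congr 1
    exact Finset.prod_congr rfl fun i _ => neg_I_mul_cpow_half τ.im_pos i.2

end Frame

/-! ### Translations of the theta function -/

theorem theta_T (τ : ℍ) (z : Fin c → ℂ) (γ : I.DOmega) :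
    I.theta (ModularGroup.T • τ) z γ = qe (I.quad γ) * I.theta τ z γ := by
  rw [theta, theta, ← tsum_mul_left]
  refine tsum_congr ?_
  rintro ⟨a, rfl⟩
  obtain ⟨x, hx, rfl⟩ := exists_bcls a
  rw [thetaTerm_bcls, thetaTerm_bcls, barToD_bcls, quad_cls, qe_coe, thetaExp, thetaExp, ← ce_add,
    UpperHalfPlane.modular_T_smul]
  congr 1
  simp
  ring

/-- Translations by Ω* act on the components through characters of D_Ω, so a single component can be
isolated by averaging (`IsLift.mul_theta`). -/
theorem theta_add_vec (τ : ℍ) (z : Fin c → ℂ) (γ : I.DOmega) {v : Fin c → ℚ}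
    (hv : v ∈ I.omegaDual) :
    I.theta τ (z + ratVec v) γ = qe (polar I.quad γ (I.cls hv)) * I.theta τ z γ := by
  rw [theta, theta, ← tsum_mul_left]
  refine tsum_congr ?_
  rintro ⟨a, rfl⟩
  obtain ⟨x, hx, rfl⟩ := exists_bcls a
  rw [thetaTerm_bcls, thetaTerm_bcls, barToD_bcls, polar_quad_cls, qe_coe, thetaExp, thetaExp,
    ← ce_add, cform_add_right, cform_ratVec]
  congr 1
  push_cast
  ring

end MatrixIndex

end JacobiMatrixIndex

namespace JacobiMatrixIndex

open QuadraticMap (polar)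

/-! ### Orthogonality of exponentials on the unit cube -/

open MeasureTheory in
theorem integral_ce_int (k : ℤ) :
    ∫ x in (Set.Icc 0 1 : Set ℝ), ce ((k : ℂ) * x) = if k = 0 then 1 else 0 := by
  split_ifs with h
  · subst h
    simp
  · rw [integral_Icc_eq_integral_Ioc, ← intervalIntegral.integral_of_le zero_le_one]
    have hc : (2 * Real.pi * Complex.I * k : ℂ) ≠ 0 :=
      mul_ne_zero Complex.two_pi_I_ne_zero (by exact_mod_cast h)
    have h1 : ∀ x : ℝ, ce ((k : ℂ) * x) = Complex.exp (2 * Real.pi * Complex.I * k * x) := fun x => by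
      rw [ce]; congr 1; ring
    simp_rw [h1]
    rw [integral_exp_mul_complex hc]
    have h2 : Complex.exp (2 * Real.pi * Complex.I * k) = 1 := by
      have := ce_intCast k
      rwa [ce] at this
    simp [h2]

open MeasureTheory in
theorem integral_ce_int_pi {c : ℕ} (k : Fin c → ℤ) :
    ∫ x in (Set.Icc 0 1 : Set (Fin c → ℝ)), ce (∑ i, (k i : ℂ) * x i) = if k = 0 then 1 else 0 := by
  have h1 : (Set.Icc 0 1 : Set (Fin c → ℝ)) = Set.univ.pi fun _ => Set.Icc 0 1 := by
    rw [Set.pi_univ_Icc]; rfl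
  simp_rw [ce_sum]
  rw [h1, volume_pi, Measure.restrict_pi_pi]
  rw [integral_fintype_prod_eq_prod (f := fun i (x : ℝ) => ce ((k i : ℂ) * x))]
  simp_rw [integral_ce_int]
  split_ifs with h
  · simp [h]
  · obtain ⟨i, hi⟩ := Function.ne_iff.1 h
    exact Finset.prod_eq_zero (Finset.mem_univ i) (if_neg hi)

variable {c : ℕ} {Δ : Type*} [AddCommGroup Δ]

namespace MatrixIndex

variable {Q : QuadraticMap ℤ Δ (AddCircle (1 : ℚ))} (I : MatrixIndex c Q)

/-! ### Fourier coefficients of theta series -/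

/-- A real multiple of a real vector as complex vector. -/
def scaledVec (N : ℕ) {c : ℕ} (x : Fin c → ℝ) : Fin c → ℂ := fun i => (N : ℂ) * (x i : ℂ)

theorem thetaExp_add (τ : ℍ) (z w : Fin c → ℂ) (a : Fin c → ℚ) :
    I.thetaExp τ (z + w) a = I.thetaExp τ z a * ce (2 * cform I.S (ratVec a) w) := by
  rw [thetaExp, thetaExp, ← ce_add, cform_add_right]
  congr 1
  ring

theorem thetaExp_ne_zero (τ : ℍ) (z : Fin c → ℂ) (a : Fin c → ℚ) : I.thetaExp τ z a ≠ 0 :=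
  ce_ne_zero _

section

variable [Fintype Δ]

theorem card_single_mem (i : Fin c) :
    (Fintype.card Δ : ℚ) • (Pi.single i 1 : Fin c → ℚ) ∈ I.omega := by
  refine AddSubgroup.mem_sup_left ⟨Fintype.card Δ • Pi.single i 1, ?_, ?_⟩
  · change I.ψ _ = 0
    rw [map_nsmul]
    exact card_nsmul_eq_zero
  · ext j
    by_cases h : j = i
    · subst h; simp [intVec]
    · simp [intVec, h]

/-- The frequency `2N Sa` of the torus `ℝ^c / N ℤ^c` with `N = |Δ|`. -/
def freq (a : Fin c → ℚ) (i : Fin c) : ℤ :=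
  ⌊2 * (Fintype.card Δ : ℚ) * qform I.S a (Pi.single i 1)⌋

theorem coe_freq {a : Fin c → ℚ} (ha : a ∈ I.omegaDual) (i : Fin c) :
    (I.freq a i : ℚ) = 2 * (Fintype.card Δ : ℚ) * qform I.S a (Pi.single i 1) := by
  obtain ⟨n, hn⟩ := ha _ (I.card_single_mem i)
  rw [qform_smul_right, ← mul_assoc] at hn
  rw [freq, hn, Int.floor_intCast]

theorem sub_mem_kerS_of_freq {a b : Fin c → ℚ} (ha : a ∈ I.omegaDual) (hb : b ∈ I.omegaDual)
    (h : I.freq a = I.freq b) : a - b ∈ I.kerS := by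
  have hN : (Fintype.card Δ : ℚ) ≠ 0 := by exact_mod_cast Fintype.card_ne_zero
  rw [mem_kerS]
  ext i
  have h1 := congrArg (fun q : ℤ => (q : ℚ)) (congrFun h i)
  simp only [I.coe_freq ha, I.coe_freq hb] at h1
  have h2 : qform I.S a (Pi.single i 1) = qform I.S b (Pi.single i 1) :=
    mul_left_cancel₀ (mul_ne_zero two_ne_zero hN) h1
  have h3 : ∀ y, qform I.S y (Pi.single i 1) = (I.S *ᵥ y) i := fun y => by
    rw [I.qform_comm, qform, single_dotProduct, one_mul]
  rw [h3, h3] at h2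
  rw [Matrix.mulVec_sub, Pi.sub_apply, h2, sub_self, Pi.zero_apply]

theorem two_cform_scaledVec {a : Fin c → ℚ} (ha : a ∈ I.omegaDual) (x : Fin c → ℝ) :
    2 * cform I.S (ratVec a) (scaledVec (Fintype.card Δ) x) = ∑ i, (I.freq a i : ℂ) * x i := by
  rw [Frame.cform_v, Finset.mul_sum]
  refine Finset.sum_congr rfl fun i _ => ?_
  have := congrArg (fun q : ℚ => (q : ℂ)) (I.coe_freq ha i)
  push_cast at this
  rw [this, scaledVec, I.qform_comm]
  ring

variable [Fintype I.DOmega]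

theorem hasSum_sum_theta (f : I.DOmega → ℂ) (τ : ℍ) (z : Fin c → ℂ) :
    HasSum (fun a => f (I.barToD a) * I.thetaTerm τ z a) (∑ γ, f γ * I.theta τ z γ) := by
  classical
  have hs := (I.summable_thetaTerm τ z).of_norm
  have h1 : ∀ γ, HasSum (fun a => f γ * if I.barToD a = γ then I.thetaTerm τ z a else 0)
      (f γ * I.theta τ z γ) := fun γ => by
    refine HasSum.mul_left _ ?_
    have h2 : Summable fun a => if I.barToD a = γ then I.thetaTerm τ z a else 0 :=
      (I.summable_thetaTerm τ z).of_norm_bounded fun a => by split_ifs <;> simp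
    have h3 : I.theta τ z γ = ∑' a, if I.barToD a = γ then I.thetaTerm τ z a else 0 := by
      rw [theta]
      exact (tsum_subtype {a | I.barToD a = γ} (I.thetaTerm τ z)).trans
        (tsum_congr fun a => by simp [Set.indicator_apply])
    rw [h3]
    exact h2.hasSum
  convert hasSum_sum fun γ (_ : γ ∈ Finset.univ) => h1 γ using 2 with a
  simp

open MeasureTheory in
/-- Fourier coefficients of linear combinations of theta functions. -/
theorem integral_sum_theta (f : I.DOmega → ℂ) (τ : ℍ) (z : Fin c → ℂ) {a : Fin c → ℚ}
    (ha : a ∈ I.omegaDual) :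
    ∫ x in (Set.Icc 0 1 : Set (Fin c → ℝ)),
      (∑ γ, f γ * I.theta τ (z + scaledVec (Fintype.card Δ) x) γ) *
        ce (-(2 * cform I.S (ratVec a) (scaledVec (Fintype.card Δ) x))) =
      f (I.cls ha) * I.thetaExp τ z a := by
  classical
  let h : I.OmegaBarDual → ℂ := fun b => f (I.barToD b) * I.thetaTerm τ z b
  choose rp hrp hrp' using fun b : I.OmegaBarDual => exists_bcls b
  let k : I.OmegaBarDual → Fin c → ℤ := fun b => I.freq (rp b) - I.freq a
  let F : I.OmegaBarDual → (Fin c → ℝ) → ℂ := fun b x => h b * ce (∑ i, (k b i : ℂ) * x i)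
  have hterm : ∀ b x, f (I.barToD b) * I.thetaTerm τ (z + scaledVec (Fintype.card Δ) x) b *
      ce (-(2 * cform I.S (ratVec a) (scaledVec (Fintype.card Δ) x))) = F b x := fun b x => by
    have e1 : I.thetaTerm τ (z + scaledVec (Fintype.card Δ) x) b =
        I.thetaTerm τ z b * ce (∑ i, (I.freq (rp b) i : ℂ) * x i) := by
      rw [← I.two_cform_scaledVec (hrp b)]
      conv_lhs => rw [← hrp' b]
      conv_rhs => rw [← hrp' b, thetaTerm_bcls]
      rw [thetaTerm_bcls, thetaExp_add]
      congr 4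
      all_goals rw [hrp' b]
    have e2 : ∑ i, (k b i : ℂ) * x i = ∑ i, (I.freq (rp b) i : ℂ) * x i +
        -∑ i, (I.freq a i : ℂ) * x i := by
      rw [← sub_eq_add_neg, ← Finset.sum_sub_distrib]
      refine Finset.sum_congr rfl fun i _ => ?_
      simp only [k, Pi.sub_apply, Int.cast_sub]
      ring
    simp only [F, h]
    rw [e1, I.two_cform_scaledVec ha, e2, ce_add]
    ring
  have hsumN : Summable fun b => ‖h b‖ := by
    have hb : ∃ C, ∀ γ, ‖f γ‖ ≤ C := ⟨∑ γ, ‖f γ‖, fun γ =>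
      Finset.single_le_sum (f := fun γ => ‖f γ‖) (fun _ _ => norm_nonneg _) (Finset.mem_univ γ)⟩
    obtain ⟨C, hC⟩ := hb
    refine ((I.summable_thetaTerm τ z).mul_left C).of_nonneg_of_le (fun _ => norm_nonneg _)
      fun b => ?_
    rw [norm_mul]
    exact mul_le_mul_of_nonneg_right (hC _) (norm_nonneg _)
  have hce : ∀ b (x : Fin c → ℝ), ‖ce (∑ i, (k b i : ℂ) * x i)‖ = 1 := fun b x => by
    rw [norm_ce]
    simp
  have hvol : (volume (Set.Icc 0 1 : Set (Fin c → ℝ))) = 1 := by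
    rw [Real.volume_Icc_pi]
    simp
  have hint : ∀ b, Integrable (F b) (volume.restrict (Set.Icc 0 1)) := fun b => by
    have : Continuous (F b) := by
      refine continuous_const.mul (continuous_ce.comp ?_)
      fun_prop
    exact this.continuousOn.integrableOn_compact isCompact_Icc
  have hsum : Summable fun b => ∫ x in (Set.Icc 0 1 : Set (Fin c → ℝ)), ‖F b x‖ := by
    have : ∀ b, ∫ x in (Set.Icc 0 1 : Set (Fin c → ℝ)), ‖F b x‖ = ‖h b‖ := fun b => by
      simp only [F, norm_mul, hce, mul_one]
      rw [setIntegral_const, Measure.real, hvol]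
      simp
    simp_rw [this]
    exact hsumN
  have hlhs : ∀ x : Fin c → ℝ, (∑ γ, f γ * I.theta τ (z + scaledVec (Fintype.card Δ) x) γ) *
        ce (-(2 * cform I.S (ratVec a) (scaledVec (Fintype.card Δ) x))) = ∑' b, F b x := fun x => by
    rw [← (I.hasSum_sum_theta f τ _).tsum_eq, ← tsum_mul_right]
    exact tsum_congr fun b => hterm b x
  simp_rw [hlhs]
  have : Countable I.OmegaBarDual := QuotientAddGroup.mk_surjective.countable
  -- The exponentials are unimodular on real x, so the series is dominated by a convergent series
  -- independent of x and may be integrated termwise.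
  rw [← integral_tsum_of_summable_integral_norm hint hsum]
  -- The frequency determines the class modulo ker S, so only the class of a survives.
  have hF : ∀ b, ∫ x in (Set.Icc 0 1 : Set (Fin c → ℝ)), F b x =
      if b = I.bcls ha then h b else 0 := fun b => by
    simp only [F]
    rw [integral_const_mul, integral_ce_int_pi, mul_ite, mul_one, mul_zero]
    refine if_congr ?_ rfl rfl
    constructor
    · intro h0
      have := I.sub_mem_kerS_of_freq ha (hrp b) (sub_eq_zero.1 h0).symm
      rw [← hrp' b, bcls_eq_iff]
      exact this
    · intro h0
      have h1 : a - rp b ∈ I.kerS := by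
        rw [← bcls_eq_iff (hrp b) ha, hrp', h0]
      funext i
      have h2 : (I.freq (rp b) i : ℚ) = I.freq a i := by
        rw [I.coe_freq (hrp b), I.coe_freq ha, I.qform_comm a, ← sub_add_cancel a (rp b),
          qform_add_right, I.qform_kerS h1, zero_add, I.qform_comm]
      simp only [k, Pi.sub_apply, Pi.zero_apply]
      rw [sub_eq_zero]
      exact_mod_cast h2
  simp_rw [hF]
  rw [tsum_ite_eq]
  rfl

/-- The theta functions are linearly independent. -/
theorem eq_zero_of_sum_theta {f : I.DOmega → ℂ} (τ : ℍ)
    (h : ∀ z, ∑ γ, f γ * I.theta τ z γ = 0) : f = 0 := by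
  funext γ
  obtain ⟨a, ha, rfl⟩ := I.exists_cls γ
  have h1 := I.integral_sum_theta f τ 0 ha
  simp_rw [h, zero_mul, MeasureTheory.integral_zero] at h1
  exact (mul_eq_zero.1 h1.symm).resolve_right (I.thetaExp_ne_zero _ _ _)

theorem exists_theta_ne_zero (τ : ℍ) (γ : I.DOmega) : ∃ z, I.theta τ z γ ≠ 0 := by
  classical
  by_contra! h
  have := I.eq_zero_of_sum_theta (f := Pi.single γ 1) τ fun z => by
    simp [Pi.single_apply, h]
  simpa using congrFun this γ

/-- An element l of the radical occurs in the inversion formula exactly as 0 does. Hence θ_l and θ_0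
agree at a point of the upper half-plane for all z, and linear independence gives l = 0. -/
theorem isDiscriminantForm_quad : IsDiscriminantForm I.quad := by
  classical
  obtain ⟨f⟩ := I.nonempty_frame
  refine ⟨I.finite_DOmega, fun l hl => ?_⟩
  have h1 : ∀ (τ : ℍ) (z : Fin c → ℂ), I.theta (ModularGroup.S • τ) ((τ : ℂ)⁻¹ • z) l =
      I.theta (ModularGroup.S • τ) ((τ : ℂ)⁻¹ • z) 0 := fun τ z => by
    rw [f.theta_inversion, f.theta_inversion]
    simp [hl]
  have h2 := I.eq_zero_of_sum_theta (f := Pi.single l 1 - Pi.single 0 1)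
    (ModularGroup.S • UpperHalfPlane.I) fun z => by
      have h3 := h1 UpperHalfPlane.I ((UpperHalfPlane.I : ℂ) • z)
      rw [smul_smul, inv_mul_cancel₀ (UpperHalfPlane.ne_zero _), one_smul] at h3
      simp only [Pi.sub_apply, sub_mul, Finset.sum_sub_distrib, Pi.single_apply, ite_mul, one_mul,
        zero_mul, Finset.sum_ite_eq', Finset.mem_univ, if_true]
      rw [h3, sub_self]
  by_contra h
  have := congrFun h2 l
  simp [h] at this

end

end MatrixIndex

end JacobiMatrixIndex

namespace JacobiMatrixIndex

open QuadraticMap (polar)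

variable {c : ℕ} {Δ : Type*} [AddCommGroup Δ]

namespace MatrixIndex

variable {Q : QuadraticMap ℤ Δ (AddCircle (1 : ℚ))} (I : MatrixIndex c Q)

/-! ### Modularity of the theta function -/

/-- The sixth root of unity in the upper half-plane. -/
def sixthRoot : ℍ := ⟨⟨1 / 2, Real.sqrt 3 / 2⟩, by simp⟩

theorem sixthRoot_sq : (sixthRoot : ℂ) ^ 2 = sixthRoot - 1 := by
  have h3 : Real.sqrt 3 * Real.sqrt 3 = 3 := Real.mul_self_sqrt (by norm_num)
  apply Complex.ext
  · simp [sixthRoot, sq]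
    linarith
  · simp [sixthRoot, sq]
    ring

theorem sixthRoot_re : (sixthRoot : ℂ).re = 1 / 2 := rfl

/-- The third root of unity in the upper half-plane. -/
def thirdRoot : ℍ := ModularGroup.S • sixthRoot

theorem coe_S_smul (τ : ℍ) : ((ModularGroup.S • τ : ℍ) : ℂ) = -1 / τ := by
  rw [UpperHalfPlane.modular_S_smul, UpperHalfPlane.coe_mk, inv_neg, neg_div, one_div]

theorem coe_T_smul (τ : ℍ) : ((ModularGroup.T • τ : ℍ) : ℂ) = τ + 1 := by
  rw [UpperHalfPlane.modular_T_smul]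
  simp [add_comm]

theorem coe_thirdRoot : (thirdRoot : ℂ) = sixthRoot ^ 2 := by
  have h0 : (sixthRoot : ℂ) ≠ 0 := UpperHalfPlane.ne_zero _
  have := sixthRoot_sq
  rw [thirdRoot, coe_S_smul, div_eq_iff h0]
  linear_combination (-1 - (sixthRoot : ℂ)) * this

/-- Both T and S carry the third root to the sixth root, while S also carries the sixth root back;
this gives two routes for computing one theta value. -/
theorem T_smul_thirdRoot : ModularGroup.T • thirdRoot = sixthRoot := by
  ext1
  rw [coe_T_smul, coe_thirdRoot, sixthRoot_sq]
  ring

theorem S_smul_thirdRoot : ModularGroup.S • thirdRoot = sixthRoot := by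
  have h0 : (sixthRoot : ℂ) ≠ 0 := UpperHalfPlane.ne_zero _
  have := sixthRoot_sq
  ext1
  rw [coe_S_smul, coe_thirdRoot, div_eq_iff (pow_ne_zero 2 h0)]
  linear_combination (-1 - (sixthRoot : ℂ)) * this

/-- The principal root of ρ² is ρ because Re ρ > 0. This relation makes the roots of τ cancel when
the two routes are compared. -/
theorem root_S_sixthRoot_sq : Mp2Z.S.root sixthRoot ^ 2 = Mp2Z.S.root thirdRoot := by
  rw [Mp2Z.S.sq_root, Mp2Z.root_S, coe_thirdRoot, one_div, Complex.sq_cpow_two_inv]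
  · simp [autJ, Mp2Z.S, ModularGroup.S]
  · rw [sixthRoot_re]; norm_num

section

variable [Fintype Δ] [Fintype I.DOmega]

theorem exists_sum_theta_ne_zero {f : I.DOmega → ℂ} (hf : f ≠ 0) (τ : ℍ) :
    ∃ z, ∑ γ, f γ * I.theta τ z γ ≠ 0 := by
  by_contra! h
  exact hf (I.eq_zero_of_sum_theta τ h)

theorem theta_S_smul (τ : ℍ) (z : Fin c → ℂ) :
    I.theta (ModularGroup.S • τ) ((τ : ℂ)⁻¹ • z) =
      (Mp2Z.S.root τ ^ I.S.rank * ce (cform I.S z z / τ)) • weilS I.quad (I.theta τ z) := by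
  classical
  obtain ⟨f⟩ := I.nonempty_frame
  obtain ⟨c₀, hc₀, hcst⟩ := f.exists_cst_eq
  set W : (I.DOmega → ℂ) → I.DOmega → ℂ := fun X γ => ∑ δ, qe (-polar I.quad γ δ) * X δ with hW
  have hinv : ∀ τ z γ, I.theta (ModularGroup.S • τ) z γ =
      f.cst τ * ce (τ * cform I.S z z) * W (I.theta τ ((τ : ℂ) • z)) γ := fun τ z γ => by
    have h0 : (τ : ℂ) ≠ 0 := UpperHalfPlane.ne_zero _
    have := f.theta_inversion τ ((τ : ℂ) • z) γ
    rw [smul_smul, inv_mul_cancel₀ h0, one_smul, cform_smul_left, cform_smul_right] at this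
    rw [this]
    congr 3
    field_simp
  set g := ∑ γ, qe (I.quad γ) with hg
  have hST : ∀ z γ, I.theta sixthRoot z γ = qe (I.quad γ) * I.theta thirdRoot z γ := fun z γ => by
    rw [← T_smul_thirdRoot, theta_T]
  -- First route: invert from the sixth root, pass to the third root by T, and invert again.
  -- Completing the square in the middle sum produces the Gauss sum g.
  have key1 : ∀ z, I.theta thirdRoot z 0 = f.cst sixthRoot ^ 2 * ce (thirdRoot * cform I.S z z) *
      (g * ∑ γ, qe (-I.quad γ) * I.theta sixthRoot ((thirdRoot : ℂ) • z) γ) := fun z => by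
    have e1 : W (I.theta sixthRoot ((sixthRoot : ℂ) • z)) 0 =
        f.cst sixthRoot * ce (sixthRoot ^ 3 * cform I.S z z) *
          (g * ∑ γ, qe (-I.quad γ) * I.theta sixthRoot ((thirdRoot : ℂ) • z) γ) := by
      have e2 : ∀ γ, I.theta thirdRoot ((sixthRoot : ℂ) • z) γ = f.cst sixthRoot *
          ce (sixthRoot ^ 3 * cform I.S z z) *
            W (I.theta sixthRoot ((thirdRoot : ℂ) • z)) γ := fun γ => by
        rw [thirdRoot, hinv, ← thirdRoot, cform_smul_left, cform_smul_right, smul_smul,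
          coe_thirdRoot, sq]
        congr 3
        ring
      have e5 : ∀ γ, I.theta sixthRoot ((sixthRoot : ℂ) • z) γ = qe (I.quad γ) *
          (f.cst sixthRoot * ce (sixthRoot ^ 3 * cform I.S z z) *
            W (I.theta sixthRoot ((thirdRoot : ℂ) • z)) γ) := fun γ => by rw [hST, e2]
      change ∑ γ, qe (-polar I.quad 0 γ) * I.theta sixthRoot ((sixthRoot : ℂ) • z) γ = _
      simp_rw [e5, hW, Finset.mul_sum]
      rw [Finset.sum_comm]
      refine Finset.sum_congr rfl fun δ _ => ?_
      have e3 := sum_qe_quad_sub_polar I.quad δ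
      rw [← hg] at e3
      rw [← mul_assoc g, ← e3, Finset.sum_mul, Finset.mul_sum]
      refine Finset.sum_congr rfl fun γ _ => ?_
      rw [QuadraticMap.polar_zero_left, neg_zero, qe_zero, one_mul]
      ring
    have e4 : (thirdRoot : ℂ) * cform I.S z z =
        sixthRoot * cform I.S z z + sixthRoot ^ 3 * cform I.S z z := by
      have := sixthRoot_sq
      rw [coe_thirdRoot]
      linear_combination (-(sixthRoot : ℂ) * cform I.S z z) * this
    conv_lhs => rw [thirdRoot, hinv, e1]
    rw [e4, ce_add]
    ring
  -- Second route: T fixes the component at 0, so the value equals the one at the sixth root, and a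
  -- single inversion from the third root suffices.
  have key2 : ∀ z, I.theta thirdRoot z 0 = f.cst thirdRoot * ce (thirdRoot * cform I.S z z) *
      ∑ γ, qe (-I.quad γ) * I.theta sixthRoot ((thirdRoot : ℂ) • z) γ := fun z => by
    have h1 := hST z 0
    rw [QuadraticMap.map_zero, qe_zero, one_mul] at h1
    rw [← h1, ← S_smul_thirdRoot, hinv, S_smul_thirdRoot]
    congr 1
    refine Finset.sum_congr rfl fun γ _ => ?_
    rw [QuadraticMap.polar_zero_left, neg_zero, qe_zero, one_mul, hST, qe_neg,
      inv_mul_cancel_left₀ (qe_ne_zero _)]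
  -- The two routes share a theta combination that is non-zero for some z and can be cancelled.
  have hc : f.cst sixthRoot ^ 2 * g = f.cst thirdRoot := by
    obtain ⟨z, hz⟩ := I.exists_sum_theta_ne_zero (f := fun γ => qe (-I.quad γ))
      (fun h => qe_ne_zero _ (congrFun h 0)) sixthRoot
    have h0 : (thirdRoot : ℂ) ≠ 0 := UpperHalfPlane.ne_zero _
    have h1 := (key1 ((thirdRoot : ℂ)⁻¹ • z)).symm.trans (key2 _)
    rw [smul_smul, mul_inv_cancel₀ h0, one_smul] at h1
    refine mul_right_cancel₀ (mul_ne_zero (ce_ne_zero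
      (thirdRoot * cform I.S ((thirdRoot : ℂ)⁻¹ • z) ((thirdRoot : ℂ)⁻¹ • z))) hz) (Eq.trans ?_ (h1.trans ?_))
    · ring
    · ring
  have hc₀g : c₀ * g = 1 := by
    rw [hcst, hcst, mul_pow, ← pow_mul, mul_comm I.S.rank, pow_mul, root_S_sixthRoot_sq] at hc
    have h0 : c₀ * Mp2Z.S.root thirdRoot ^ I.S.rank ≠ 0 :=
      mul_ne_zero hc₀ (pow_ne_zero _ (Mp2Z.root_ne_zero _ _))
    refine mul_right_cancel₀ h0 ?_
    linear_combination hc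
  have hcard : (Fintype.card I.DOmega : ℂ) ≠ 0 := by exact_mod_cast Fintype.card_ne_zero
  -- Since c₀ g = 1 and g times its conjugate sum is |D_Ω|, c₀ is exactly the scalar in `weilS`.
  have hc₀' : c₀ = (∑ μ, qe (-I.quad μ)) / Fintype.card I.DOmega := by
    rw [eq_div_iff hcard, ← gaussSum_mul_conj I.quad I.isDiscriminantForm_quad, ← mul_assoc, hc₀g,
      one_mul]
  funext γ
  rw [f.theta_inversion, hcst, Pi.smul_apply, weilS_apply, ← hc₀', smul_eq_mul]
  simp_rw [QuadraticMap.polar_comm I.quad _ γ]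
  ring

/-- The theta function is a modular form for the Weil representation of `D_Ω`. -/
theorem theta_modular {p : Mp2Z × Module.End ℂ (I.DOmega → ℂ)} (hp : p ∈ weilGraph I.quad)
    (τ : ℍ) (z : Fin c → ℂ) :
    I.theta (p.1.mat • τ) ((autJ p.1.mat τ)⁻¹ • z) =
      (p.1.root τ ^ I.S.rank * ce ((p.1.mat 1 0 : ℂ) * cform I.S z z / autJ p.1.mat τ)) •
        p.2 (I.theta τ z) := by
  induction hp using Submonoid.closure_induction generalizing τ z with
  | mem p hp =>
    rcases hp with rfl | rfl
    · have h1 : autJ Mp2Z.T.mat τ = 1 := by simp [autJ, Mp2Z.T, ModularGroup.T]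
      have h2 : Mp2Z.T.mat 1 0 = 0 := rfl
      simp only [h1, h2, Mp2Z.root_T, inv_one, one_smul, one_pow, Int.cast_zero, zero_mul,
        zero_div, ce_zero, mul_one]
      funext γ
      exact theta_T τ z γ
    · have h1 : autJ Mp2Z.S.mat τ = τ := by simp [autJ, Mp2Z.S, ModularGroup.S]
      have h2 : Mp2Z.S.mat 1 0 = 1 := rfl
      simp only [h1, h2, Int.cast_one, one_mul]
      exact I.theta_S_smul τ z
  | one => simp [autJ]
  | mul p q _ _ hp hq =>
    have e1 : (autJ (p * q).1.mat τ)⁻¹ • z =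
        (autJ p.1.mat (q.1.mat • τ))⁻¹ • (autJ q.1.mat τ)⁻¹ • z := by
      rw [Prod.fst_mul, Mp2Z.mul_mat, autJ_mul, mul_inv, smul_smul]
    have e2 := autJ_smul_eq p.1.mat q.1.mat τ
    have hj := autJ_ne_zero q.1.mat τ
    have hj' := autJ_ne_zero p.1.mat (q.1.mat • τ)
    have e3 : ((p.1.mat * q.1.mat) 1 0 : ℂ) * cform I.S z z / autJ (p.1.mat * q.1.mat) τ =
        (p.1.mat 1 0 : ℂ) * ((autJ q.1.mat τ)⁻¹ * ((autJ q.1.mat τ)⁻¹ * cform I.S z z)) /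
          autJ p.1.mat (q.1.mat • τ) +
        (q.1.mat 1 0 : ℂ) * cform I.S z z / autJ q.1.mat τ := by
      rw [mul_div_right_comm, e2]
      field_simp
    rw [e1, Prod.fst_mul, Mp2Z.mul_mat, mul_smul, hp, hq, map_smul, smul_smul, Prod.snd_mul,
      Module.End.mul_apply, Mp2Z.mul_root, e3, ce_add, cform_smul_left, cform_smul_right]
    congr 1
    ring

end

/-! ### Holomorphy of the theta function -/

theorem differentiableAt_theta₁ {E : Type*} [NormedAddCommGroup E] [NormedSpace ℂ E] {d : ℕ}
    (hd : d ≠ 0) (r : ℤ) {g h : E → ℂ} {x : E} (hg : DifferentiableAt ℂ g x)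
    (hh : DifferentiableAt ℂ h x) (hx : 0 < (g x).im) :
    DifferentiableAt ℂ (fun y => theta₁ d r (g y) (h y)) x := by
  have h1 : 0 < (2 * d * g x).im := by
    have h : 0 < (2 * d : ℝ) := by positivity
    rw [show (2 * d * g x : ℂ) = ((2 * d : ℝ) : ℂ) * g x by push_cast; ring, Complex.im_ofReal_mul]
    positivity
  have h2 := (hasFDerivAt_jacobiTheta₂ (r * g x + 2 * d * h x) h1).differentiableAt
  have h3 : DifferentiableAt ℂ (fun y => (r * g y + 2 * d * h y, 2 * d * g y)) x := by fun_prop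
  have h4 := h2.comp x h3
  unfold theta₁
  refine DifferentiableAt.mul ?_ h4
  exact differentiable_ce.differentiableAt.comp x (by fun_prop)

theorem differentiable_cform_right (S : Matrix (Fin c) (Fin c) ℚ) (x : Fin c → ℂ) :
    Differentiable ℂ (cform S x) := by
  unfold cform dotProduct Matrix.mulVec dotProduct
  fun_prop

theorem differentiableAt_theta [Finite Δ] (γ : I.DOmega) {p : ℂ × (Fin c → ℂ)} (hp : 0 < p.1.im) :
    DifferentiableAt ℂ (fun p : ℂ × (Fin c → ℂ) => I.theta (UpperHalfPlane.ofComplex p.1) p.2 γ)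
      p := by
  classical
  obtain ⟨f⟩ := I.nonempty_frame
  have h1 : DifferentiableAt ℂ (fun p : ℂ × (Fin c → ℂ) => ∑ r : f.R, if f.Ind γ (f.rep r) then
      ∏ i : f.J, theta₁ (f.d i) (f.rep r i) p.1 (f.zeta p.2 i) else 0) p := by
    refine DifferentiableAt.fun_sum fun r _ => ?_
    split_ifs
    · refine (HasFDerivAt.finsetProd (g := fun (i : f.J) (q : ℂ × (Fin c → ℂ)) =>
        theta₁ (f.d i) (f.rep r i) q.1 (f.zeta q.2 i)) fun i _ =>
          DifferentiableAt.hasFDerivAt ?_).differentiableAt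
      refine differentiableAt_theta₁ i.2 _ differentiableAt_fst ?_ hp
      unfold Frame.zeta
      have h := differentiable_cform_right I.S (ratVec (f.v i))
      have h' : DifferentiableAt ℂ (fun q : ℂ × (Fin c → ℂ) => cform I.S (ratVec (f.v i)) q.2) p :=
        h.differentiableAt.fun_comp' p differentiableAt_snd
      simp only [div_eq_mul_inv]
      exact h'.mul_const _
    · exact differentiableAt_const _
  refine h1.congr_of_eventuallyEq ?_
  have h2 : {q : ℂ × (Fin c → ℂ) | 0 < q.1.im} ∈ nhds p :=
    (isOpen_lt continuous_const (Complex.continuous_im.comp continuous_fst)).mem_nhds hp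
  filter_upwards [h2] with q hq
  rw [f.theta_eq_sum, UpperHalfPlane.ofComplex_apply_of_im_pos hq]

end MatrixIndex

end JacobiMatrixIndex

namespace JacobiMatrixIndex

open QuadraticMap (polar)

/-! ### Fourier coefficients of periodic entire functions -/

section Fourier

open JacobiMatrixIndex.MatrixIndex (scaledVec)
open MeasureTheory

variable {c : ℕ}

theorem scaledVec_add (N : ℕ) (x y : Fin c → ℝ) :
    scaledVec N (x + y) = scaledVec N x + scaledVec N y := by
  funext i
  simp [scaledVec, mul_add]

theorem continuous_scaledVec (N : ℕ) : Continuous (scaledVec N : (Fin c → ℝ) → Fin c → ℂ) := by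
  unfold scaledVec
  fun_prop

/-- The projection to the real torus. -/
def toTorus (c : ℕ) : C(Fin c → ℝ, UnitAddTorus (Fin c)) where
  toFun x i := (x i : UnitAddCircle)
  continuous_toFun := continuous_pi fun i => (AddCircle.continuous_mk' 1).comp (continuous_apply i)

theorem toTorus_add (x y : Fin c → ℝ) : toTorus c (x + y) = toTorus c x + toTorus c y := rfl

theorem isQuotientMap_toTorus : Topology.IsQuotientMap (toTorus c) :=
  (IsOpenQuotientMap.piMap fun _ => QuotientAddGroup.isOpenQuotientMap_mk).isQuotientMap

theorem mFourier_toTorus (k : Fin c → ℤ) (x : Fin c → ℝ) :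
    UnitAddTorus.mFourier k (toTorus c x) = ce (∑ i, (k i : ℂ) * x i) := by
  rw [ce_sum]
  change ∏ i, fourier (k i) ((x i : ℝ) : UnitAddCircle) = _
  refine Finset.prod_congr rfl fun i _ => ?_
  rw [fourier_coe_apply, ce]
  congr 1
  simp
  ring

/-- The Fourier coefficients of `x ↦ G(z + Nx)`. -/
def fcoef (N : ℕ) (G : (Fin c → ℂ) → ℂ) (k : Fin c → ℤ) (z : Fin c → ℂ) : ℂ :=
  ∫ x in (Set.Icc 0 1 : Set (Fin c → ℝ)), G (z + scaledVec N x) * ce (-∑ i, (k i : ℂ) * x i)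

theorem exists_torus_lift {N : ℕ} {G : (Fin c → ℂ) → ℂ} (hG : Continuous G)
    (hp : ∀ z (v : Fin c → ℤ), G (z + scaledVec N fun i => v i) = G z) (z : Fin c → ℂ) :
    ∃ g : C(UnitAddTorus (Fin c), ℂ), ∀ x, g (toTorus c x) = G (z + scaledVec N x) := by
  let g₀ : C(Fin c → ℝ, ℂ) :=
    ⟨fun x => G (z + scaledVec N x), hG.comp (continuous_const.add (continuous_scaledVec N))⟩
  have h : Function.FactorsThrough g₀ (toTorus c) := fun x y hxy => by
    have h1 : ∀ i, ∃ n : ℤ, x i = y i + n := fun i => by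
      have h2 : ((x i : ℝ) : UnitAddCircle) = ((y i : ℝ) : UnitAddCircle) := congrFun hxy i
      obtain ⟨n, hn⟩ := (AddCircle.coe_eq_zero_iff (1 : ℝ)).1
        (show ((x i - y i : ℝ) : UnitAddCircle) = 0 by rw [AddCircle.coe_sub, h2, sub_self])
      refine ⟨n, ?_⟩
      rw [zsmul_eq_mul, mul_one] at hn
      rw [hn, add_sub_cancel]
    choose v hv using h1
    have h3 : x = y + fun i => (v i : ℝ) := funext hv
    change G _ = G _
    rw [h3, scaledVec_add, ← add_assoc, hp]
  exact ⟨isQuotientMap_toTorus.lift g₀ h, fun x => congrArg (fun f => f x) (isQuotientMap_toTorus.lift_comp g₀ h)⟩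

/-- The normalized Haar measure on the real torus. -/
def torusMeasure (c : ℕ) : Measure (UnitAddTorus (Fin c)) :=
  Measure.pi fun _ => AddCircle.haarAddCircle

theorem integral_torus (f : UnitAddTorus (Fin c) → ℂ) :
    ∫ t, f t ∂torusMeasure c = ∫ x in (Set.Icc 0 1 : Set (Fin c → ℝ)), f (toTorus c x) := by
  refine (UnitAddTorus.integral_preimage f 0).trans ?_
  refine setIntegral_congr_set ?_
  have h := Measure.univ_pi_Ioc_ae_eq_Icc (μ := fun _ : Fin c => (volume : Measure ℝ))
    (f := 0) (g := 1)
  rw [← volume_pi] at h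
  have h1 : {x : Fin c → ℝ | ∀ i, x i ∈ Set.Ioc ((0 : Fin c → ℝ) i) ((0 : Fin c → ℝ) i + 1)} =
      Set.univ.pi fun i => Set.Ioc ((0 : Fin c → ℝ) i) ((1 : Fin c → ℝ) i) := by
    ext x
    simp [Set.mem_pi]
  rw [h1]
  exact h

theorem fcoef_eq_mFourierCoeff {N : ℕ} {G : (Fin c → ℂ) → ℂ} {z : Fin c → ℂ}
    {g : C(UnitAddTorus (Fin c), ℂ)} (hg : ∀ x, g (toTorus c x) = G (z + scaledVec N x))
    (k : Fin c → ℤ) : UnitAddTorus.mFourierCoeff g k = fcoef N G k z := by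
  refine (integral_torus _).trans ?_
  rw [fcoef]
  congr 1
  funext x
  rw [hg, mFourier_toTorus, smul_eq_mul, mul_comm]
  simp

/-- Summability is left to the caller; for Jacobi forms it comes from comparison with theta series.
-/
theorem hasSum_fcoef {N : ℕ} {G : (Fin c → ℂ) → ℂ} (hG : Continuous G)
    (hp : ∀ z (v : Fin c → ℤ), G (z + scaledVec N fun i => v i) = G z) (z : Fin c → ℂ)
    (hs : Summable fun k => fcoef N G k z) : HasSum (fun k => fcoef N G k z) (G z) := by
  obtain ⟨g, hg⟩ := exists_torus_lift hG hp z
  have h : UnitAddTorus.mFourierCoeff g = fun k => fcoef N G k z :=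
    funext fun k => fcoef_eq_mFourierCoeff hg k
  have h1 := UnitAddTorus.hasSum_mFourier_series_apply_of_summable (h ▸ hs) (toTorus c 0)
  rw [h, hg] at h1
  have h2 : scaledVec N (0 : Fin c → ℝ) = 0 := by funext i; simp [scaledVec]
  simpa [mFourier_toTorus, h2] using h1

/-- Translation invariance of Haar measure on the torus. -/
theorem fcoef_add_real {N : ℕ} {G : (Fin c → ℂ) → ℂ} (hG : Continuous G)
    (hp : ∀ z (v : Fin c → ℤ), G (z + scaledVec N fun i => v i) = G z) (k : Fin c → ℤ)
    (z : Fin c → ℂ) (y : Fin c → ℝ) :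
    fcoef N G k (z + scaledVec N y) = ce (∑ i, (k i : ℂ) * y i) * fcoef N G k z := by
  obtain ⟨g, hg⟩ := exists_torus_lift hG hp z
  have : (torusMeasure c).IsAddRightInvariant := by unfold torusMeasure; infer_instance
  let F : UnitAddTorus (Fin c) → ℂ :=
    fun t => UnitAddTorus.mFourier (-k) (t + toTorus c (-y)) * g t
  have h : ∫ t, F (t + toTorus c y) ∂torusMeasure c = ∫ t, F t ∂torusMeasure c :=
    integral_add_right_eq_self F (toTorus c y)
  rw [integral_torus, integral_torus] at h
  have h1 : ∀ x, F (toTorus c x + toTorus c y) =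
      G (z + scaledVec N y + scaledVec N x) * ce (-∑ i, (k i : ℂ) * x i) := fun x => by
    simp only [F]
    rw [← toTorus_add, ← toTorus_add, add_neg_cancel_right, mFourier_toTorus, hg, scaledVec_add,
      mul_comm, add_comm (scaledVec N x), add_assoc]
    simp
  have h2 : ∀ x, F (toTorus c x) =
      ce (∑ i, (k i : ℂ) * y i) * (G (z + scaledVec N x) * ce (-∑ i, (k i : ℂ) * x i)) :=
    fun x => by
    simp only [F]
    rw [← toTorus_add, mFourier_toTorus, hg, mul_comm, mul_left_comm, ← ce_add]
    congr 2
    simp [mul_add, Finset.sum_add_distrib]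
    ring
  simp_rw [h1, h2] at h
  rw [integral_const_mul] at h
  exact h

open Metric in
theorem differentiable_fcoef_line {N : ℕ} {G : (Fin c → ℂ) → ℂ} (hG : Differentiable ℂ G)
    (k : Fin c → ℤ) (z w : Fin c → ℂ) :
    Differentiable ℂ fun ζ : ℂ => fcoef N G k (z + ζ • w) := by
  intro ζ₀
  let F : ℂ → (Fin c → ℝ) → ℂ := fun ζ x =>
    G (z + ζ • w + scaledVec N x) * ce (-∑ i, (k i : ℂ) * x i)
  have hF : Continuous fun p : (Fin c → ℝ) × ℂ => F p.2 p.1 := by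
    have h1 := continuous_scaledVec N (c := c)
    have h2 := hG.continuous
    have h3 := continuous_ce
    fun_prop
  have hd : ∀ x, Differentiable ℂ fun ζ => F ζ x := fun x => by
    refine Differentiable.mul_const ?_ _
    exact hG.comp (by fun_prop)
  obtain ⟨C, hC⟩ := ((isCompact_Icc (a := (0 : Fin c → ℝ)) (b := 1)).prod
    (isCompact_closedBall ζ₀ 2)).exists_bound_of_continuousOn hF.continuousOn
  -- Cauchy's estimate on the unit circle about ζ, which stays inside the ball of radius 2 where F
  -- is bounded by C.
  have hb : ∀ x ∈ Set.Icc (0 : Fin c → ℝ) 1, ∀ ζ ∈ ball ζ₀ 1, ‖deriv (fun ζ => F ζ x) ζ‖ ≤ C := by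
    intro x hx ζ hζ
    have := Complex.norm_deriv_le_of_forall_mem_sphere_norm_le (c := ζ) (R := 1) (C := C)
      (f := fun ζ => F ζ x) one_pos (hd x).diffContOnCl fun ξ hξ => hC (x, ξ) ⟨hx, ?_⟩
    · simpa using this
    · rw [mem_sphere] at hξ
      rw [mem_ball] at hζ
      rw [mem_closedBall]
      linarith [dist_triangle ξ ζ ζ₀]
  refine (hasDerivAt_integral_of_dominated_loc_of_deriv_le (F := F)
    (μ := volume.restrict (Set.Icc 0 1)) (F' := fun ζ x => deriv (fun ζ => F ζ x) ζ)
    (s := ball ζ₀ 1) (bound := fun _ => C) (ball_mem_nhds ζ₀ one_pos) ?_ ?_ ?_ ?_ ?_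
    ?_).2.differentiableAt
  · exact Filter.Eventually.of_forall fun ζ =>
      (hF.comp (by fun_prop : Continuous fun x : Fin c → ℝ => (x, ζ))).aestronglyMeasurable
  · exact (hF.comp (by fun_prop : Continuous fun x : Fin c → ℝ =>
      (x, ζ₀))).continuousOn.integrableOn_compact isCompact_Icc
  · have h := stronglyMeasurable_deriv_with_param (𝕜 := ℂ) (f := fun x ζ => F ζ x) hF
    exact (h.comp_measurable
      (by fun_prop : Measurable fun x : Fin c → ℝ => (x, ζ₀))).aestronglyMeasurable
  · exact (ae_restrict_iff' measurableSet_Icc).2 (Filter.Eventually.of_forall hb)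
  · exact continuous_const.continuousOn.integrableOn_compact isCompact_Icc
  · exact Filter.Eventually.of_forall fun x ζ _ => (hd x ζ).hasDerivAt

theorem eq_of_eq_ofReal {f g : ℂ → ℂ} (hf : Differentiable ℂ f) (hg : Differentiable ℂ g)
    (h : ∀ t : ℝ, f t = g t) : f = g := by
  refine AnalyticOnNhd.eq_of_frequently_eq (z₀ := 0) (fun z _ => hf.analyticAt z)
    (fun z _ => hg.analyticAt z) ?_
  have h1 : Filter.Tendsto (fun t : ℝ => (t : ℂ)) (nhdsWithin 0 {0}ᶜ) (nhdsWithin 0 {0}ᶜ) := by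
    refine tendsto_nhdsWithin_of_tendsto_nhds_of_eventually_within _ ?_ ?_
    · exact (Complex.continuous_ofReal.tendsto' 0 0 Complex.ofReal_zero).mono_left
        nhdsWithin_le_nhds
    · filter_upwards [self_mem_nhdsWithin] with t ht
      simpa using ht
  exact h1.frequently (Filter.Eventually.of_forall h).frequently

/-- Along a real direction both sides are entire in the step ζ and agree for real ζ, so they agree
for complex ζ; a complex translation is a real one plus i times a real one. -/
theorem fcoef_add {N : ℕ} (hN : N ≠ 0) {G : (Fin c → ℂ) → ℂ} (hG : Differentiable ℂ G)
    (hp : ∀ z (v : Fin c → ℤ), G (z + scaledVec N fun i => v i) = G z) (k : Fin c → ℤ)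
    (z w : Fin c → ℂ) :
    fcoef N G k (z + w) = ce ((∑ i, (k i : ℂ) * w i) / N) * fcoef N G k z := by
  have hN' : (N : ℂ) ≠ 0 := by exact_mod_cast hN
  have key : ∀ (z : Fin c → ℂ) (y : Fin c → ℝ) (ζ : ℂ),
      fcoef N G k (z + ζ • scaledVec N y) = ce (ζ * ∑ i, (k i : ℂ) * y i) * fcoef N G k z := by
    intro z y
    refine congrFun (eq_of_eq_ofReal (differentiable_fcoef_line hG k z _) ?_ fun t => ?_)
    · have := differentiable_ce
      fun_prop
    · have h := fcoef_add_real hG.continuous hp k z (t • y)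
      have h1 : scaledVec N (t • y) = (t : ℂ) • scaledVec N y := by
        funext i
        simp [scaledVec]
        ring
      rw [h1] at h
      rw [h, Finset.mul_sum]
      congr 2
      refine Finset.sum_congr rfl fun i _ => ?_
      simp
      ring
  have hw : w = (1 : ℂ) • scaledVec N (fun i => (w i).re / N) +
      Complex.I • scaledVec N (fun i => (w i).im / N) := by
    funext i
    simp only [scaledVec, Pi.add_apply, Pi.smul_apply, smul_eq_mul, Complex.ofReal_div,
      Complex.ofReal_natCast]
    rw [mul_div_cancel₀ _ hN', mul_div_cancel₀ _ hN', one_mul, mul_comm, Complex.re_add_im]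
  conv_lhs => rw [hw, ← add_assoc, key, key]
  rw [← mul_assoc, ← ce_add, Finset.sum_div, one_mul, Finset.mul_sum, ← Finset.sum_add_distrib]
  congr 2
  refine Finset.sum_congr rfl fun i _ => ?_
  conv_rhs => rw [← Complex.re_add_im (w i)]
  push_cast
  ring

end Fourier

end JacobiMatrixIndex

namespace JacobiMatrixIndex

open QuadraticMap (polar)

variable {c : ℕ} {Δ : Type*} [AddCommGroup Δ]

namespace MatrixIndex

variable {Q : QuadraticMap ℤ Δ (AddCircle (1 : ℚ))} (I : MatrixIndex c Q)

/-! ### The theta decomposition -/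

theorem charOp_apply (β γ : Δ) (X : Δ → ℂ) : charOp Q β X γ = qe (polar Q β γ) * X γ := rfl

theorem transOp_apply (α γ : Δ) (X : Δ → ℂ) : transOp α X γ = X (γ + α) := rfl

/-- The elliptic transformation law of Jacobi forms at a fixed point of the upper half-plane. -/
def IsElliptic (τ : ℍ) (φ : (Fin c → ℂ) → Δ → ℂ) : Prop :=
  ∀ (z : Fin c → ℂ) (u v : Fin c → ℤ),
    φ (fun i => z i + τ * (u i : ℂ) + (v i : ℂ)) =
      ce (-((τ : ℂ) * (qform I.S (intVec c u) (intVec c u) : ℂ)) -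
          2 * cform I.S (ratVec (intVec c u)) z) •
        charOp Q (I.ψ v) (transOp (I.ψ u) (φ z))

theorem ratVec_intVec (v : Fin c → ℤ) : ratVec (intVec c v) = fun i => (v i : ℂ) := by
  funext i
  simp [ratVec, intVec]

section

variable {I} {τ : ℍ} {φ : (Fin c → ℂ) → Δ → ℂ}

theorem IsElliptic.add_int (h : I.IsElliptic τ φ) (z : Fin c → ℂ) (v : Fin c → ℤ) (β : Δ) :
    φ (z + ratVec (intVec c v)) β = qe (polar Q (I.ψ v) β) * φ z β := by
  have := congrFun (h z 0 v) β
  have h1 : (fun i => z i + τ * (((0 : Fin c → ℤ) i : ℤ) : ℂ) + (v i : ℂ)) =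
      z + ratVec (intVec c v) := by
    rw [ratVec_intVec]
    funext i
    simp
  rw [h1] at this
  rw [this]
  simp [charOp_apply, transOp_apply, qform, cform, ratVec, ce_zero, dotProduct]

theorem IsElliptic.add_smul (h : I.IsElliptic τ φ) (z : Fin c → ℂ) (u : Fin c → ℤ) (β : Δ) :
    φ (z + (τ : ℂ) • ratVec (intVec c u)) β =
      ce (-((τ : ℂ) * (qform I.S (intVec c u) (intVec c u) : ℂ)) -
        2 * cform I.S (ratVec (intVec c u)) z) * φ z (β + I.ψ u) := by
  have := congrFun (h z u 0) β
  have h1 : (fun i => z i + τ * (u i : ℂ) + (((0 : Fin c → ℤ) i : ℤ) : ℂ)) =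
      z + (τ : ℂ) • ratVec (intVec c u) := by
    rw [ratVec_intVec]
    funext i
    simp
  rw [h1] at this
  rw [this]
  simp [charOp_apply, transOp_apply, qe_zero]

variable [Fintype Δ]

theorem IsElliptic.periodic (h : I.IsElliptic τ φ) (β : Δ) (z : Fin c → ℂ) (v : Fin c → ℤ) :
    φ (z + scaledVec (Fintype.card Δ) fun i => v i) β = φ z β := by
  have h1 : scaledVec (Fintype.card Δ) (fun i => (v i : ℝ)) =
      ratVec (intVec c (Fintype.card Δ • v)) := by
    rw [ratVec_intVec]
    funext i
    simp [scaledVec]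
  have h2 : I.ψ (Fintype.card Δ • v) = 0 := by
    rw [map_nsmul]
    exact card_nsmul_eq_zero
  rw [h1, h.add_int, h2, QuadraticMap.polar_zero_left, qe_zero, one_mul]

/-- The Fourier coefficients of a function with the elliptic transformation law. -/
abbrev ecoef (φ : (Fin c → ℂ) → Δ → ℂ) (β : Δ) (k : Fin c → ℤ) : ℂ :=
  fcoef (Fintype.card Δ) (fun z => φ z β) k 0

theorem card_ne_zero' : (Fintype.card Δ : ℂ) ≠ 0 := by exact_mod_cast Fintype.card_ne_zero

theorem IsElliptic.fcoef_eq (h : I.IsElliptic τ φ) (hφ : Differentiable ℂ φ) (β : Δ)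
    (k : Fin c → ℤ) (z : Fin c → ℂ) :
    fcoef (Fintype.card Δ) (fun z => φ z β) k z =
      ce ((∑ i, (k i : ℂ) * z i) / Fintype.card Δ) * ecoef φ β k := by
  rw [ecoef, ← fcoef_add Fintype.card_ne_zero ((differentiable_pi.1 hφ) β) (h.periodic β), zero_add]

/-- Translation by v multiplies φ by one character and its Fourier coefficient by another; a
non-zero coefficient forces them to agree. -/
theorem IsElliptic.ecoef_int (h : I.IsElliptic τ φ) (hφ : Differentiable ℂ φ) {β : Δ}
    {k : Fin c → ℤ} (hk : ecoef φ β k ≠ 0) (v : Fin c → ℤ) :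
    ce ((∑ i, (k i : ℂ) * v i) / Fintype.card Δ) = qe (polar Q (I.ψ v) β) := by
  refine mul_right_cancel₀ hk ?_
  have h1 := h.fcoef_eq hφ β k (ratVec (intVec c v))
  rw [ratVec_intVec] at h1
  rw [← h1, ← ratVec_intVec, ecoef, fcoef, fcoef, ← MeasureTheory.integral_const_mul]
  congr 1
  funext x
  rw [add_comm, h.add_int, zero_add, mul_assoc]

/-- Translation by τu is computed twice: by the general translation rule for Fourier coefficients,
and by the elliptic law, whose factor shifts the frequency by that of u. -/
theorem IsElliptic.ecoef_shift (h : I.IsElliptic τ φ) (hφ : Differentiable ℂ φ) (β : Δ)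
    (k : Fin c → ℤ) (u : Fin c → ℤ) :
    ce (τ * ((∑ i, (k i : ℂ) * u i) / Fintype.card Δ)) * ecoef φ β k =
      ce (-((τ : ℂ) * (qform I.S (intVec c u) (intVec c u) : ℂ))) *
        ecoef φ (β + I.ψ u) (k + I.freq (intVec c u)) := by
  have h1 := h.fcoef_eq hφ β k ((τ : ℂ) • ratVec (intVec c u))
  have h2 : (∑ i, (k i : ℂ) * ((τ : ℂ) • ratVec (intVec c u)) i) / Fintype.card Δ =
      τ * ((∑ i, (k i : ℂ) * u i) / Fintype.card Δ) := by
    rw [ratVec_intVec, ← mul_div_assoc, Finset.mul_sum]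
    congr 1
    refine Finset.sum_congr rfl fun i _ => ?_
    simp
    ring
  rw [h2] at h1
  rw [← h1, ecoef, fcoef, fcoef, ← MeasureTheory.integral_const_mul]
  congr 1
  funext x
  rw [add_comm, h.add_smul, zero_add, I.two_cform_scaledVec (I.intVec_mem_omegaDual u),
    sub_eq_add_neg, ce_add]
  have h3 : -∑ i, (((k + I.freq (intVec c u)) i : ℤ) : ℂ) * x i =
      -∑ i, (I.freq (intVec c u) i : ℂ) * x i + -∑ i, (k i : ℂ) * x i := by
    rw [← neg_add, ← Finset.sum_add_distrib]
    congr 1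
    refine Finset.sum_congr rfl fun i _ => ?_
    simp
    ring
  rw [h3, ce_add]
  ring

theorem sum_freq {a : Fin c → ℚ} (ha : a ∈ I.omegaDual) (z : Fin c → ℂ) :
    (∑ i, (I.freq a i : ℂ) * z i) / Fintype.card Δ = 2 * cform I.S (ratVec a) z := by
  rw [Frame.cform_v, div_eq_iff card_ne_zero', Finset.mul_sum, Finset.sum_mul]
  refine Finset.sum_congr rfl fun i _ => ?_
  have := congrArg (fun q : ℚ => (q : ℂ)) (I.coe_freq ha i)
  push_cast at this
  rw [this, I.qform_comm]
  ring

theorem freq_add {a b : Fin c → ℚ} (ha : a ∈ I.omegaDual) (hb : b ∈ I.omegaDual) :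
    I.freq (a + b) = I.freq a + I.freq b := by
  funext i
  have h : (I.freq (a + b) i : ℚ) = I.freq a i + I.freq b i := by
    rw [I.coe_freq ha, I.coe_freq hb, I.coe_freq (I.omegaDual.add_mem ha hb), qform_add_left]
    ring
  exact_mod_cast h

theorem freq_of_mem_kerS {a : Fin c → ℚ} (ha : a ∈ I.kerS) : I.freq a = 0 := by
  funext i
  rw [freq, I.qform_comm, I.qform_kerS ha]
  simp

/-- The functional y ↦ kᵗy/|Δ| must be 2aᵗSy for some a ∈ Ω*. This requires that it vanish on ker S
and be integral on ker ψ; orthogonal coordinates then produce a. -/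
theorem IsElliptic.exists_freq (h : I.IsElliptic τ φ) (hφ : Differentiable ℂ φ) {β : Δ}
    {k : Fin c → ℤ} (hk : ecoef φ β k ≠ 0) : ∃ a ∈ I.omegaDual, I.freq a = k := by
  obtain ⟨f⟩ := I.nonempty_frame
  have hN : (Fintype.card Δ : ℚ) ≠ 0 := by exact_mod_cast Fintype.card_ne_zero
  have hint : ∀ v, I.ψ v = 0 → ∃ n : ℤ, (∑ i, (k i : ℚ) * v i) / Fintype.card Δ = n := by
    intro v hv
    have h1 := h.ecoef_int hφ hk v
    rw [hv, QuadraticMap.polar_zero_left, qe_zero, ce_eq_one_iff] at h1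
    obtain ⟨n, hn⟩ := h1
    exact ⟨n, by exact_mod_cast hn⟩
  -- For v ∈ ker S the shift law becomes 𝐞(τ kᵗv/|Δ|) = 1. Taking absolute values with Im τ > 0
  -- forces kᵗv = 0.
  have hker : ∀ v, intVec c v ∈ I.kerS → (∑ i, (k i : ℚ) * v i) / Fintype.card Δ = 0 := by
    intro v hv
    have h1 := h.ecoef_shift hφ β k v
    rw [freq_of_mem_kerS hv, I.qform_kerS hv, I.ψ_ker v (I.mem_kerS.1 hv), add_zero, add_zero,
      Rat.cast_zero, mul_zero, neg_zero, ce_zero] at h1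
    have h2 := mul_right_cancel₀ hk h1
    have h3 := congrArg norm h2
    rw [norm_ce, norm_one, Real.exp_eq_one_iff] at h3
    have h4 : ((τ : ℂ) * ((∑ i, (k i : ℂ) * v i) / Fintype.card Δ)).im =
        τ.im * (((∑ i, (k i : ℚ) * v i) / Fintype.card Δ : ℚ) : ℝ) := by
      have : ((∑ i, (k i : ℂ) * v i) / Fintype.card Δ : ℂ) =
          ((((∑ i, (k i : ℚ) * v i) / Fintype.card Δ : ℚ) : ℝ) : ℂ) := by push_cast; rfl
      rw [this, Complex.im_mul_ofReal]
      rfl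
    rw [h4] at h3
    have h5 := τ.im_pos.ne'
    have h6 := Real.pi_pos.ne'
    have h7 : (((∑ i, (k i : ℚ) * v i) / Fintype.card Δ : ℚ) : ℝ) = 0 := by
      simpa [h5, h6] using h3
    exact_mod_cast h7
  choose n hn using fun j => hint (f.u j) (f.map_u j)
  set a := f.vec fun j => n j with ha
  have hbasis : ∀ j, 2 * qform I.S a (f.v j) = (∑ i, (k i : ℚ) * f.v j i) / Fintype.card Δ := by
    intro j
    by_cases hj : f.d j = 0
    · rw [I.qform_kerS (f.v_mem_kerS hj), mul_zero]
      exact (hker _ (f.v_mem_kerS hj)).symm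
    · exact (f.two_qform_vec _ ⟨j, hj⟩).trans (hn j).symm
  have hall : ∀ y, 2 * qform I.S a y = (∑ i, (k i : ℚ) * y i) / Fintype.card Δ := by
    intro y
    have hy := f.basis.sum_repr y
    simp_rw [f.basis_apply] at hy
    rw [← hy, I.qform_comm, qform_sum_left, Finset.mul_sum]
    simp_rw [qform_smul_left, Finset.sum_apply, Finset.mul_sum]
    rw [Finset.sum_comm, Finset.sum_div]
    refine Finset.sum_congr rfl fun j _ => ?_
    have := hbasis j
    rw [Frame.v] at this
    rw [mul_left_comm, I.qform_comm, this, ← mul_div_assoc, Finset.mul_sum]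
    congr 1
    refine Finset.sum_congr rfl fun i _ => ?_
    simp
    ring
  have haΩ : a ∈ I.omegaDual := by
    intro b hb
    obtain ⟨y, hy, l, hl, rfl⟩ := AddSubgroup.mem_sup.1 hb
    obtain ⟨v, hv, rfl⟩ := AddSubgroup.mem_map.1 hy
    rw [qform_add_right, I.qform_kerS hl, add_zero, hall]
    exact hint v hv
  refine ⟨a, haΩ, funext fun i => ?_⟩
  have h1 : (I.freq a i : ℚ) = k i := by
    rw [I.coe_freq haΩ, mul_right_comm, hall, div_mul_cancel₀ _ hN]
    simp [Pi.single_apply]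
  exact_mod_cast h1

/-- The coefficients of the theta expansion. -/
def tcoef (I : MatrixIndex c Q) (τ : ℍ) (φ : (Fin c → ℂ) → Δ → ℂ) (β : Δ) (a : Fin c → ℚ) : ℂ :=
  ce (-((τ : ℂ) * (qform I.S a a : ℂ))) * ecoef φ β (I.freq a)

/-- Expanding the norm of a + u shows that the normalization by 𝐞(-τ aᵗSa) absorbs all factors of
the shift law. -/
theorem IsElliptic.tcoef_add (h : I.IsElliptic τ φ) (hφ : Differentiable ℂ φ) (β : Δ)
    {a : Fin c → ℚ} (ha : a ∈ I.omegaDual) (u : Fin c → ℤ) :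
    I.tcoef τ φ (β + I.ψ u) (a + intVec c u) = I.tcoef τ φ β a := by
  have h1 := h.ecoef_shift hφ β (I.freq a) u
  have h2 := sum_freq ha (ratVec (intVec c u))
  rw [cform_ratVec, ratVec_intVec] at h2
  rw [tcoef, tcoef, freq_add ha (I.intVec_mem_omegaDual u)]
  have h3 : -((τ : ℂ) * (qform I.S (a + intVec c u) (a + intVec c u) : ℂ)) =
      -(τ * (qform I.S a a : ℂ)) + (-(τ * (2 * (qform I.S a (intVec c u) : ℂ))) +
        -(τ * (qform I.S (intVec c u) (intVec c u) : ℂ))) := by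
    rw [qform_add_left, qform_add_right, qform_add_right, I.qform_comm (intVec c u) a]
    push_cast
    ring
  rw [h3, ce_add, ce_add, mul_assoc, mul_assoc, ← h1, h2, ce_neg (τ * (2 * _)),
    inv_mul_cancel_left₀ (ce_ne_zero _)]

theorem tcoef_add_kerS (β : Δ) {a l : Fin c → ℚ} (ha : a ∈ I.omegaDual) (hl : l ∈ I.kerS) :
    I.tcoef τ φ β (a + l) = I.tcoef τ φ β a := by
  rw [tcoef, tcoef, freq_add ha (I.omega_le_omegaDual (I.kerS_le_omega hl)), freq_of_mem_kerS hl,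
    add_zero, qform_add_left, qform_add_right, qform_add_right, I.qform_comm l,
    I.qform_kerS hl, I.qform_kerS hl]
  simp

theorem IsElliptic.tcoef_congr (h : I.IsElliptic τ φ) (hφ : Differentiable ℂ φ) (β : Δ)
    {a b : Fin c → ℚ} (ha : a ∈ I.omegaDual) (hb : b ∈ I.omegaDual) (hab : I.cls ha = I.cls hb) :
    I.tcoef τ φ β a = I.tcoef τ φ β b := by
  rw [I.cls_eq_iff] at hab
  obtain ⟨y, hy, l, hl, hyl⟩ := AddSubgroup.mem_sup.1 hab
  obtain ⟨u, hu, rfl⟩ := AddSubgroup.mem_map.1 hy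
  have h1 : b = a + intVec c u + l := by rw [add_assoc, hyl, add_sub_cancel]
  rw [h1, tcoef_add_kerS _ (I.omegaDual.add_mem ha (I.intVec_mem_omegaDual u)) hl,
    ← h.tcoef_add hφ β ha u, (AddMonoidHom.mem_ker).1 hu, add_zero]

variable [Fintype I.DOmega]

/-- The theta decomposition of a function with the elliptic transformation law. -/
theorem IsElliptic.eq_sum_theta (h : I.IsElliptic τ φ) (hφ : Differentiable ℂ φ) {β : Δ}
    {f : I.DOmega → ℂ}
    (hf : ∀ {a} (ha : a ∈ I.omegaDual), f (I.cls ha) = I.tcoef τ φ β a) (z : Fin c → ℂ) :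
    φ z β = ∑ γ, f γ * I.theta τ z γ := by
  choose rp hrp hrp' using fun b : I.OmegaBarDual => exists_bcls b
  have hinj : Function.Injective fun b => I.freq (rp b) := by
    intro b b' hb
    have := I.sub_mem_kerS_of_freq (hrp b') (hrp b) hb.symm
    rw [← bcls_eq_iff (hrp b) (hrp b'), hrp', hrp'] at this
    exact this
  -- The convergent theta combination reproduces the Fourier series term by term, and frequencies
  -- not coming from Ω* have coefficient zero. This also supplies the summability needed by
  -- `hasSum_fcoef`.
  have h1 : HasSum (fun k => fcoef (Fintype.card Δ) (fun z => φ z β) k z)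
      (∑ γ, f γ * I.theta τ z γ) := by
    rw [← hinj.hasSum_iff]
    · convert I.hasSum_sum_theta f τ z using 2 with b
      conv_rhs => rw [← hrp' b, barToD_bcls, thetaTerm_bcls, hf, tcoef]
      rw [Function.comp_apply, h.fcoef_eq hφ, sum_freq (hrp b), thetaExp, ce_add, ce_neg]
      have := ce_ne_zero ((τ : ℂ) * (qform I.S (rp b) (rp b) : ℂ))
      field_simp
    · intro k hk
      rw [h.fcoef_eq hφ]
      by_contra h0
      obtain ⟨a, ha, rfl⟩ := h.exists_freq hφ (right_ne_zero_of_mul h0)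
      refine hk ⟨I.bcls ha, ?_⟩
      have h2 := (bcls_eq_iff (hrp (I.bcls ha)) ha).1 (hrp' _)
      have h3 := freq_add (hrp (I.bcls ha)) (I.omega_le_omegaDual (I.kerS_le_omega h2))
      rw [freq_of_mem_kerS h2, add_zero, add_sub_cancel] at h3
      exact h3.symm
  exact (hasSum_fcoef ((differentiable_pi.1 hφ) β).continuous (h.periodic β) z h1.summable).unique h1

/-- The last two properties drive the gluing: invariance under diagonal translation by ℤ^c makes the
coefficients depend on δ alone, and the support condition supplies elements of H^⊥. -/
theorem IsElliptic.exists_theta_expansion (h : I.IsElliptic τ φ) (hφ : Differentiable ℂ φ) :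
    ∃ f : Δ → I.DOmega → ℂ,
      (∀ z β, φ z β = ∑ γ, f β γ * I.theta τ z γ) ∧
      (∀ β {a} (ha : a ∈ I.omegaDual), f β (I.cls ha) = I.tcoef τ φ β a) ∧
      (∀ β γ u, f (β + I.ψ u) (γ + I.intClass u) = f β γ) ∧
      ∀ β γ v, f β γ ≠ 0 → polar I.quad γ (I.intClass v) = polar Q β (I.ψ v) := by
  choose rp hrp hrp' using I.exists_cls
  have hf : ∀ β {a} (ha : a ∈ I.omegaDual), I.tcoef τ φ β (rp (I.cls ha)) = I.tcoef τ φ β a :=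
    fun β a ha => h.tcoef_congr hφ β (hrp _) ha (hrp' _)
  refine ⟨fun β γ => I.tcoef τ φ β (rp γ), fun z β => h.eq_sum_theta hφ (hf β) z, hf, ?_, ?_⟩
  · intro β γ u
    obtain ⟨a, ha, rfl⟩ := I.exists_cls γ
    beta_reduce
    rw [intClass_eq, ← cls_add, hf, hf, h.tcoef_add hφ β ha]
  · intro β γ v h0
    have h1 := h.ecoef_int hφ (right_ne_zero_of_mul h0) v
    have h2 := sum_freq (hrp γ) (ratVec (intVec c v))
    rw [cform_ratVec, ratVec_intVec] at h2
    rw [h2] at h1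
    conv_lhs => rw [← hrp' γ]
    rw [QuadraticMap.polar_comm Q]
    refine qe_injective ?_
    rw [← h1, intClass_eq, polar_quad_cls, qe_coe]
    push_cast
    rfl

end

end MatrixIndex

end JacobiMatrixIndex

namespace JacobiMatrixIndex

open QuadraticMap (polar)

variable {c : ℕ} {Δ : Type*} [AddCommGroup Δ]

namespace MatrixIndex

variable {Q : QuadraticMap ℤ Δ (AddCircle (1 : ℚ))} {I : MatrixIndex c Q}

/-! ### Gluing along the horizontal subgroup -/

section Gluing

variable {D : Type*} [AddCommGroup D] {QD : QuadraticMap ℤ D (AddCircle (1 : ℚ))}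
  {HD : AddSubgroup D} {ι : I.HOmega ≃+ HD}

/-- The orthogonal complement of the horizontal subgroup. -/
abbrev gperp (I : MatrixIndex c Q) (QD : QuadraticMap ℤ D (AddCircle (1 : ℚ)))
    {HD : AddSubgroup D} (ι : I.HOmega ≃+ HD) : AddSubgroup (I.DOmega × D) :=
  perp (I.quad.prod QD) (I.glue ι)

/-- The projection `H^⊥ → Δ`. -/
def glueHom (e : I.DeltaH QD ι ≃+ Δ) : I.gperp QD ι →+ Δ :=
  show I.gluePerp QD ι →+ Δ from e.toAddMonoidHom.comp (QuotientAddGroup.mk' _)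

/-- The compatibility conditions for an identification of `Δ_H` with `Δ`. -/
structure IsGluing (I : MatrixIndex c Q) (QD : QuadraticMap ℤ D (AddCircle (1 : ℚ)))
    {HD : AddSubgroup D} (ι : I.HOmega ≃+ HD) (e : I.DeltaH QD ι ≃+ Δ) : Prop where
  quad_ι : ∀ γ : I.HOmega, QD (ι γ : D) = -I.quad (γ : I.DOmega)
  quad_e : ∀ α : I.gluePerp QD ι, Q (e (I.toDeltaH QD ι α)) = I.quad.prod QD α.1
  e_int : ∀ u : Fin c → ℤ, e (I.intToDeltaH QD ι u) = I.ψ u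

variable {e : I.DeltaH QD ι ≃+ Δ}

theorem glueHom_apply (α : I.gperp QD ι) : glueHom e α = e (I.toDeltaH QD ι α) := rfl

theorem glueHom_surjective : Function.Surjective (glueHom e) :=
  e.surjective.comp
    (QuotientAddGroup.mk'_surjective ((I.glue ι).addSubgroupOf (I.gluePerp QD ι)))

theorem glueHom_eq_zero_iff (α : I.gperp QD ι) : glueHom e α = 0 ↔ α.1 ∈ I.glue ι := by
  rw [glueHom_apply, EmbeddingLike.map_eq_zero_iff]
  exact (QuotientAddGroup.eq_zero_iff (N := (I.glue ι).addSubgroupOf (I.gluePerp QD ι)) _).trans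
    AddSubgroup.mem_addSubgroupOf

theorem mem_glue {α : I.DOmega × D} : α ∈ I.glue ι ↔ ∃ h : I.HOmega, α = (h.1, (ι h : D)) := by
  constructor
  · rintro ⟨h, rfl⟩
    exact ⟨h, rfl⟩
  · rintro ⟨h, rfl⟩
    exact ⟨h, rfl⟩

theorem mem_gluePerp {α : I.DOmega × D} : α ∈ I.gperp QD ι ↔
    ∀ h : I.HOmega, polar I.quad α.1 h + polar QD α.2 (ι h) = 0 := by
  constructor
  · intro hα h
    rw [← polar_prod_apply α (h.1, (ι h : D))]
    exact hα _ (mem_glue.2 ⟨h, rfl⟩)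
  · rintro hα _ hl
    obtain ⟨l, rfl⟩ := mem_glue.1 hl
    rw [polar_prod_apply]
    exact hα l

theorem IsGluing.quad_glue (hG : I.IsGluing QD ι e) : ∀ h ∈ I.glue ι, I.quad.prod QD h = 0 := by
  intro h hh
  obtain ⟨h, rfl⟩ := mem_glue.1 hh
  rw [QuadraticMap.prod_apply, hG.quad_ι, add_neg_cancel]

theorem IsGluing.quad_glueHom (hG : I.IsGluing QD ι e) (α : I.gperp QD ι) :
    Q (glueHom e α) = I.quad.prod QD α.1 := hG.quad_e α

theorem IsGluing.polar_glueHom (hG : I.IsGluing QD ι e) (α α' : I.gperp QD ι) :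
    polar Q (glueHom e α) (glueHom e α') = polar (I.quad.prod QD) α.1 α'.1 := by
  rw [polar, polar, ← map_add, hG.quad_glueHom, hG.quad_glueHom, hG.quad_glueHom]
  rfl

theorem IsGluing.glueHom_int (hG : I.IsGluing QD ι e) (u : Fin c → ℤ) :
    glueHom e ⟨(I.intClass u, 0), I.intClass_mem_gluePerp QD ι u⟩ = I.ψ u := hG.e_int u

theorem IsGluing.polar_fst_int (hG : I.IsGluing QD ι e) (α : I.gperp QD ι) (u : Fin c → ℤ) :
    polar I.quad α.1.1 (I.intClass u) = polar Q (glueHom e α) (I.ψ u) := by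
  rw [← hG.glueHom_int, hG.polar_glueHom, polar_prod_apply, QuadraticMap.polar_zero_right, add_zero]

/-- H is the graph of a homomorphism, so an element of H with first component 0 is 0. -/
theorem snd_eq_of_glueHom_eq {α α' : I.gperp QD ι} (h : glueHom e α = glueHom e α')
    (h1 : α.1.1 = α'.1.1) : α = α' := by
  rw [← sub_eq_zero, ← map_sub, glueHom_eq_zero_iff] at h
  obtain ⟨l, hl⟩ := mem_glue.1 h
  have hl1 : l = 0 := by
    ext1
    have := congrArg Prod.fst hl
    simp only [AddSubgroup.coe_sub, Prod.fst_sub, h1, sub_self] at this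
    exact this.symm
  rw [hl1, map_zero] at hl
  exact sub_eq_zero.1 (Subtype.ext hl)

/-- For any α above β, the difference between γ and the first component of α is orthogonal to ℤ^c,
so it lies in H_Ω and can be corrected by an element of H. -/
theorem IsGluing.exists_fst_eq (hG : I.IsGluing QD ι e) {β : Δ} {γ : I.DOmega}
    (h : ∀ u, polar I.quad γ (I.intClass u) = polar Q β (I.ψ u)) :
    ∃ α : I.gperp QD ι, glueHom e α = β ∧ α.1.1 = γ := by
  obtain ⟨α, rfl⟩ := glueHom_surjective (e := e) β
  have h1 : γ - α.1.1 ∈ I.HOmega := by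
    rintro _ ⟨u, rfl⟩
    rw [QuadraticMap.polar_sub_left, h, hG.polar_fst_int, sub_self]
  have h2 : (γ - α.1.1, (ι ⟨_, h1⟩ : D)) ∈ I.glue ι := mem_glue.2 ⟨⟨_, h1⟩, rfl⟩
  refine ⟨α + ⟨_, isotropic_le_perp hG.quad_glue h2⟩, ?_, ?_⟩
  · rw [map_add, (glueHom_eq_zero_iff ⟨_, isotropic_le_perp hG.quad_glue h2⟩).2 h2, add_zero]
  · simp

variable [Fintype I.DOmega]

/-- If no γ existed, the character l ↦ (γ, l) + (δ, ι l) of H_Ω would be non-trivial for each γ and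
all its sums would vanish. Summing over γ first leaves only l = 0 and gives |D_Ω|. -/
theorem exists_mem_gluePerp (hI : IsDiscriminantForm I.quad) (δ : D) :
    ∃ γ : I.DOmega, (γ, δ) ∈ I.gperp QD ι := by
  classical
  by_contra! h
  have h1 : ∀ γ : I.DOmega, ∑ l : I.HOmega, qe (polar I.quad γ l + polar QD δ (ι l)) = 0 := by
    intro γ
    have h2 := sum_qe_addMonoidHom (((pairing I.quad γ).comp I.HOmega.subtype) +
      (pairing QD δ).comp (HD.subtype.comp ι.toAddMonoidHom))
    refine h2.trans (if_neg fun h3 => h γ (mem_gluePerp.2 h3))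
  have h2 : ∑ γ : I.DOmega, ∑ l : I.HOmega, qe (polar I.quad γ l + polar QD δ (ι l)) =
      Fintype.card I.DOmega := by
    rw [Finset.sum_comm]
    simp_rw [qe_add, ← Finset.sum_mul]
    have h3 : ∀ l : I.HOmega, ∑ γ, qe (polar I.quad (l : I.DOmega) γ) =
        if l = 0 then (Fintype.card I.DOmega : ℂ) else 0 := fun l => by
      rw [sum_qe_polar _ hI]
      simp
    have h4 : ∀ l : I.HOmega, (∑ γ, qe (polar I.quad γ (l : I.DOmega))) =
        if l = 0 then (Fintype.card I.DOmega : ℂ) else 0 := fun l => by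
      rw [← h3]
      exact Finset.sum_congr rfl fun γ _ => by rw [QuadraticMap.polar_comm]
    simp_rw [h4]
    simp [qe_zero]
  simp_rw [h1, Finset.sum_const_zero] at h2
  exact Fintype.card_ne_zero (α := I.DOmega) (by exact_mod_cast h2.symm)

theorem range_intClass_eq (hI : IsDiscriminantForm I.quad) {γ : I.DOmega}
    (h : ∀ l : I.HOmega, polar I.quad γ l = 0) : ∃ u, I.intClass u = γ := by
  have h1 : γ ∈ perp I.quad (perp I.quad I.intClass.range) := fun l hl => h ⟨l, hl⟩
  rw [perp_perp I.quad hI] at h1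
  exact h1

/-! ### The arrow operator on tensors with theta functions -/

variable [Fintype D]

theorem arrowDown_eq (X : I.DOmega × D → ℂ) : I.arrowDown QD ι e X = arrow (glueHom e) X := by
  classical
  funext β
  rw [arrow_apply, arrowDown, finsum_eq_sum_of_fintype, ← Finset.sum_filter]
  exact (Finset.sum_subtype _ (fun _ => by simp; rfl) (fun α : I.gperp QD ι => X α.1)).symm

open Classical in
/-- The coefficient of `𝔢_γ` in the definition of the arrow operator. -/
def glueCoef (e : I.DeltaH QD ι ≃+ Δ) (Y : D → ℂ) (β : Δ) (γ : I.DOmega) : ℂ :=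
  ∑ α : perp (I.quad.prod QD) (I.glue ι), if glueHom e α = β ∧ α.1.1 = γ then Y α.1.2 else 0

theorem arrow_tens (X : I.DOmega → ℂ) (Y : D → ℂ) (β : Δ) :
    arrow (glueHom e) (tens X Y) β = ∑ γ, glueCoef e Y β γ * X γ := by
  classical
  simp_rw [glueCoef, Finset.sum_mul]
  rw [Finset.sum_comm, arrow_apply]
  refine Finset.sum_congr rfl fun α _ => ?_
  split_ifs with h
  · simp [h, tens, mul_comm]
  · simp [h]

theorem glueCoef_of_mem (Y : D → ℂ) (α : I.gperp QD ι) :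
    glueCoef e Y (glueHom e α) α.1.1 = Y α.1.2 := by
  classical
  rw [glueCoef, Finset.sum_eq_single α]
  · simp
  · intro α' _ h
    rw [if_neg]
    rintro ⟨h1, h2⟩
    exact h (snd_eq_of_glueHom_eq h1 h2)
  · simp

theorem glueCoef_eq_zero (Y : D → ℂ) {β : Δ} {γ : I.DOmega}
    (h : ∀ α : I.gperp QD ι, glueHom e α = β → α.1.1 ≠ γ) : glueCoef e Y β γ = 0 :=
  Finset.sum_eq_zero fun α _ => if_neg fun h' => h α h'.1 h'.2

variable [Fintype Δ]

/-- Linear independence of the theta functions recovers each coefficient, and every δ occurs in some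
coefficient. This is the source of both uniqueness and modularity of F. -/
theorem eq_of_arrow_theta_eq {τ : ℍ} {Y Y' : D → ℂ}
    (h : ∀ z, arrow (glueHom e) (tens (I.theta τ z) Y) =
      arrow (glueHom e) (tens (I.theta τ z) Y')) : Y = Y' := by
  funext δ
  obtain ⟨γ, hγ⟩ := exists_mem_gluePerp (ι := ι) (QD := QD) I.isDiscriminantForm_quad δ
  have h1 := I.eq_zero_of_sum_theta (f := fun γ' => glueCoef e Y (glueHom e ⟨_, hγ⟩) γ' -
    glueCoef e Y' (glueHom e ⟨_, hγ⟩) γ') τ fun z => by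
      simp_rw [sub_mul, Finset.sum_sub_distrib, ← arrow_tens, h, sub_self]
  have h2 := congrFun h1 γ
  exact (glueCoef_of_mem Y (⟨_, hγ⟩ : I.gperp QD ι)).symm.trans
    ((sub_eq_zero.1 h2).trans (glueCoef_of_mem Y' (⟨_, hγ⟩ : I.gperp QD ι)))

theorem IsElliptic.exists_arrow_eq (hG : I.IsGluing QD ι e) {τ : ℍ} {φ : (Fin c → ℂ) → Δ → ℂ}
    (h : I.IsElliptic τ φ) (hφ : Differentiable ℂ φ) :
    ∃ Y : D → ℂ, (∀ z, φ z = arrow (glueHom e) (tens (I.theta τ z) Y)) ∧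
      ∀ (α : I.gperp QD ι) {a : Fin c → ℚ} (ha : a ∈ I.omegaDual), I.cls ha = α.1.1 →
        Y α.1.2 = I.tcoef τ φ (glueHom e α) a := by
  obtain ⟨f, hf1, hf2, hf3, hf4⟩ := h.exists_theta_expansion hφ
  choose g hg using exists_mem_gluePerp (ι := ι) (QD := QD) I.isDiscriminantForm_quad
  let Y : D → ℂ := fun δ => f (glueHom e ⟨_, hg δ⟩) (g δ)
  -- Two elements of H^⊥ with the same δ have first components differing by H_Ω^⊥, i.e. by the class
  -- of some u. Their images in Δ then differ by ψu, and f is invariant under this joint shift.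
  have hY : ∀ α : I.gperp QD ι, Y α.1.2 = f (glueHom e α) α.1.1 := by
    intro α
    obtain ⟨u, hu⟩ := range_intClass_eq (γ := α.1.1 - g α.1.2) I.isDiscriminantForm_quad fun l => by
      have h1 := mem_gluePerp.1 α.2 l
      have h2 := mem_gluePerp.1 (hg α.1.2) l
      rw [QuadraticMap.polar_sub_left, eq_neg_of_add_eq_zero_left h1,
        eq_neg_of_add_eq_zero_left h2, sub_self]
    have h3 : α = ⟨_, hg α.1.2⟩ + ⟨(I.intClass u, 0), I.intClass_mem_gluePerp QD ι u⟩ := by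
      ext1
      refine Prod.ext ?_ ?_
      · simp [hu]
      · simp
    have h4 : glueHom e α = glueHom e ⟨_, hg α.1.2⟩ + I.ψ u := by
      conv_lhs => rw [h3]
      rw [← hG.glueHom_int]
      exact map_add (glueHom e) _ _
    have h5 : α.1.1 = g α.1.2 + I.intClass u := by rw [hu, add_sub_cancel]
    rw [h4, h5, hf3]
  refine ⟨Y, fun z => ?_, fun α a ha hα => ?_⟩
  · funext β
    rw [hf1, arrow_tens]
    refine Finset.sum_congr rfl fun γ _ => ?_
    congr 1
    by_cases h0 : ∃ α : I.gperp QD ι, glueHom e α = β ∧ α.1.1 = γ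
    · obtain ⟨α, rfl, rfl⟩ := h0
      rw [glueCoef_of_mem, hY]
    · rw [glueCoef_eq_zero Y fun α h1 h2 => h0 ⟨α, h1, h2⟩]
      -- If the coefficient were non-zero, the support condition would produce an element of H^⊥
      -- over β with first component γ.
      by_contra h1
      exact h0 (hG.exists_fst_eq (hf4 β γ · h1))
  · rw [hY, ← hf2 _ ha, hα]

end Gluing

end MatrixIndex

end JacobiMatrixIndex

namespace JacobiMatrixIndex

open QuadraticMap (polar)

variable {c : ℕ} {Δ : Type*} [AddCommGroup Δ]

namespace MatrixIndex

variable {Q : QuadraticMap ℤ Δ (AddCircle (1 : ℚ))} {I : MatrixIndex c Q}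

/-! ### The modular form attached to a Jacobi form -/

section Lift

variable {D : Type*} [AddCommGroup D] {QD : QuadraticMap ℤ D (AddCircle (1 : ℚ))}
  {HD : AddSubgroup D} {ι : I.HOmega ≃+ HD} {e : I.DeltaH QD ι ≃+ Δ}
  [Fintype Δ] [Fintype D]

theorem IsJacobiForm.isElliptic {Γ : Subgroup Mp2Z} {κ : ℤ} {Φ : ℍ → (Fin c → ℂ) → Δ → ℂ}
    (hΦ : I.IsJacobiForm Γ κ Φ) (τ : ℍ) : I.IsElliptic τ (Φ τ) := hΦ.periodic τ

theorem thetaCoeff_eq {a : Fin c → ℚ} (ha : a ∈ I.omegaDual) (Φ : ℍ → (Fin c → ℂ) → Δ → ℂ)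
    (β : Δ) (τ : ℍ) : I.thetaCoeff Φ β a τ = I.tcoef τ (Φ τ) β a := by
  rw [thetaCoeff, tcoef, ecoef, fcoef]
  congr 2
  funext x
  rw [← I.two_cform_scaledVec ha, zero_add]
  rfl

variable [Fintype I.DOmega]

/-- `Φ` is the image of `Θ ⊗ F` under the arrow operator. -/
def IsLift (e : I.DeltaH QD ι ≃+ Δ) (Φ : ℍ → (Fin c → ℂ) → Δ → ℂ) (F : ℍ → D → ℂ) : Prop :=
  ∀ τ z, Φ τ z = arrow (glueHom e) (tens (I.theta τ z) (F τ))

theorem tens_smul_left {M N : Type*} (r : ℂ) (X : M → ℂ) (Y : N → ℂ) :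
    tens (r • X) Y = r • tens X Y := by
  funext α
  simp [tens, mul_assoc]

theorem tens_smul_right {M N : Type*} (r : ℂ) (X : M → ℂ) (Y : N → ℂ) :
    tens X (r • Y) = r • tens X Y := by
  funext α
  simp [tens, mul_left_comm]

/-- Θ contributes the root to the power b₊ and the index factor, so weights m - b₊ and m correspond,
while the arrow turns U into V. -/
theorem IsGluing.exists_arrow_smul (hG : I.IsGluing QD ι e) (hD : IsDiscriminantForm QD)
    {A : Mp2Z} {U : Module.End ℂ (D → ℂ)} (hU : (A, U) ∈ weilGraph QD) :
    ∃ V, (A, V) ∈ weilGraph Q ∧ ∀ (m : ℤ) (τ : ℍ) (z : Fin c → ℂ) (Y : D → ℂ),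
      arrow (glueHom e) (tens (I.theta (A.mat • τ) ((autJ A.mat τ)⁻¹ • z))
        (A.root τ ^ (m - I.S.rank) • U Y)) =
      (A.root τ ^ m * ce ((A.mat 1 0 : ℂ) * cform I.S z z / autJ A.mat τ)) •
        V (arrow (glueHom e) (tens (I.theta τ z) Y)) := by
  obtain ⟨W, V, hW, hV, hWV⟩ := exists_weil_compat I.isDiscriminantForm_quad hD hG.quad_glue
    (glueHom e) glueHom_eq_zero_iff glueHom_surjective hG.quad_glueHom hU
  refine ⟨V, hV, fun m τ z Y => ?_⟩
  rw [← hWV, I.theta_modular hW, tens_smul_right, tens_smul_left, map_smul, map_smul, smul_smul,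
    ← mul_assoc, ← zpow_natCast, ← zpow_add₀ (A.root_ne_zero τ), sub_add_cancel]

/-- Both sides have the same arrow image with Θ at Aτ, by the laws of Φ and Θ, and Θ can be
cancelled. -/
theorem IsLift.modular {Γ : Subgroup Mp2Z} {κ : ℤ} {Φ : ℍ → (Fin c → ℂ) → Δ → ℂ} {F : ℍ → D → ℂ}
    (hF : IsLift e Φ F) (hΦ : I.IsJacobiForm Γ κ Φ) (hG : I.IsGluing QD ι e)
    (hD : IsDiscriminantForm QD) {A : Mp2Z} (hA : A ∈ Γ) {U : Module.End ℂ (D → ℂ)}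
    (hU : (A, U) ∈ weilGraph QD) (τ : ℍ) :
    F (A.mat • τ) = A.root τ ^ (κ - I.S.rank) • U (F τ) := by
  obtain ⟨V, hV, h⟩ := hG.exists_arrow_smul hD hU
  refine eq_of_arrow_theta_eq (e := e) (τ := A.mat • τ) fun z => ?_
  have hz : z = (autJ A.mat τ)⁻¹ • (autJ A.mat τ • z) := by
    rw [smul_smul, inv_mul_cancel₀ (autJ_ne_zero _ _), one_smul]
  rw [hz, h, ← hF, ← hF]
  exact hΦ.modular A hA V hV τ _

/-- The components of `F` as quotients of linear combinations of translates of `Φ` by theta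
functions. -/
theorem IsLift.mul_theta {Φ : ℍ → (Fin c → ℂ) → Δ → ℂ} {F : ℍ → D → ℂ} (hF : IsLift e Φ F)
    {rp : I.DOmega → Fin c → ℚ} (hrp : ∀ v, rp v ∈ I.omegaDual) (hrp' : ∀ v, I.cls (hrp v) = v)
    (α : I.gperp QD ι) (τ : ℍ) (z : Fin c → ℂ) :
    F τ α.1.2 * I.theta τ z α.1.1 = (Fintype.card I.DOmega : ℂ)⁻¹ *
      ∑ v, qe (-polar I.quad v α.1.1) * Φ τ (z + ratVec (rp v)) (glueHom e α) := by
  classical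
  have hc : (Fintype.card I.DOmega : ℂ) ≠ 0 := by exact_mod_cast Fintype.card_ne_zero
  rw [eq_inv_mul_iff_mul_eq₀ hc]
  simp_rw [hF τ, arrow_tens, I.theta_add_vec _ _ _ (hrp _), hrp', Finset.mul_sum]
  rw [Finset.sum_comm, Finset.sum_eq_single α.1.1]
  · rw [glueCoef_of_mem]
    have : ∀ v : I.DOmega, qe (-polar I.quad v α.1.1) * (F τ α.1.2 *
        (qe (polar I.quad α.1.1 v) * I.theta τ z α.1.1)) = F τ α.1.2 * I.theta τ z α.1.1 := by
      intro v
      rw [qe_neg, QuadraticMap.polar_comm]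
      have := qe_ne_zero (polar I.quad α.1.1 v)
      field_simp
    simp_rw [this]
    simp
  · intro γ _ hγ
    have h1 : ∀ v : I.DOmega, qe (-polar I.quad v α.1.1) * (glueCoef e (F τ) (glueHom e α) γ *
        (qe (polar I.quad γ v) * I.theta τ z γ)) = qe (polar I.quad (γ - α.1.1) v) *
          (glueCoef e (F τ) (glueHom e α) γ * I.theta τ z γ) := by
      intro v
      rw [QuadraticMap.polar_sub_left, sub_eq_add_neg, qe_add, QuadraticMap.polar_comm I.quad v]
      ring
    simp_rw [h1]
    -- Averaging against the character of α.1.1 annihilates every other component, by non-degeneracy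
    -- of D_Ω.
    rw [← Finset.sum_mul, sum_qe_polar _ I.isDiscriminantForm_quad, if_neg (sub_ne_zero.2 hγ),
      zero_mul]
  · simp

open UpperHalfPlane in
-- With z chosen so that θ_γ(τ₀, z) ≠ 0, the theta component stays non-zero near τ₀ and
-- `IsLift.mul_theta` can be divided by it.
theorem IsLift.exists_eventuallyEq {Φ : ℍ → (Fin c → ℂ) → Δ → ℂ} {F : ℍ → D → ℂ}
    (hF : IsLift e Φ F) (δ : D) {τ₀ : ℂ} (hτ₀ : τ₀ ∈ upperHalfPlaneSet) :
    ∃ (β : Δ) (w : I.DOmega → Fin c → ℂ) (b : I.DOmega → ℂ) (g : ℂ → ℂ),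
      DifferentiableOn ℂ g upperHalfPlaneSet ∧ g τ₀ ≠ 0 ∧
      (fun τ : ℂ => F (ofComplex τ) δ) =ᶠ[nhds τ₀]
        fun τ => (∑ v, b v * Φ (ofComplex τ) (w v) β) / g τ := by
  obtain ⟨γ, hγ⟩ := exists_mem_gluePerp (ι := ι) (QD := QD) I.isDiscriminantForm_quad δ
  obtain ⟨z, hz⟩ := I.exists_theta_ne_zero (ofComplex τ₀) γ
  choose rp hrp hrp' using I.exists_cls
  let g : ℂ → ℂ := fun τ => I.theta (ofComplex τ) z γ
  have hg : DifferentiableOn ℂ g upperHalfPlaneSet := fun τ hτ => by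
    have h1 := I.differentiableAt_theta γ (p := (τ, z)) hτ
    have h2 : DifferentiableAt ℂ (fun τ : ℂ => (τ, z)) τ := by fun_prop
    exact (h1.fun_comp' τ h2).differentiableWithinAt
  refine ⟨glueHom e ⟨_, hγ⟩, fun v => z + ratVec (rp v),
    fun v => (Fintype.card I.DOmega : ℂ)⁻¹ * qe (-polar I.quad v γ), g, hg, hz, ?_⟩
  have h1 : ∀ᶠ τ in nhds τ₀, g τ ≠ 0 :=
    ((hg.differentiableAt (isOpen_upperHalfPlaneSet.mem_nhds hτ₀)).continuousAt).eventually_ne hz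
  filter_upwards [h1] with τ hτ
  rw [eq_div_iff hτ]
  have h2 := hF.mul_theta hrp hrp' ⟨_, hγ⟩ (ofComplex τ) z
  rw [Finset.mul_sum] at h2
  simp_rw [mul_assoc]
  exact h2

open UpperHalfPlane in
theorem IsLift.contDiffOn {Φ : ℍ → (Fin c → ℂ) → Δ → ℂ} {F : ℍ → D → ℂ}
    (hF : IsLift e Φ F)
    (hΦ : ContDiffOn ℝ ∞ (fun p : ℂ × (Fin c → ℂ) => Φ (ofComplex p.1) p.2)
      (upperHalfPlaneSet ×ˢ Set.univ)) :
    ContDiffOn ℝ ∞ (fun τ : ℂ => F (ofComplex τ)) upperHalfPlaneSet := by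
  rw [contDiffOn_pi]
  intro δ τ₀ hτ₀
  obtain ⟨β, w, b, g, hg, hg0, hFg⟩ := hF.exists_eventuallyEq δ hτ₀
  have hU := isOpen_upperHalfPlaneSet.mem_nhds hτ₀
  refine ContDiffAt.contDiffWithinAt (ContDiffAt.congr_of_eventuallyEq ?_ hFg)
  have h1 : ContDiffAt ℝ ∞ g τ₀ :=
    ((hg.contDiffOn isOpen_upperHalfPlaneSet).contDiffAt hU).restrict_scalars ℝ
  have h2 : ∀ v, ContDiffAt ℝ ∞ (fun τ : ℂ => Φ (ofComplex τ) (w v) β) τ₀ := fun v => by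
    have h3 := hΦ.contDiffAt ((isOpen_upperHalfPlaneSet.prod isOpen_univ).mem_nhds
      (⟨hτ₀, trivial⟩ : (τ₀, w v) ∈ upperHalfPlaneSet ×ˢ Set.univ))
    have h4 : ContDiffAt ℝ ∞ (fun τ : ℂ => (τ, w v)) τ₀ := by fun_prop
    exact contDiffAt_pi.1 (h3.comp τ₀ h4) β
  simp_rw [div_eq_mul_inv]
  exact (ContDiffAt.sum fun v _ => contDiffAt_const.mul (h2 v)).mul (h1.inv hg0)

open UpperHalfPlane in
theorem IsLift.holomorphicOnH {Φ : ℍ → (Fin c → ℂ) → Δ → ℂ} {F : ℍ → D → ℂ}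
    (hF : IsLift e Φ F) (hΦ : JointlyHolomorphic Φ) : HolomorphicOnH F := by
  refine differentiableOn_pi.2 fun δ τ₀ hτ₀ => ?_
  obtain ⟨β, w, b, g, hg, hg0, hFg⟩ := hF.exists_eventuallyEq δ hτ₀
  have hU := isOpen_upperHalfPlaneSet.mem_nhds hτ₀
  refine DifferentiableAt.differentiableWithinAt (DifferentiableAt.congr_of_eventuallyEq ?_ hFg)
  have h2 : ∀ v, DifferentiableAt ℂ (fun τ : ℂ => Φ (ofComplex τ) (w v) β) τ₀ := fun v => by
    have h3 := hΦ.differentiableAt ((isOpen_upperHalfPlaneSet.prod isOpen_univ).mem_nhds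
      (⟨hτ₀, trivial⟩ : (τ₀, w v) ∈ upperHalfPlaneSet ×ˢ Set.univ))
    have h4 : DifferentiableAt ℂ (fun τ : ℂ => (τ, w v)) τ₀ := by fun_prop
    exact differentiableAt_pi.1 (h3.comp τ₀ h4) β
  exact (DifferentiableAt.fun_sum fun v _ => (h2 v).const_mul _).div
    (hg.differentiableAt hU) hg0

open UpperHalfPlane in
theorem IsLift.jointlyHolomorphic {Φ : ℍ → (Fin c → ℂ) → Δ → ℂ} {F : ℍ → D → ℂ}
    (hF : IsLift e Φ F) (h : HolomorphicOnH F) : JointlyHolomorphic Φ := by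
  classical
  refine differentiableOn_pi.2 fun β p hp => ?_
  have hp1 : p.1 ∈ upperHalfPlaneSet := hp.1
  refine DifferentiableAt.differentiableWithinAt ?_
  have h1 : (fun p : ℂ × (Fin c → ℂ) => Φ (ofComplex p.1) p.2 β) =
      fun p : ℂ × (Fin c → ℂ) => ∑ α : I.gperp QD ι, if glueHom e α = β then
        I.theta (ofComplex p.1) p.2 α.1.1 * F (ofComplex p.1) α.1.2 else 0 := by
    funext p
    rw [hF, arrow_apply]
    rfl
  rw [h1]
  refine DifferentiableAt.fun_sum fun α _ => ?_
  split_ifs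
  · refine (I.differentiableAt_theta α.1.1 hp1).mul ?_
    have h2 := differentiableAt_pi.1
      (h.differentiableAt (isOpen_upperHalfPlaneSet.mem_nhds hp1)) α.1.2
    exact h2.fun_comp' p differentiableAt_fst
  · exact differentiableAt_const _

theorem IsLift.isModularForm {Γ : Subgroup Mp2Z} {κ : ℤ} {Φ : ℍ → (Fin c → ℂ) → Δ → ℂ}
    {F : ℍ → D → ℂ} (hF : IsLift e Φ F) (hΦ : I.IsJacobiForm Γ κ Φ) (hG : I.IsGluing QD ι e)
    (hD : IsDiscriminantForm QD) (hgr : ∀ δ, ExpGrowthAtCusps fun τ => F τ δ) :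
    IsModularForm Γ (κ - I.S.rank) QD F where
  smooth := hF.contDiffOn hΦ.smooth
  modular _ hA _ hU τ := hF.modular hΦ hG hD hA hU τ
  growth := hgr

/-- F is constructed separately for each τ. Each component equals some `thetaCoeff` of Φ, so the
growth condition carries over unchanged. -/
theorem exists_isLift {Γ : Subgroup Mp2Z} {κ : ℤ} {Φ : ℍ → (Fin c → ℂ) → Δ → ℂ}
    (hΦ : I.IsJacobiForm Γ κ Φ) (hG : I.IsGluing QD ι e) (hD : IsDiscriminantForm QD) :
    ∃ F : ℍ → D → ℂ, IsModularForm Γ (κ - I.S.rank) QD F ∧ IsLift e Φ F := by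
  choose F hF hF' using fun τ => (hΦ.isElliptic τ).exists_arrow_eq hG (hΦ.holo τ)
  have h : IsLift e Φ F := hF
  refine ⟨F, h.isModularForm hΦ hG hD fun δ => ?_, h⟩
  obtain ⟨γ, hγ⟩ := exists_mem_gluePerp (ι := ι) (QD := QD) I.isDiscriminantForm_quad δ
  obtain ⟨a, ha, haγ⟩ := I.exists_cls γ
  have h1 : (fun τ => F τ δ) = I.thetaCoeff Φ (glueHom e ⟨_, hγ⟩) a := by
    funext τ
    rw [thetaCoeff_eq ha]
    exact hF' τ ⟨_, hγ⟩ ha haγ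
  rw [h1]
  exact hΦ.growth _ a ha

end Lift

end MatrixIndex

end JacobiMatrixIndex

namespace JacobiMatrixIndex

open QuadraticMap (polar)

/-! ### Holomorphy and periodicity of slashed modular forms -/

namespace Mp2Z

theorem root_T_pow (n : ℕ) (τ : ℍ) : (T ^ n).root τ = 1 := by
  induction n generalizing τ with
  | zero => rfl
  | succ n ih => rw [pow_succ, mul_root, root_T, mul_one, ih]

open UpperHalfPlane in
-- Normalizing cτ + d to be 1 at τ₀ makes the principal root holomorphic there. Its ratio to the
-- continuous root is ±1 nearby and equals 1 at τ₀.
theorem differentiableAt_root (A : Mp2Z) {τ₀ : ℂ} (hτ₀ : 0 < τ₀.im) :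
    DifferentiableAt ℂ (fun τ : ℂ => A.root (ofComplex τ)) τ₀ := by
  set r₀ := A.root (ofComplex τ₀) with hr₀
  have h0 : r₀ ≠ 0 := A.root_ne_zero _
  let J : ℂ → ℂ := fun τ => ((A.mat 1 0 : ℂ) * τ + A.mat 1 1) / r₀ ^ 2
  let s : ℂ → ℂ := fun τ => r₀ * J τ ^ (1 / 2 : ℂ)
  have hJ₀ : J τ₀ = 1 := by
    simp only [J]
    rw [hr₀, A.sq_root, autJ, ofComplex_apply_of_im_pos hτ₀]
    refine div_self ?_
    exact autJ_ne_zero A.mat ⟨τ₀, hτ₀⟩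
  have hs : DifferentiableAt ℂ s τ₀ := by
    refine DifferentiableAt.const_mul (DifferentiableAt.cpow_const ?_ ?_) _
    · simp only [J]
      fun_prop
    · rw [hJ₀]
      exact Complex.one_mem_slitPlane
  have hs₀ : s τ₀ = r₀ := by simp [s, hJ₀]
  have him : ∀ᶠ τ : ℂ in nhds τ₀, 0 < τ.im :=
    (isOpen_lt continuous_const Complex.continuous_im).mem_nhds hτ₀
  have hroot : ContinuousAt (fun τ : ℂ => A.root (ofComplex τ)) τ₀ := by
    refine A.continuous_root.continuousAt.comp ?_
    exact ((mdifferentiableAt_ofComplex hτ₀).continuousAt)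
  have hsne : s τ₀ ≠ 0 := by rw [hs₀]; exact h0
  have hq : ContinuousAt (fun τ => A.root (ofComplex τ) / s τ) τ₀ :=
    hroot.div hs.continuousAt hsne
  have hq₀ : A.root (ofComplex τ₀) / s τ₀ = 1 := by rw [hs₀]; exact div_self h0
  have hev : ∀ᶠ τ in nhds τ₀, A.root (ofComplex τ) / s τ ≠ -1 :=
    hq.eventually_ne (by rw [hq₀]; norm_num)
  refine hs.congr_of_eventuallyEq ?_
  filter_upwards [him, hev, hs.continuousAt.eventually_ne hsne] with τ h1 h2 h3
  have h4 : s τ ^ 2 = A.root (ofComplex τ) ^ 2 := by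
    have h5 : s τ ^ 2 = r₀ ^ 2 * J τ := by
      simp only [s]
      rw [mul_pow, ← Complex.cpow_nat_mul]
      norm_num
    have h6 : A.root (ofComplex τ) ^ 2 = (A.mat 1 0 : ℂ) * τ + A.mat 1 1 := by
      rw [A.sq_root, autJ, ofComplex_apply_of_im_pos h1]
    rw [h5, h6]
    exact mul_div_cancel₀ _ (pow_ne_zero 2 h0)
  have h5 : (A.root (ofComplex τ) / s τ) ^ 2 = 1 := by
    rw [div_pow, h4]
    exact div_self (pow_ne_zero 2 (A.root_ne_zero _))
  rcases (sq_eq_one_iff.1 h5) with h6 | h6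
  · exact (div_eq_one_iff_eq h3).1 h6
  · exact absurd h6 h2

end Mp2Z

section Slash

variable {D : Type*} [AddCommGroup D] {QD : QuadraticMap ℤ D (AddCircle (1 : ℚ))}

/-- The slash operator on vector valued functions on the upper half-plane. -/
def slashH (w : ℤ) (F : ℍ → D → ℂ) (A : Mp2Z) (τ : ℍ) : D → ℂ :=
  A.root τ ^ (-w) • F (A.mat • τ)

theorem qe_nsmul (n : ℕ) (x : AddCircle (1 : ℚ)) : qe (n • x) = qe x ^ n := by
  induction n with
  | zero => rw [zero_smul, qe_zero, pow_zero]
  | succ n ih => rw [succ_nsmul, qe_add, ih, pow_succ]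

theorem weilT_pow_apply (n : ℕ) (X : D → ℂ) (δ : D) :
    (weilT QD ^ n) X δ = qe (QD δ) ^ n * X δ := by
  induction n with
  | zero => simp
  | succ n ih => rw [pow_succ', Module.End.mul_apply, weilT_apply, ih, pow_succ', mul_assoc]

variable [Fintype D]

/-- |D|² · Q(δ) = Q(|D|δ) = 0. -/
theorem weilT_pow_card : weilT QD ^ (Fintype.card D * Fintype.card D) = 1 := by
  refine LinearMap.ext fun X => funext fun δ => ?_
  rw [weilT_pow_apply, ← qe_nsmul]
  have h := QuadraticMap.map_smul QD (Fintype.card D : ℤ) δ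
  rw [natCast_zsmul, card_nsmul_eq_zero, QuadraticMap.map_zero] at h
  have h1 : (Fintype.card D * Fintype.card D) • QD δ = 0 := by
    rw [h, ← natCast_zsmul]
    push_cast
    rfl
  rw [h1, qe_zero, one_mul]
  rfl

variable {Γ : Subgroup Mp2Z} {w : ℤ} {F : ℍ → D → ℂ}

/-- Modularity is applied to 1 ∈ Γ. This replaces any proof that `weilGraph` is the graph of a
function. -/
theorem IsModularForm.apply_eq_self (hF : IsModularForm Γ w QD F) {U : Module.End ℂ (D → ℂ)}
    (hU : (1, U) ∈ weilGraph QD) (τ : ℍ) : U (F τ) = F τ := by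
  have := hF.modular 1 Γ.one_mem U hU τ
  simpa using this.symm

theorem IsModularForm.apply_slashH (hF : IsModularForm Γ w QD F) {U : Module.End ℂ (D → ℂ)}
    (hU : (1, U) ∈ weilGraph QD) (A : Mp2Z) (τ : ℍ) : U (slashH w F A τ) = slashH w F A τ := by
  rw [slashH, map_smul, hF.apply_eq_self hU]

theorem exists_weilGraph_inv (QD : QuadraticMap ℤ D (AddCircle (1 : ℚ))) (A : Mp2Z) :
    ∃ U U' : Module.End ℂ (D → ℂ), (A, U) ∈ weilGraph QD ∧ (A⁻¹, U') ∈ weilGraph QD ∧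
      (1, U * U') ∈ weilGraph QD := by
  obtain ⟨U, hU⟩ := exists_mem_weilGraph QD A
  obtain ⟨U', hU'⟩ := exists_mem_weilGraph QD A⁻¹
  refine ⟨U, U', hU, hU', ?_⟩
  have := (weilGraph QD).mul_mem hU hU'
  rwa [Prod.mk_mul_mk, mul_inv_cancel] at this

/-- A power of A T^N A⁻¹ lies in Γ by finite index. With N = |D|² the power of T acts trivially, so
the conjugate acts through U U', which fixes F. -/
theorem IsModularForm.exists_period [Γ.FiniteIndex] (hF : IsModularForm Γ w QD F) (A : Mp2Z) :
    ∃ M : ℕ, 0 < M ∧ ∀ τ : ℍ, slashH w F A ((Mp2Z.T ^ M).mat • τ) = slashH w F A τ := by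
  obtain ⟨U, U', hU, hU', hUU'⟩ := exists_weilGraph_inv QD A
  set N := Fintype.card D * Fintype.card D with hN
  obtain ⟨n, hn, -, hmem⟩ := Subgroup.exists_pow_mem_of_index_ne_zero
    (H := Γ) Subgroup.FiniteIndex.index_ne_zero (A * Mp2Z.T ^ N * A⁻¹)
  rw [conj_pow, ← pow_mul] at hmem
  have hT : (Mp2Z.T ^ (N * n), (1 : Module.End ℂ (D → ℂ))) ∈ weilGraph QD := by
    have h1 : (Mp2Z.T, weilT QD) ∈ weilGraph QD := Submonoid.subset_closure (by simp)
    have h2 := (weilGraph QD).pow_mem h1 (N * n)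
    rwa [Prod.pow_mk, pow_mul (weilT QD), weilT_pow_card, one_pow] at h2
  have hB : (A * Mp2Z.T ^ (N * n) * A⁻¹, U * U') ∈ weilGraph QD := by
    have := (weilGraph QD).mul_mem ((weilGraph QD).mul_mem hU hT) hU'
    rwa [Prod.mk_mul_mk, Prod.mk_mul_mk, mul_one] at this
  refine ⟨N * n, Nat.mul_pos (Nat.mul_pos Fintype.card_pos Fintype.card_pos) hn, fun τ => ?_⟩
  have h := hF.modular _ hmem _ hB (A.mat • τ)
  rw [hF.apply_eq_self hUU'] at h
  have h1 : (A * Mp2Z.T ^ (N * n) * A⁻¹).mat • A.mat • τ =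
      A.mat • (Mp2Z.T ^ (N * n)).mat • τ := by
    rw [Mp2Z.mul_mat, Mp2Z.mul_mat, Mp2Z.inv_mat, mul_smul, inv_smul_smul, mul_smul]
  have h2 : (A * Mp2Z.T ^ (N * n) * A⁻¹).root (A.mat • τ) =
      A.root ((Mp2Z.T ^ (N * n)).mat • τ) * (A.root τ)⁻¹ := by
    rw [Mp2Z.mul_root, Mp2Z.mul_root, Mp2Z.inv_mat, Mp2Z.inv_root, inv_smul_smul,
      Mp2Z.root_T_pow, mul_one]
  rw [h1, h2] at h
  rw [slashH, slashH, h, smul_smul, mul_zpow, ← mul_assoc, ← zpow_add₀ (A.root_ne_zero _),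
    neg_add_cancel, zpow_zero, one_mul, inv_zpow, zpow_neg]

open UpperHalfPlane in
theorem HolomorphicOnH.slashH (hF : HolomorphicOnH F) (w : ℤ) (A : Mp2Z) :
    HolomorphicOnH (slashH w F A) := by
  refine differentiableOn_pi.2 fun δ τ₀ hτ₀ => DifferentiableAt.differentiableWithinAt ?_
  have h1 : DifferentiableAt ℂ (fun τ : ℂ => A.root (ofComplex τ) ^ (-w)) τ₀ :=
    (A.differentiableAt_root hτ₀).zpow (Or.inl (A.root_ne_zero _))
  have h2 : DifferentiableAt ℂ (fun τ : ℂ => F (A.mat • ofComplex τ) δ) τ₀ := by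
    have hdet : 0 < (A.mat : GL (Fin 2) ℝ).val.det := by
      have h := (Matrix.SpecialLinearGroup.map (Int.castRingHom ℝ) A.mat).det_coe
      exact h.symm ▸ one_pos
    have h3 := analyticAt_smul hdet ⟨τ₀, hτ₀⟩
    have h4 : DifferentiableAt ℂ (fun τ : ℂ => F (ofComplex τ) δ)
        ((A.mat • ofComplex τ₀ : ℍ) : ℂ) :=
      differentiableAt_pi.1 (hF.differentiableAt (isOpen_upperHalfPlaneSet.mem_nhds
        (A.mat • ofComplex τ₀).im_pos)) δ
    have h5 := h4.fun_comp' τ₀ h3.differentiableAt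
    simp only [ofComplex_apply] at h5
    exact h5
  exact h1.mul h2

end Slash

end JacobiMatrixIndex

namespace JacobiMatrixIndex

open QuadraticMap (polar)

theorem coe_T_pow_smul (n : ℕ) (τ : ℍ) : (((Mp2Z.T ^ n).mat • τ : ℍ) : ℂ) = τ + n := by
  rw [Mp2Z.mat_pow]
  have h := UpperHalfPlane.modular_T_zpow_smul τ n
  rw [zpow_natCast] at h
  change ((ModularGroup.T ^ n • τ : ℍ) : ℂ) = _
  rw [h, UpperHalfPlane.coe_vadd]
  push_cast
  ring

open UpperHalfPlane in
-- The function is holomorphic in q = 𝐞(τ/M) and extends over q = 0 by boundedness, so only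
-- non-negative exponents occur.
theorem exists_hasSum_of_bounded {E : ℍ → ℂ} {M : ℕ} (hM : 0 < M)
    (hE : DifferentiableOn ℂ (fun τ : ℂ => E (ofComplex τ)) upperHalfPlaneSet)
    (hper : ∀ τ : ℍ, E ((Mp2Z.T ^ M).mat • τ) = E τ) {C : ℝ}
    (hb : ∀ τ : ℍ, 1 ≤ τ.im → ‖E τ‖ ≤ C) :
    ∃ a : ℕ → ℂ, ∀ τ : ℍ, HasSum (fun n : ℕ => a n * ce (((n / M : ℚ) : ℂ) * τ)) (E τ) := by
  have hp : Function.Periodic (E ∘ ofComplex) ((M : ℝ) : ℂ) := by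
    intro w
    by_cases hw : 0 < w.im
    · have h1 : 0 < (w + ((M : ℝ) : ℂ)).im := by simpa using hw
      rw [Function.comp_apply, Function.comp_apply, ← hper (ofComplex w)]
      congr 1
      ext1
      rw [coe_T_pow_smul, ofComplex_apply_of_im_pos h1, ofComplex_apply_of_im_pos hw]
      simp
    -- Off the upper half-plane `ofComplex` takes a constant default value, so periodicity holds
    -- there trivially.
    · have h1 : (w + ((M : ℝ) : ℂ)).im ≤ 0 := by simpa using hw
      rw [Function.comp_apply, Function.comp_apply, ofComplex_apply_of_im_nonpos h1,
        ofComplex_apply_of_im_nonpos (not_lt.1 hw)]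
  have h := fun τ => hasSum_qExpansion (h := M) (Nat.cast_pos.2 hM) hp (mdifferentiable_iff.2 hE)
    (isBoundedAtImInfty_iff.2 ⟨C, 1, hb⟩) τ
  refine ⟨fun n => (qExpansion M E).coeff n, fun τ => ?_⟩
  convert h τ using 2 with n
  rw [smul_eq_mul, Function.Periodic.qParam, ← Complex.exp_nat_mul, ce]
  congr 2
  push_cast
  ring

variable {c : ℕ} {Δ : Type*} [AddCommGroup Δ]

namespace MatrixIndex

variable {Q : QuadraticMap ℤ Δ (AddCircle (1 : ℚ))} (I : MatrixIndex c Q)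

/-! ### Regular Fourier expansions -/

/-- The condition on the Fourier expansion of a holomorphic Jacobi form. -/
def IsRegular (h : ℍ → (Fin c → ℂ) → ℂ) : Prop :=
  ∃ coef : ℚ × (Fin c → ℚ) → ℂ,
    (∀ m r, coef (m, r) ≠ 0 → ∃ a : Fin c → ℚ, r = (2 : ℚ) • (I.S *ᵥ a) ∧ qform I.S a a ≤ m) ∧
    ∀ (τ : ℍ) (z : Fin c → ℂ),
      HasSum (fun p : ℚ × (Fin c → ℚ) =>
        coef p * ce ((p.1 : ℂ) * τ + ∑ i, (p.2 i : ℂ) * z i)) (h τ z)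

variable {I}

theorem IsRegular.zero : I.IsRegular fun _ _ => 0 :=
  ⟨0, by simp, fun τ z => by simp⟩

theorem IsRegular.add {f g : ℍ → (Fin c → ℂ) → ℂ} (hf : I.IsRegular f) (hg : I.IsRegular g) :
    I.IsRegular fun τ z => f τ z + g τ z := by
  obtain ⟨a, ha, ha'⟩ := hf
  obtain ⟨b, hb, hb'⟩ := hg
  refine ⟨a + b, fun m r h => ?_, fun τ z => ?_⟩
  · by_cases h1 : a (m, r) = 0
    · refine hb m r fun h2 => h ?_
      rw [Pi.add_apply, h1, h2, add_zero]
    · exact ha m r h1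
  · simpa only [Pi.add_apply, add_mul] using (ha' τ z).add (hb' τ z)

theorem IsRegular.const_mul {f : ℍ → (Fin c → ℂ) → ℂ} (hf : I.IsRegular f) (s : ℂ) :
    I.IsRegular fun τ z => s * f τ z := by
  obtain ⟨a, ha, ha'⟩ := hf
  refine ⟨s • a, fun m r h => ha m r (right_ne_zero_of_mul h), fun τ z => ?_⟩
  simpa only [Pi.smul_apply, smul_eq_mul, mul_assoc] using (ha' τ z).mul_left s

theorem IsRegular.sum {α : Type*} (s : Finset α) {f : α → ℍ → (Fin c → ℂ) → ℂ}
    (hf : ∀ i ∈ s, I.IsRegular (f i)) : I.IsRegular fun τ z => ∑ i ∈ s, f i τ z := by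
  classical
  induction s using Finset.induction_on with
  | empty => simpa using IsRegular.zero
  | insert i s hi ih =>
    simp_rw [Finset.sum_insert hi]
    exact (hf i (Finset.mem_insert_self _ _)).add
      (ih fun j hj => hf j (Finset.mem_insert_of_mem hj))

theorem linearMap_apply_eq_sum {M N : Type*} [Fintype M] [DecidableEq M]
    (V : (M → ℂ) →ₗ[ℂ] (N → ℂ)) (X : M → ℂ) (β : N) :
    V X β = ∑ i, V (Pi.single i 1) β * X i := by
  conv_lhs => rw [← Finset.univ_sum_single X, map_sum, Finset.sum_apply]
  refine Finset.sum_congr rfl fun i _ => ?_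
  have : (Pi.single i (X i) : M → ℂ) = X i • Pi.single i 1 := by
    rw [← Pi.single_smul, smul_eq_mul, mul_one]
  rw [this, map_smul, Pi.smul_apply, smul_eq_mul, mul_comm]

theorem IsRegular.linearMap {M N : Type*} [Fintype M] {f : ℍ → (Fin c → ℂ) → M → ℂ}
    (hf : ∀ i, I.IsRegular fun τ z => f τ z i) (V : (M → ℂ) →ₗ[ℂ] (N → ℂ)) (β : N) :
    I.IsRegular fun τ z => V (f τ z) β := by
  classical
  have h : (fun τ z => V (f τ z) β) = fun τ z => ∑ i, V (Pi.single i 1) β * f τ z i :=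
    funext₂ fun τ z => linearMap_apply_eq_sum V _ _
  rw [h]
  exact IsRegular.sum _ fun i _ => (hf i).const_mul _

variable [Fintype Δ]

/-- Products of theta functions and holomorphic `q`-expansions have regular expansions. -/
theorem isRegular_theta_mul [Fintype I.DOmega] {E : ℍ → ℂ} {M : ℕ} {b : ℕ → ℂ} (hM : 0 < M)
    (hE : ∀ τ : ℍ, HasSum (fun n : ℕ => b n * ce (((n / M : ℚ) : ℂ) * τ)) (E τ)) (γ : I.DOmega) :
    I.IsRegular fun τ z => I.theta τ z γ * E τ := by
  classical
  choose rp hrp hrp' using fun a : I.OmegaBarDual => exists_bcls a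
  let j : I.OmegaBarDual × ℕ → ℚ × (Fin c → ℚ) := fun p =>
    (qform I.S (rp p.1) (rp p.1) + p.2 / M, (2 : ℚ) • (I.S *ᵥ rp p.1))
  let g : I.OmegaBarDual × ℕ → ℂ := fun p => (if I.barToD p.1 = γ then 1 else 0) * b p.2
  have hMQ : (M : ℚ) ≠ 0 := by exact_mod_cast hM.ne'
  have hj : Function.Injective j := by
    rintro ⟨a, n⟩ ⟨a', n'⟩ h
    have h2 := congrArg Prod.snd h
    have h1 := congrArg Prod.fst h
    simp only [j] at h1 h2
    have h3 : I.S *ᵥ rp a = I.S *ᵥ rp a' := smul_right_injective _ (two_ne_zero (α := ℚ)) h2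
    have h4 : rp a' - rp a ∈ I.kerS := by rw [mem_kerS, Matrix.mulVec_sub, h3, sub_self]
    have h5 : a = a' := by rw [← hrp' a, ← hrp' a', bcls_eq_iff]; exact h4
    subst h5
    rw [add_right_inj, div_left_inj' hMQ, Nat.cast_inj] at h1
    rw [h1]
  -- Distinct pairs (a, n) give distinct exponents (aᵗSa + n/M, 2Sa), so each coefficient is a
  -- single product and is zero off the image of j.
  refine ⟨Function.extend j g 0, fun m r h => ?_, fun τ z => ?_⟩
  · by_cases hr : ∃ p, j p = (m, r)
    · obtain ⟨p, hp⟩ := hr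
      refine ⟨rp p.1, (congrArg Prod.snd hp).symm, ?_⟩
      have := congrArg Prod.fst hp
      simp only [j] at this
      rw [← this]
      exact le_add_of_nonneg_right (by positivity)
    · rw [Function.extend_apply' _ _ _ hr] at h
      exact absurd rfl h
  · rw [← hj.hasSum_iff]
    · have h1 : HasSum (fun a => (if I.barToD a = γ then 1 else 0) * I.thetaTerm τ z a)
          (I.theta τ z γ) := by
        have := I.hasSum_sum_theta (Pi.single γ 1) τ z
        simpa [Pi.single_apply] using this
      have h2 := hE τ
      have h3 := summable_mul_of_summable_norm h1.summable.norm h2.summable.norm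
      have h4 := h1.mul h2 h3
      refine h4.congr_fun fun p => ?_
      rw [Function.comp_apply, hj.extend_apply]
      have h5 : I.thetaTerm τ z p.1 = I.thetaExp τ z (rp p.1) := by
        conv_lhs => rw [← hrp' p.1, thetaTerm_bcls]
      have h6 : ∑ i, ((j p).2 i : ℂ) * z i = 2 * cform I.S (ratVec (rp p.1)) z := by
        rw [Frame.cform_v, Finset.mul_sum]
        refine Finset.sum_congr rfl fun i _ => ?_
        simp only [j, Pi.smul_apply, smul_eq_mul]
        rw [qform, single_dotProduct, one_mul]
        push_cast
        ring
      rw [h6, h5, thetaExp]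
      simp only [j, g]
      rw [show ((qform I.S (rp p.1) (rp p.1) + p.2 / M : ℚ) : ℂ) * τ +
          2 * cform I.S (ratVec (rp p.1)) z = (τ * (qform I.S (rp p.1) (rp p.1) : ℂ) +
          2 * cform I.S (ratVec (rp p.1)) z) + ((p.2 / M : ℚ) : ℂ) * τ by push_cast; ring, ce_add]
      ring
    · intro p hp
      rw [Function.extend_apply' _ _ _ hp, Pi.zero_apply, zero_mul]

/-! ### Behaviour at the cusps -/

section Cusps

variable [Fintype I.DOmega] {D : Type*} [AddCommGroup D] {QD : QuadraticMap ℤ D (AddCircle (1 : ℚ))}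
  {HD : AddSubgroup D} {ι : I.HOmega ≃+ HD} {e : I.DeltaH QD ι ≃+ Δ} [Fintype D]

/-- F|A equals U U'(F|A), so the transformation rule of Θ ⊗ · under A, applied to U'(F|A), expresses
Φ|A at the cusp. -/
theorem IsLift.slash_eq {κ : ℤ} {Φ : ℍ → (Fin c → ℂ) → Δ → ℂ} {F : ℍ → D → ℂ}
    {Γ : Subgroup Mp2Z} (hL : IsLift e Φ F) (hF : IsModularForm Γ (κ - I.S.rank) QD F)
    (hG : I.IsGluing QD ι e) (hD : IsDiscriminantForm QD) (A : Mp2Z) :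
    ∃ (U' : Module.End ℂ (D → ℂ)) (V : Module.End ℂ (Δ → ℂ)), ∀ τ z, I.slash κ Φ A τ z =
      V (arrow (glueHom e) (tens (I.theta τ z) (U' (slashH (κ - I.S.rank) F A τ)))) := by
  obtain ⟨U, U', hU, -, hUU'⟩ := exists_weilGraph_inv QD A
  obtain ⟨V, -, hV⟩ := hG.exists_arrow_smul hD hU
  refine ⟨U', V, fun τ z => ?_⟩
  have h1 := hV κ τ z (U' (slashH (κ - I.S.rank) F A τ))
  have h2 : U (U' (slashH (κ - I.S.rank) F A τ)) = slashH (κ - I.S.rank) F A τ :=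
    hF.apply_slashH hUU' A τ
  rw [h2, slashH, smul_smul, ← zpow_add₀ (A.root_ne_zero τ), add_neg_cancel, zpow_zero, one_smul,
    ← hL] at h1
  rw [slash, h1, smul_smul, mul_mul_mul_comm, ← zpow_add₀ (A.root_ne_zero τ), neg_add_cancel,
    zpow_zero, one_mul, ← ce_add, neg_add_cancel, ce_zero, one_smul]
  rfl

/-- The converse direction: the rule for A⁻¹ is applied at Aτ, which recovers Θ ⊗ U'(F|A) from Φ|A.
-/
theorem IsLift.arrow_eq {κ : ℤ} {Φ : ℍ → (Fin c → ℂ) → Δ → ℂ} {F : ℍ → D → ℂ}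
    {Γ : Subgroup Mp2Z} (hL : IsLift e Φ F) (hF : IsModularForm Γ (κ - I.S.rank) QD F)
    (hG : I.IsGluing QD ι e) (hD : IsDiscriminantForm QD) (A : Mp2Z) :
    ∃ (U U' : Module.End ℂ (D → ℂ)) (V' : Module.End ℂ (Δ → ℂ)),
      (∀ τ, U (U' (slashH (κ - I.S.rank) F A τ)) = slashH (κ - I.S.rank) F A τ) ∧
      ∀ τ z, arrow (glueHom e) (tens (I.theta τ z) (U' (slashH (κ - I.S.rank) F A τ))) =
        V' (I.slash κ Φ A τ z) := by
  obtain ⟨U, U', hU, hU', hUU'⟩ := exists_weilGraph_inv QD A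
  obtain ⟨V', -, hV'⟩ := hG.exists_arrow_smul hD hU'
  refine ⟨U, U', V', fun τ => hF.apply_slashH hUU' A τ, fun τ z => ?_⟩
  have h1 := hV' κ (A.mat • τ) ((autJ A.mat τ)⁻¹ • z) (F (A.mat • τ))
  have hj := autJ_ne_zero A.mat τ
  have h2 : autJ A.mat⁻¹ (A.mat • τ) = (autJ A.mat τ)⁻¹ := by
    have := autJ_mul A.mat⁻¹ A.mat τ
    rw [inv_mul_cancel] at this
    refine eq_inv_of_mul_eq_one_left ?_
    rw [← this]
    simp [autJ]
  have h3 : (A.mat⁻¹ 1 0 : ℤ) = -A.mat 1 0 := by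
    rw [Matrix.SpecialLinearGroup.SL2_inv_expl]
    rfl
  rw [Mp2Z.inv_mat, Mp2Z.inv_root, inv_smul_smul, h2, inv_inv, smul_smul, mul_inv_cancel₀ hj,
    one_smul, h3, ← hL, cform_smul_left, cform_smul_right, inv_zpow', inv_zpow'] at h1
  rw [slashH, map_smul, h1, slash, map_smul]
  congr 3
  rw [div_inv_eq_mul]
  field_simp
  push_cast
  ring

theorem IsLift.holomorphicAtCusps {κ : ℤ} {Φ : ℍ → (Fin c → ℂ) → Δ → ℂ} {F : ℍ → D → ℂ}
    {Γ : Subgroup Mp2Z} [Γ.FiniteIndex] (hL : IsLift e Φ F)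
    (hF : IsModularForm Γ (κ - I.S.rank) QD F)
    (hG : I.IsGluing QD ι e) (hD : IsDiscriminantForm QD) (hhol : HolomorphicOnH F)
    (hb : BoundedAtCusps (κ - I.S.rank) F) : I.HolomorphicAtCusps κ Φ := by
  intro A β
  obtain ⟨U', V, h⟩ := hL.slash_eq hF hG hD A
  obtain ⟨M, hM, hper⟩ := hF.exists_period A
  obtain ⟨C, hC⟩ := hb A
  have hreg : ∀ α : I.DOmega × D, I.IsRegular fun τ z =>
      tens (I.theta τ z) (slashH (κ - I.S.rank) F A τ) α := fun α => by
    obtain ⟨b, hb⟩ := exists_hasSum_of_bounded (E := fun τ => slashH (κ - I.S.rank) F A τ α.2) hM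
      (differentiableOn_pi.1 (hhol.slashH (κ - I.S.rank) A) α.2)
      (fun τ => congrFun (hper τ) α.2) (fun τ hτ => hC τ hτ α.2)
    exact isRegular_theta_mul hM hb α.1
  have hreg' : ∀ α : I.DOmega × D, I.IsRegular fun τ z =>
      tens (I.theta τ z) (U' (slashH (κ - I.S.rank) F A τ)) α := fun α => by
    classical
    have h1 : ∀ τ z, tens (I.theta τ z) (U' (slashH (κ - I.S.rank) F A τ)) α =
        ∑ δ, U' (Pi.single δ 1) α.2 * tens (I.theta τ z) (slashH (κ - I.S.rank) F A τ) (α.1, δ) := by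
      intro τ z
      rw [tens, linearMap_apply_eq_sum U', Finset.mul_sum]
      exact Finset.sum_congr rfl fun δ _ => mul_left_comm _ _ _
    simp_rw [h1]
    exact IsRegular.sum _ fun δ _ => (hreg (α.1, δ)).const_mul _
  have h2 : (fun τ z => I.slash κ Φ A τ z β) = fun τ z => (V ∘ₗ arrow (glueHom e))
      (tens (I.theta τ z) (U' (slashH (κ - I.S.rank) F A τ))) β := by
    funext τ z
    rw [h]
    rfl
  have h3 := IsRegular.linearMap hreg' (V ∘ₗ arrow (glueHom e)) β
  rw [← h2] at h3
  exact h3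

end Cusps

end MatrixIndex

end JacobiMatrixIndex

namespace JacobiMatrixIndex

open QuadraticMap (polar)

variable {c : ℕ} {Δ : Type*} [AddCommGroup Δ]

namespace MatrixIndex

variable {Q : QuadraticMap ℤ Δ (AddCircle (1 : ℚ))} {I : MatrixIndex c Q}

/-! ### Boundedness at the cusps -/

section Bounded

theorem norm_ce_real {x : ℂ} (hx : x.im = 0) : ‖ce x‖ = 1 := by
  rw [norm_ce, hx]
  simp

theorem im_sum_shift (τ : ℍ) (m : ℚ) (r a : Fin c → ℚ) (N : ℕ) (x : Fin c → ℝ) :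
    ((m : ℂ) * τ + ∑ i, (r i : ℂ) * ((-((τ : ℂ) • ratVec a) + scaledVec N x : Fin c → ℂ) i)).im =
      τ.im * ((m - ∑ i, r i * a i : ℚ) : ℝ) := by
  have h : (m : ℂ) * τ + ∑ i, (r i : ℂ) * ((-((τ : ℂ) • ratVec a) + scaledVec N x : Fin c → ℂ) i) =
      (((m - ∑ i, r i * a i : ℚ) : ℝ) : ℂ) * τ + ((∑ i, (r i : ℝ) * (N * x i) : ℝ) : ℂ) := by
    push_cast
    rw [sub_mul, sub_add, sub_eq_add_neg, Finset.sum_mul, ← Finset.sum_sub_distrib,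
      ← Finset.sum_neg_distrib]
    congr 1
    refine Finset.sum_congr rfl fun i _ => ?_
    simp only [scaledVec, ratVec, Pi.add_apply, Pi.neg_apply, Pi.smul_apply, smul_eq_mul]
    ring
  rw [h, Complex.add_im, Complex.ofReal_im, add_zero, Complex.im_ofReal_mul, mul_comm]
  rfl

/-- With r = 2Sa', the expression is m - a'ᵗSa' plus the value of the form at a' - a. -/
theorem sub_add_qform_nonneg {m : ℚ} {r a : Fin c → ℚ}
    (h : ∃ a' : Fin c → ℚ, r = (2 : ℚ) • (I.S *ᵥ a') ∧ qform I.S a' a' ≤ m) :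
    0 ≤ m - ∑ i, r i * a i + qform I.S a a := by
  obtain ⟨a', rfl, ha'⟩ := h
  have h1 : ∑ i, ((2 : ℚ) • (I.S *ᵥ a')) i * a i = 2 * qform I.S a a' := by
    rw [qform, dotProduct, Finset.mul_sum]
    refine Finset.sum_congr rfl fun i _ => ?_
    rw [Pi.smul_apply, smul_eq_mul]
    ring
  have h2 := I.qform_nonneg (a' + (-1 : ℚ) • a)
  rw [qform_add_left, qform_add_right, qform_add_right, qform_smul_left, qform_smul_right,
    qform_smul_left, qform_smul_right, I.qform_comm a' a] at h2
  rw [h1]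
  linarith

variable [Fintype Δ]

open MeasureTheory in
/-- Functions whose product with a theta term is a Fourier coefficient of a function with a regular
expansion are bounded. -/
theorem IsRegular.exists_bound {h : ℍ → (Fin c → ℂ) → ℂ} (hh : I.IsRegular h) {a : Fin c → ℚ}
    (ha : a ∈ I.omegaDual) {G : ℍ → ℂ}
    (hG : ∀ τ z, ∫ x in (Set.Icc 0 1 : Set (Fin c → ℝ)),
      h τ (z + scaledVec (Fintype.card Δ) x) *
        ce (-(2 * cform I.S (ratVec a) (scaledVec (Fintype.card Δ) x))) =
      G τ * I.thetaExp τ z a) : ∃ C : ℝ, ∀ τ : ℍ, 1 ≤ τ.im → ‖G τ‖ ≤ C := by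
  obtain ⟨coef, hcoef, hsum⟩ := hh
  set q : ℚ := qform I.S a a with hq
  let ex : ℚ × (Fin c → ℚ) → ℚ := fun p => p.1 - ∑ i, p.2 i * a i
  -- These are the absolute values of the terms at τ = i, rescaled by 𝐞(i aᵗSa). Since the exponents
  -- are non-negative, they dominate the rescaled terms for all Im τ ≥ 1.
  let t : ℚ × (Fin c → ℚ) → ℝ := fun p => ‖coef p‖ * Real.exp (-(2 * Real.pi * ((ex p + q : ℚ) : ℝ)))
  have hterm : ∀ (τ : ℍ) (x : Fin c → ℝ) p, ‖coef p * ce ((p.1 : ℂ) * τ + ∑ i, (p.2 i : ℂ) *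
      ((-((τ : ℂ) • ratVec a) + scaledVec (Fintype.card Δ) x : Fin c → ℂ) i))‖ =
      ‖coef p‖ * Real.exp (-(2 * Real.pi * (τ.im * (ex p : ℝ)))) := fun τ x p => by
    rw [norm_mul, norm_ce, im_sum_shift]
  have ht : Summable t := by
    have h1 := (hsum UpperHalfPlane.I
      (-((UpperHalfPlane.I : ℂ) • ratVec a) + scaledVec (Fintype.card Δ) 0)).summable.norm
    simp_rw [hterm, UpperHalfPlane.I_im, one_mul] at h1
    refine (h1.mul_right (Real.exp (-(2 * Real.pi * (q : ℝ))))).congr fun p => ?_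
    simp only [t]
    rw [mul_assoc, ← Real.exp_add]
    push_cast
    congr 2
    ring
  have hbound : ∀ (τ : ℍ) (x : Fin c → ℝ), 1 ≤ τ.im →
      ‖h τ (-((τ : ℂ) • ratVec a) + scaledVec (Fintype.card Δ) x)‖ ≤
        (∑' p, t p) * Real.exp (2 * Real.pi * (τ.im * q)) := fun τ x hτ => by
    rw [← (hsum τ _).tsum_eq]
    refine tsum_of_norm_bounded (ht.hasSum.mul_right _) fun p => ?_
    rw [hterm]
    simp only [t]
    rw [mul_assoc ‖coef p‖, ← Real.exp_add]
    by_cases h0 : coef p = 0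
    · simp [h0]
    · refine mul_le_mul_of_nonneg_left (Real.exp_le_exp.2 ?_) (norm_nonneg _)
      have h1 : (0 : ℝ) ≤ ((ex p + q : ℚ) : ℝ) := by
        exact_mod_cast sub_add_qform_nonneg (hcoef p.1 p.2 h0)
      have h2 := mul_nonneg (sub_nonneg.2 hτ) h1
      have h3 := mul_nonneg Real.two_pi_pos.le h2
      push_cast at h3 ⊢
      linarith
  refine ⟨∑' p, t p, fun τ hτ => ?_⟩
  -- At z = -τa the theta term is 𝐞(-τ aᵗSa), whose absolute value is exactly the growth factor in
  -- `hbound`, so the two cancel.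
  have h1 := hG τ (-((τ : ℂ) • ratVec a))
  have h2 : I.thetaExp τ (-((τ : ℂ) • ratVec a)) a = ce (-((τ : ℂ) * (q : ℂ))) := by
    rw [thetaExp, ← neg_smul, cform_smul_right, cform_ratVec]
    congr 1
    ring
  have h3 : ‖ce (-((τ : ℂ) * (q : ℂ)))‖ = Real.exp (2 * Real.pi * (τ.im * q)) := by
    rw [norm_ce]
    congr 1
    have : (τ : ℂ) * (q : ℂ) = ((q : ℝ) : ℂ) * τ := by push_cast; ring
    rw [this, Complex.neg_im, Complex.im_ofReal_mul]
    change -(2 * Real.pi * -((q : ℝ) * τ.im)) = _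
    ring
  have hvol : (volume (Set.Icc 0 1 : Set (Fin c → ℝ))) = 1 := by
    rw [Real.volume_Icc_pi]
    simp
  have h4 := norm_setIntegral_le_of_norm_le_const (μ := volume)
    (s := (Set.Icc 0 1 : Set (Fin c → ℝ))) (by rw [hvol]; exact ENNReal.one_lt_top)
    (fun x _ => show ‖h τ (-((τ : ℂ) • ratVec a) + scaledVec (Fintype.card Δ) x) *
        ce (-(2 * cform I.S (ratVec a) (scaledVec (Fintype.card Δ) x)))‖ ≤
        (∑' p, t p) * Real.exp (2 * Real.pi * (τ.im * q)) by
      rw [norm_mul, I.two_cform_scaledVec ha, norm_ce_real (by simp), mul_one]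
      exact hbound τ x hτ)
  rw [h1, h2, norm_mul, h3, Measure.real, hvol, ENNReal.toReal_one, mul_one] at h4
  exact le_of_mul_le_mul_right h4 (Real.exp_pos _)

variable [Fintype I.DOmega] {D : Type*} [AddCommGroup D] {QD : QuadraticMap ℤ D (AddCircle (1 : ℚ))}
  {HD : AddSubgroup D} {ι : I.HOmega ≃+ HD} {e : I.DeltaH QD ι ≃+ Δ} [Fintype D]

/-- The components of U'(F|A) are Fourier coefficients of a linear image of Φ|A, hence bounded, and
applying U recovers F|A. -/
theorem IsLift.boundedAtCusps {κ : ℤ} {Φ : ℍ → (Fin c → ℂ) → Δ → ℂ} {F : ℍ → D → ℂ}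
    {Γ : Subgroup Mp2Z} (hL : IsLift e Φ F) (hF : IsModularForm Γ (κ - I.S.rank) QD F)
    (hG : I.IsGluing QD ι e) (hD : IsDiscriminantForm QD) (hreg : I.HolomorphicAtCusps κ Φ) :
    BoundedAtCusps (κ - I.S.rank) F := by
  classical
  intro A
  obtain ⟨U, U', V', hU, h⟩ := hL.arrow_eq hF hG hD A
  set G : ℍ → D → ℂ := fun τ => U' (slashH (κ - I.S.rank) F A τ) with hGdef
  have hb : ∀ δ, ∃ C : ℝ, ∀ τ : ℍ, 1 ≤ τ.im → ‖G τ δ‖ ≤ C := fun δ => by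
    obtain ⟨γ, hγ⟩ := exists_mem_gluePerp (ι := ι) (QD := QD) I.isDiscriminantForm_quad δ
    obtain ⟨a, ha, haγ⟩ := I.exists_cls γ
    have h1 : I.IsRegular fun τ z => V' (I.slash κ Φ A τ z) (glueHom e ⟨_, hγ⟩) :=
      IsRegular.linearMap (fun β => hreg A β) V' _
    refine h1.exists_bound ha (G := fun τ => G τ δ) fun τ z => ?_
    simp_rw [← h, arrow_tens]
    rw [I.integral_sum_theta _ τ z ha, haγ]
    exact congrArg (fun s => s * I.thetaExp τ z a) (glueCoef_of_mem (G τ) ⟨_, hγ⟩)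
  choose C hC using hb
  -- Summing over δ' as well gives one bound valid for all components.
  refine ⟨∑ δ', ∑ δ, ‖U (Pi.single δ 1) δ'‖ * C δ, fun τ hτ δ' => ?_⟩
  have h1 : A.root τ ^ (-(κ - (I.S.rank : ℤ))) * F (A.mat • τ) δ' = U (G τ) δ' :=
    (congrFun (hU τ) δ').symm
  have h2 : ∀ δ', ‖U (G τ) δ'‖ ≤ ∑ δ, ‖U (Pi.single δ 1) δ'‖ * C δ := fun δ' => by
    rw [linearMap_apply_eq_sum U]
    refine norm_sum_le_of_le _ fun δ _ => ?_
    rw [norm_mul]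
    exact mul_le_mul_of_nonneg_left (hC δ τ hτ) (norm_nonneg _)
  rw [h1]
  exact (h2 δ').trans (Finset.single_le_sum (f := fun δ' => ∑ δ, ‖U (Pi.single δ 1) δ'‖ * C δ)
    (fun δ' _ => (norm_nonneg _).trans (h2 δ')) (Finset.mem_univ δ'))

end Bounded

end MatrixIndex

end JacobiMatrixIndex

end

open JacobiMatrixIndex

/-! ### The theorem -/

theorem mainTheorem6
    {c : ℕ} {Δ : Type*} [AddCommGroup Δ] [Fintype Δ]
    (QΔ : QuadraticMap ℤ Δ (AddCircle (1 : ℚ))) (hΔ : IsDiscriminantForm QΔ)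
    (I : MatrixIndex c QΔ)
    {D : Type*} [AddCommGroup D] [Fintype D]
    (QD : QuadraticMap ℤ D (AddCircle (1 : ℚ))) (hD : IsDiscriminantForm QD)
    -- a subgroup of `D` that is isomorphic to `H_Ω` with the opposite quadratic form
    (HD : AddSubgroup D) (ι : I.HOmega ≃+ HD)
    (hι : ∀ γ : I.HOmega, QD (ι γ : D) = -I.quad (γ : I.DOmega))
    -- an isomorphism of discriminant forms between `Δ_H` and `Δ` that is compatible with the
    -- embeddings of `D_{Ω,S}`, the image of `ℤ^c`, into both
    (e : I.DeltaH QD ι ≃+ Δ)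
    (he_quad : ∀ α : I.gluePerp QD ι, QΔ (e (I.toDeltaH QD ι α)) = I.quad.prod QD α.1)
    (he_emb : ∀ u : Fin c → ℤ, e (I.intToDeltaH QD ι u) = I.ψ u)
    (Γ : Subgroup Mp2Z) [Γ.FiniteIndex] (κ : ℤ)
    (Φ : ℍ → (Fin c → ℂ) → Δ → ℂ) (hΦ : I.IsJacobiForm Γ κ Φ) :
    ∃ F : ℍ → D → ℂ,
      (IsModularForm Γ (κ - I.S.rank) QD F ∧
        ∀ τ z, Φ τ z = I.arrowDown QD ι e fun α => I.theta τ z α.1 * F τ α.2) ∧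
      (∀ F' : ℍ → D → ℂ, IsModularForm Γ (κ - I.S.rank) QD F' →
        (∀ τ z, Φ τ z = I.arrowDown QD ι e fun α => I.theta τ z α.1 * F' τ α.2) → F' = F) ∧
      (HolomorphicOnH F ↔ JointlyHolomorphic Φ) ∧
      ((HolomorphicOnH F ∧ BoundedAtCusps (κ - I.S.rank) F) ↔
        (JointlyHolomorphic Φ ∧ I.HolomorphicAtCusps κ Φ)) := by
  classical
  have := I.finite_DOmega
  have := Fintype.ofFinite I.DOmega
  have hG : I.IsGluing QD ι e := ⟨hι, he_quad, he_emb⟩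
  obtain ⟨F, hF, hL⟩ := MatrixIndex.exists_isLift hΦ hG hD
  have hhol : HolomorphicOnH F ↔ JointlyHolomorphic Φ := ⟨hL.jointlyHolomorphic, hL.holomorphicOnH⟩
  refine ⟨F, ⟨hF, fun τ z => ?_⟩, fun F' _ hF' => ?_, hhol, ?_⟩
  · rw [MatrixIndex.arrowDown_eq]
    exact hL τ z
  · funext τ
    refine MatrixIndex.eq_of_arrow_theta_eq (e := e) (τ := τ) fun z => ?_
    have h := hF' τ z
    rw [MatrixIndex.arrowDown_eq] at h
    exact h.symm.trans (hL τ z)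
  · exact ⟨fun h => ⟨hhol.1 h.1, hL.holomorphicAtCusps hF hG hD h.1 h.2⟩,
      fun h => ⟨hhol.2 h.1, hL.boundedAtCusps hF hG hD h.2⟩⟩
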